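/- Let $M$ be a smooth manifold and let $E$ be a quaternionic vector bundle over $M$, that is, a smooth real vector bundle with typical fibre $\mathbb{H}^k$ and structural group $\mathrm{Sp}(1)\cdot\mathrm{GL}(k,\mathbb{H})$ acting on $\mathbb{H}^k$ by $q\mapsto aqA^{-1}$. Let $\pi:Z\to M$ be the bundle of admissible linear complex structures of $E$: its elements are the $J\in\mathrm{End}(E_x)$, $x\in M$, which, with respect to the admissible frames, are the left multiplications by imaginary quaternions of norm one; the fibres of $Z$ are the unit spheres of the oriented rank three bundle $Q\subseteq\mathrm{End}(E)$ of left multiplications by imaginary quaternions, and the complex structure of $Z_x$ is $V\mapsto J\circ V$ on $T_JZ_x=\{V\in Q_x : JV=-VJ\}$. Let $\rho:E\to TM$ be a surjective morphism of vector bundles whose kernel contains no nonzero subspace preserved by some admissible linear complex structure; that is, $(M,E,\rho)$ is an almost co-CR quaternionic manifold. Let $\nabla$ be a connection on $E$ compatible with its structural group. For $J\in Z$, denote $E^J=\ker(J+\mathrm{i})\subseteq E_{\pi(J)}\otimes\mathbb{C}$, and let $\mathcal{B}_J\subseteq T_J^{\mathbb{C}}Z$ be the horizontal lift of $\rho(E^J)\subseteq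 T^{\mathbb{C}}_{\pi(J)}M$ with respect to $\nabla$. Let $\mathcal{C}=(\ker\mathrm{d}\pi)^{0,1}\oplus\mathcal{B}$ be the induced almost co-CR structure on $Z$. Let $R$ be the curvature form of $\nabla$, and let $T$ be the torsion of $\nabla$ with respect to $\rho$, that is, the section of $TM\otimes\Lambda^2E^*$ such that $$T(s_1,s_2)=\rho\bigl(\nabla_{\rho s_1}s_2-\nabla_{\rho s_2}s_1\bigr)-[\rho s_1,\rho s_2]$$ for any local sections $s_1,s_2$ of $E$; $\rho$, $R$ and $T$ are extended complex multilinearly. Then the following assertions are equivalent: (i) $\mathcal{C}$ is integrable, that is, the space of its smooth local sections is closed under the Lie bracket; (ii) for any $J\in Z$ we have $R\bigl(\Lambda^2(\rho(E^J))\bigr)(E^J)\subseteq E^J$ and $T\bigl(\Lambda^2(E^J)\bigr)\subseteq\rho(E^J)$. -/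

import Mathlib

open scoped Manifold ContDiff Quaternion TensorProduct Topology
open Bundle

noncomputable section

/-! ### The structural group `Sp(1)·GL(k,ℍ)` -/

/-- The typical fibre `ℍᵏ`, as a real vector space. -/
abbrev HVec (k : ℕ) : Type := Fin k → ℍ[ℝ]

/-- Left multiplication `q ↦ p q` on `ℍᵏ` by a quaternion `p`. -/
def leftMul (k : ℕ) (p : ℍ[ℝ]) : HVec k →L[ℝ] HVec k :=
  ContinuousLinearMap.pi fun i =>
    (ContinuousLinearMap.mul ℝ ℍ[ℝ] p).comp (ContinuousLinearMap.proj i)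

/-- The group `Sp(1)·GL(k,ℍ)`, acting on (row vectors of) `ℍᵏ` by `q ↦ a q A⁻¹`. -/
def SpGL (k : ℕ) : Subgroup (HVec k ≃L[ℝ] HVec k) where
  carrier := {g | ∃ a : ℍ[ℝ], ‖a‖ = 1 ∧ ∃ A : (Matrix (Fin k) (Fin k) ℍ[ℝ])ˣ,
    ∀ q : HVec k, g q = leftMul k a (Matrix.vecMul q (A⁻¹).val)}
  one_mem' := ⟨1, by simp, 1, fun q => by
    change q = _
    ext1 i
    simp [leftMul]⟩
  mul_mem' := by
    rintro g h ⟨a, ha, A, hg⟩ ⟨b, hb, B, hh⟩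
    refine ⟨a * b, by simp [ha, hb], A * B, fun q => ?_⟩
    have key : ∀ (c : ℍ[ℝ]) (v : HVec k) (C : Matrix (Fin k) (Fin k) ℍ[ℝ]),
        Matrix.vecMul (leftMul k c v) C = leftMul k c (Matrix.vecMul v C) := by
      intro c v C
      ext1 i
      simp [leftMul, Matrix.vecMul, dotProduct, mul_assoc]
    change g (h q) = _
    rw [hh, hg, key, Matrix.vecMul_vecMul]
    ext1 i
    simp [leftMul, mul_assoc]
  inv_mem' := by
    rintro g ⟨a, ha, A, hg⟩
    have ha0 : a ≠ 0 := by rintro rfl; simp at ha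
    have key : ∀ (c : ℍ[ℝ]) (v : HVec k) (C : Matrix (Fin k) (Fin k) ℍ[ℝ]),
        Matrix.vecMul (leftMul k c v) C = leftMul k c (Matrix.vecMul v C) := by
      intro c v C
      ext1 i
      simp [leftMul, Matrix.vecMul, dotProduct, mul_assoc]
    refine ⟨a⁻¹, by simp [ha], A⁻¹, fun q => ?_⟩
    apply g.injective
    rw [hg (leftMul k a⁻¹ _), inv_inv, key, Matrix.vecMul_vecMul, Units.mul_inv]
    change g (g.symm q) = _
    rw [g.apply_symm_apply]
    ext1 i
    simp [leftMul, ha0]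

/-- The Lie algebra of `Sp(1)·GL(k,ℍ)`, acting on `ℍᵏ`: the endomorphisms `q ↦ a q - q A`, with
`a` an imaginary quaternion and `A` a quaternionic `k × k` matrix. -/
def spglLie (k : ℕ) : Set (HVec k → HVec k) :=
  {f | ∃ a : ℍ[ℝ], a.re = 0 ∧ ∃ A : Matrix (Fin k) (Fin k) ℍ[ℝ],
    ∀ q : HVec k, f q = leftMul k a q - Matrix.vecMul q A}

/-! ### Complexification -/

/-- The complex vector `a + i b` of the complexification of a real vector space. -/
def cvec {V : Type*} [AddCommGroup V] [Module ℝ V] (a b : V) : ℂ ⊗[ℝ] V :=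
  (1 : ℂ) ⊗ₜ[ℝ] a + Complex.I ⊗ₜ[ℝ] b

/-- The complex bilinear extension of a real bilinear map. -/
def complexify₂ {U V W : Type*} [AddCommGroup U] [Module ℝ U] [AddCommGroup V] [Module ℝ V]
    [AddCommGroup W] [Module ℝ W] :
    (U →ₗ[ℝ] V →ₗ[ℝ] W) →ₗ[ℝ] ((ℂ ⊗[ℝ] U) →ₗ[ℂ] (ℂ ⊗[ℝ] V) →ₗ[ℂ] (ℂ ⊗[ℝ] W)) :=
  ((LinearMap.liftBaseChangeEquiv (R := ℝ) ℂ (M := U)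
      (N := (ℂ ⊗[ℝ] V) →ₗ[ℂ] (ℂ ⊗[ℝ] W))).toLinearMap.restrictScalars ℝ).comp
    ((LinearMap.llcomp ℝ U (V →ₗ[ℝ] W) ((ℂ ⊗[ℝ] V) →ₗ[ℂ] (ℂ ⊗[ℝ] W)))
      (LinearMap.baseChangeHom ℝ ℂ V W))

/-- The complex trilinear extension of a real trilinear map. -/
def complexify₃ {T U V W : Type*} [AddCommGroup T] [Module ℝ T] [AddCommGroup U] [Module ℝ U]
    [AddCommGroup V] [Module ℝ V] [AddCommGroup W] [Module ℝ W]
    (B : T →ₗ[ℝ] U →ₗ[ℝ] V →ₗ[ℝ] W) :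
    (ℂ ⊗[ℝ] T) →ₗ[ℂ] (ℂ ⊗[ℝ] U) →ₗ[ℂ] (ℂ ⊗[ℝ] V) →ₗ[ℂ] (ℂ ⊗[ℝ] W) :=
  LinearMap.liftBaseChange ℂ (complexify₂.comp B)

/-! ### Connections on a vector bundle: torsion with respect to an anchor, curvature -/

section Connection

set_option linter.unusedSectionVars false

variable {B : Type*} [NormedAddCommGroup B] [NormedSpace ℝ B] [FiniteDimensional ℝ B]
  {H : Type*} [TopologicalSpace H] {I : ModelWithCorners ℝ B H}
  {M : Type*} [TopologicalSpace M] [ChartedSpace H M] [IsManifold I ∞ M]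
  {F : Type*} [NormedAddCommGroup F] [NormedSpace ℝ F] [FiniteDimensional ℝ F]
  {E : M → Type*} [TopologicalSpace (TotalSpace F E)]
  [∀ x, AddCommGroup (E x)] [∀ x, Module ℝ (E x)] [∀ x, TopologicalSpace (E x)]
  [∀ x, IsTopologicalAddGroup (E x)] [∀ x, ContinuousSMul ℝ (E x)]
  [FiberBundle F E] [VectorBundle ℝ F E] [ContMDiffVectorBundle ∞ F E I]

/-- `∇` is smooth: over every open set it takes smooth sections of `E` to smooth sections of
`Hom(TM, E)`. -/
def IsSmoothConnection (cov : CovariantDerivative I F E) : Prop :=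
  ∀ U : Set M, IsOpen U → ContMDiffCovariantDerivativeOn F ∞ cov.toFun U

/-- `ρ : E → TM` is smooth. -/
def IsSmoothAnchor (ρ : ∀ x : M, E x →L[ℝ] TangentSpace I x) : Prop :=
  ContMDiff I (I.prod 𝓘(ℝ, F →L[ℝ] B)) ∞
    (fun x => TotalSpace.mk' (F →L[ℝ] B)
      (E := fun x : M => E x →L[ℝ] TangentSpace I x) x (ρ x))

/-- The expression `ρ (∇_{ρ s₁} s₂ - ∇_{ρ s₂} s₁) - [ρ s₁, ρ s₂]` at `x`, for sections `s₁, s₂`. -/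
def torsionOn (cov : CovariantDerivative I F E) (ρ : ∀ x : M, E x →L[ℝ] TangentSpace I x)
    (s₁ s₂ : ∀ x : M, E x) (x : M) : TangentSpace I x :=
  ρ x (cov s₂ x (ρ x (s₁ x)) - cov s₁ x (ρ x (s₂ x))) -
    VectorField.mlieBracket I (fun y => ρ y (s₁ y)) (fun y => ρ y (s₂ y)) x

theorem IsSmoothAnchor.mdiffAt {ρ : ∀ x : M, E x →L[ℝ] TangentSpace I x}
    (hρ : IsSmoothAnchor (F := F) ρ) {s : ∀ x : M, E x} {x : M} (hs : MDiffAt (T% s) x) :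
    MDiffAt (T% (fun y => ρ y (s y))) x :=
  MDifferentiableAt.clm_bundle_apply (b := id) ((hρ x).mdifferentiableAt (by simp)) hs

theorem torsionOn_tensorial₁ (cov : CovariantDerivative I F E)
    {ρ : ∀ x : M, E x →L[ℝ] TangentSpace I x} (hρ : IsSmoothAnchor (F := F) ρ) (x : M)
    (t : ∀ x : M, E x) (_ : MDiffAt (T% t) x) :
    TensorialAt I F (fun s => torsionOn cov ρ s t x) x where
  smul {f s} hf hs := by
    have e : (fun y => ρ y ((f • s) y)) = f • fun y => ρ y (s y) := by
      ext1 y; simp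
    simp only [torsionOn]
    rw [e, VectorField.mlieBracket_smul_left hf (hρ.mdiffAt hs),
      cov.isCovariantDerivativeOn.leibniz hs hf]
    simp
    module
  add {s s'} hs hs' := by
    have e : (fun y => ρ y ((s + s') y)) = (fun y => ρ y (s y)) + fun y => ρ y (s' y) := by
      ext1 y; simp
    simp only [torsionOn]
    rw [e, VectorField.mlieBracket_add_left (hρ.mdiffAt hs) (hρ.mdiffAt hs'),
      cov.isCovariantDerivativeOn.add hs hs']
    simp
    module

theorem torsionOn_swap (cov : CovariantDerivative I F E)
    (ρ : ∀ x : M, E x →L[ℝ] TangentSpace I x) (s t : ∀ x : M, E x) (x : M) :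
    torsionOn cov ρ s t x = - torsionOn cov ρ t s x := by
  simp only [torsionOn]
  rw [VectorField.mlieBracket_swap_apply]
  simp
  module

theorem torsionOn_tensorial₂ (cov : CovariantDerivative I F E)
    {ρ : ∀ x : M, E x →L[ℝ] TangentSpace I x} (hρ : IsSmoothAnchor (F := F) ρ) (x : M)
    (s : ∀ x : M, E x) (hs : MDiffAt (T% s) x) :
    TensorialAt I F (fun t => torsionOn cov ρ s t x) x where
  smul {f t} hf ht := by
    have := (torsionOn_tensorial₁ cov hρ x s hs).smul hf ht
    simp only [torsionOn_swap cov ρ s]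
    rw [this]
    simp
  add {t t'} ht ht' := by
    have := (torsionOn_tensorial₁ cov hρ x s hs).add ht ht'
    simp only [torsionOn_swap cov ρ s]
    rw [this]
    abel

/-- The torsion of `∇` with respect to `ρ`: the tensor `T ∈ Γ(TM ⊗ Λ²E^*)` such that
`T(s₁, s₂) = ρ (∇_{ρ s₁} s₂ - ∇_{ρ s₂} s₁) - [ρ s₁, ρ s₂]` for all sections `s₁, s₂` of `E`. -/
def anchoredTorsion (cov : CovariantDerivative I F E)
    (ρ : ∀ x : M, E x →L[ℝ] TangentSpace I x) (hρ : IsSmoothAnchor (F := F) ρ) (x : M) :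
    E x →L[ℝ] E x →L[ℝ] TangentSpace I x :=
  TensorialAt.mkHom₂ (fun s t => torsionOn cov ρ s t x) x
    (torsionOn_tensorial₁ cov hρ x) (torsionOn_tensorial₂ cov hρ x)

theorem anchoredTorsion_apply (cov : CovariantDerivative I F E)
    (ρ : ∀ x : M, E x →L[ℝ] TangentSpace I x) (hρ : IsSmoothAnchor (F := F) ρ) (x : M)
    {s t : ∀ x : M, E x} (hs : MDiffAt (T% s) x) (ht : MDiffAt (T% t) x) :
    anchoredTorsion cov ρ hρ x (s x) (t x) = torsionOn cov ρ s t x :=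
  TensorialAt.mkHom₂_apply (torsionOn_tensorial₁ cov hρ x) (torsionOn_tensorial₂ cov hρ x) hs ht

/-- The expression `∇_X ∇_Y s - ∇_Y ∇_X s - ∇_{[X,Y]} s` at `x`. -/
def curvatureOn (cov : CovariantDerivative I F E) (X Y : ∀ x : M, TangentSpace I x)
    (s : ∀ x : M, E x) (x : M) : E x :=
  cov (fun y => cov s y (Y y)) x (X x) - cov (fun y => cov s y (X y)) x (Y x) -
    cov s x (VectorField.mlieBracket I X Y x)

theorem IsSmoothConnection.mdiffAt {cov : CovariantDerivative I F E}
    (hcov : IsSmoothConnection cov) {s : ∀ x : M, E x} {x : M} {U : Set M} (hU : IsOpen U)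
    (hx : x ∈ U)
    (hs : ContMDiffOn I (I.prod 𝓘(ℝ, F)) ∞ (T% s) U)
    {Y : ∀ x : M, TangentSpace I x} (hY : MDiffAt (T% Y) x) :
    MDiffAt (T% (fun y => cov s y (Y y))) x := by
  have h := ((hcov U hU).contMDiff (σ := s) (by simpa using hs)).contMDiffAt (hU.mem_nhds hx)
  exact MDifferentiableAt.clm_bundle_apply (b := id) (h.mdifferentiableAt (by simp)) hY

theorem curvatureOn_tensorial₁ {cov : CovariantDerivative I F E}
    (hcov : IsSmoothConnection cov) {s : ∀ x : M, E x} {x : M} {U : Set M} (hU : IsOpen U)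
    (hx : x ∈ U) (hs : ContMDiffOn I (I.prod 𝓘(ℝ, F)) ∞ (T% s) U)
    (Y : ∀ x : M, TangentSpace I x) (_ : MDiffAt (T% Y) x) :
    TensorialAt I B (fun X => curvatureOn cov X Y s x) x where
  smul {f X} hf hX := by
    have e : (fun y => cov s y ((f • X) y)) = f • fun y => cov s y (X y) := by
      ext1 y; simp
    simp only [curvatureOn]
    rw [e, VectorField.mlieBracket_smul_left hf hX,
      cov.isCovariantDerivativeOn.leibniz (hcov.mdiffAt hU hx hs hX) hf]
    simp
    module
  add {X X'} hX hX' := by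
    have e : (fun y => cov s y ((X + X') y)) = (fun y => cov s y (X y)) + fun y => cov s y (X' y) := by
      ext1 y; simp
    simp only [curvatureOn]
    rw [e, VectorField.mlieBracket_add_left hX hX',
      cov.isCovariantDerivativeOn.add (hcov.mdiffAt hU hx hs hX) (hcov.mdiffAt hU hx hs hX')]
    simp
    module

theorem curvatureOn_swap (cov : CovariantDerivative I F E) (X Y : ∀ x : M, TangentSpace I x)
    (s : ∀ x : M, E x) (x : M) : curvatureOn cov X Y s x = - curvatureOn cov Y X s x := by
  simp only [curvatureOn]
  rw [VectorField.mlieBracket_swap_apply]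
  simp
  module

theorem curvatureOn_tensorial₂ {cov : CovariantDerivative I F E}
    (hcov : IsSmoothConnection cov) {s : ∀ x : M, E x} {x : M} {U : Set M} (hU : IsOpen U)
    (hx : x ∈ U) (hs : ContMDiffOn I (I.prod 𝓘(ℝ, F)) ∞ (T% s) U)
    (X : ∀ x : M, TangentSpace I x) (hX : MDiffAt (T% X) x) :
    TensorialAt I B (fun Y => curvatureOn cov X Y s x) x where
  smul {f Y} hf hY := by
    have := (curvatureOn_tensorial₁ hcov hU hx hs X hX).smul hf hY
    simp only [curvatureOn_swap cov X]
    rw [this]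
    simp
  add {Y Y'} hY hY' := by
    have := (curvatureOn_tensorial₁ hcov hU hx hs X hX).add hY hY'
    simp only [curvatureOn_swap cov X]
    rw [this]
    abel

theorem curvatureOn_add {cov : CovariantDerivative I F E} (hcov : IsSmoothConnection cov)
    {s s' : ∀ x : M, E x} {x : M} {U : Set M} (hU : IsOpen U) (hx : x ∈ U)
    (hs : ContMDiffOn I (I.prod 𝓘(ℝ, F)) ∞ (T% s) U)
    (hs' : ContMDiffOn I (I.prod 𝓘(ℝ, F)) ∞ (T% s') U)
    {X Y : ∀ x : M, TangentSpace I x} (hX : MDiffAt (T% X) x) (hY : MDiffAt (T% Y) x) :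
    curvatureOn cov X Y (s + s') x = curvatureOn cov X Y s x + curvatureOn cov X Y s' x := by
  have hd : ∀ {t : ∀ x : M, E x}, ContMDiffOn I (I.prod 𝓘(ℝ, F)) ∞ (T% t) U → ∀ y ∈ U,
      MDiffAt (T% t) y := fun ht y hy =>
    (ht.contMDiffAt (hU.mem_nhds hy)).mdifferentiableAt (by simp)
  have hss : ContMDiffOn I (I.prod 𝓘(ℝ, F)) ∞ (T% (s + s')) U := hs.add_section hs'
  have key : ∀ {Z : ∀ x : M, TangentSpace I x}, MDiffAt (T% Z) x →
      cov (fun y => cov (s + s') y (Z y)) x =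
        cov (fun y => cov s y (Z y)) x + cov (fun y => cov s' y (Z y)) x := by
    intro Z hZ
    rw [← cov.isCovariantDerivativeOn.add (hcov.mdiffAt hU hx hs hZ) (hcov.mdiffAt hU hx hs' hZ)]
    refine cov.isCovariantDerivativeOnUniv.congr_of_eventuallyEq (hcov.mdiffAt hU hx hss hZ)
      (mdifferentiableAt_add_section (hcov.mdiffAt hU hx hs hZ) (hcov.mdiffAt hU hx hs' hZ))
      Filter.univ_mem ?_
    filter_upwards [hU.mem_nhds hx] with y hy
    simp [cov.isCovariantDerivativeOn.add (hd hs y hy) (hd hs' y hy)]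
  simp only [curvatureOn]
  rw [key hX, key hY, cov.isCovariantDerivativeOn.add (hd hs x hx) (hd hs' x hx)]
  simp
  module

theorem curvatureOn_smul {cov : CovariantDerivative I F E} (hcov : IsSmoothConnection cov)
    {s : ∀ x : M, E x} (c : ℝ) {x : M} {U : Set M} (hU : IsOpen U) (hx : x ∈ U)
    (hs : ContMDiffOn I (I.prod 𝓘(ℝ, F)) ∞ (T% s) U)
    {X Y : ∀ x : M, TangentSpace I x} (hX : MDiffAt (T% X) x) (hY : MDiffAt (T% Y) x) :
    curvatureOn cov X Y (c • s) x = c • curvatureOn cov X Y s x := by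
  have hd : ∀ y ∈ U, MDiffAt (T% s) y := fun y hy =>
    (hs.contMDiffAt (hU.mem_nhds hy)).mdifferentiableAt (by simp)
  have hss : ContMDiffOn I (I.prod 𝓘(ℝ, F)) ∞ (T% (c • s)) U := hs.const_smul_section
  have key : ∀ {Z : ∀ x : M, TangentSpace I x}, MDiffAt (T% Z) x →
      cov (fun y => cov (c • s) y (Z y)) x = c • cov (fun y => cov s y (Z y)) x := by
    intro Z hZ
    rw [← cov.isCovariantDerivativeOn.smul_const c (hcov.mdiffAt hU hx hs hZ)]
    refine cov.isCovariantDerivativeOnUniv.congr_of_eventuallyEq (hcov.mdiffAt hU hx hss hZ)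
      (mdifferentiableAt_const.smul_section (hcov.mdiffAt hU hx hs hZ))
      Filter.univ_mem ?_
    filter_upwards [hU.mem_nhds hx] with y hy
    simp [cov.isCovariantDerivativeOn.smul_const c (hd y hy)]
  simp only [curvatureOn]
  rw [key hX, key hY, cov.isCovariantDerivativeOn.smul_const c (hd x hx)]
  simp
  module

variable (F) in
/-- The extension of a vector `v ∈ E x` to a section of `E` which is constant in the standard
trivialization around `x`. -/
def linExtend {x : M} (v : E x) (y : M) : E y :=
  (trivializationAt F E x).symmₗ ℝ y (trivializationAt F E x ⟨x, v⟩).2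

theorem linExtend_add (x : M) (a b : E x) :
    linExtend F (a + b) = linExtend F a + linExtend F b := by
  have hx := FiberBundle.mem_baseSet_trivializationAt' (F := F) (E := E) x
  ext1 y
  simp only [linExtend, Pi.add_apply]
  rw [((trivializationAt F E x).linear ℝ hx).map_add]
  exact ((trivializationAt F E x).symmₗ ℝ y).map_add _ _

theorem linExtend_smul (x : M) (c : ℝ) (a : E x) :
    linExtend F (c • a) = c • linExtend F a := by
  have hx := FiberBundle.mem_baseSet_trivializationAt' (F := F) (E := E) x
  ext1 y
  simp only [linExtend, Pi.smul_apply]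
  rw [((trivializationAt F E x).linear ℝ hx).map_smul]
  exact ((trivializationAt F E x).symmₗ ℝ y).map_smul _ _

theorem linExtend_self {x : M} (v : E x) : linExtend F v x = v := by
  have hx := FiberBundle.mem_baseSet_trivializationAt' (F := F) (E := E) x
  simp only [linExtend]
  rw [Trivialization.coe_symmₗ (R := ℝ) _ hx]
  exact FiberBundle.extend_apply_self F v

theorem exists_contMDiffOn_linExtend (x : M) (a b : E x) :
    ∃ U : Set M, IsOpen U ∧ x ∈ U ∧
      ContMDiffOn I (I.prod 𝓘(ℝ, F)) ∞ (T% (linExtend F a)) U ∧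
      ContMDiffOn I (I.prod 𝓘(ℝ, F)) ∞ (T% (linExtend F b)) U := by
  have key : ∀ v : E x, ∀ y ∈ (trivializationAt F E x).baseSet,
      FiberBundle.extend F v y = linExtend F v y := fun v y hy => by
    simp only [linExtend]
    rw [Trivialization.coe_symmₗ (R := ℝ) _ hy]
    rfl
  obtain ⟨s, hs, h⟩ := FiberBundle.exists_contMDiffOn_extend (k := ∞) I F a
  obtain ⟨t, ht, h'⟩ := FiberBundle.exists_contMDiffOn_extend (k := ∞) I F b
  obtain ⟨U, hU, hUo, hx⟩ := mem_nhds_iff.1 (Filter.inter_mem (Filter.inter_mem hs ht)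
    ((trivializationAt F E x).open_baseSet.mem_nhds
      (FiberBundle.mem_baseSet_trivializationAt' (F := F) (E := E) x)))
  refine ⟨U, hUo, hx, (h.mono fun y hy => (hU hy).1.1).congr fun y hy => ?_,
    (h'.mono fun y hy => (hU hy).1.2).congr fun y hy => ?_⟩
  · simp [key a y (hU hy).2]
  · simp [key b y (hU hy).2]

variable (I) in
theorem mdifferentiableAt_linExtend {x : M} (v : E x) :
    MDiffAt (T% (linExtend F v)) x := by
  obtain ⟨U, hU, hx, h, -⟩ := exists_contMDiffOn_linExtend (I := I) (F := F) x v v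
  exact (h.contMDiffAt (hU.mem_nhds hx)).mdifferentiableAt (by simp)

/-- The curvature form of `∇` at `x`, as a trilinear map: `R(X, Y) s` is the value at `x` of
`∇_X ∇_Y s - ∇_Y ∇_X s - ∇_{[X,Y]} s`, for any smooth extensions of the tangent vectors `X`, `Y`
and of the vector `s` (the definition uses those which are constant in the standard trivializations). -/
def curvatureForm (cov : CovariantDerivative I F E) (hcov : IsSmoothConnection cov) (x : M) :
    TangentSpace I x →ₗ[ℝ] TangentSpace I x →ₗ[ℝ] E x →ₗ[ℝ] E x where
  toFun X :=
    { toFun Y :=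
        { toFun s := curvatureOn cov (linExtend B X) (linExtend B Y)
            (linExtend F s) x
          map_add' a b := by
            obtain ⟨U, hU, hx, ha, hb⟩ := exists_contMDiffOn_linExtend (I := I) (F := F) x a b
            rw [linExtend_add, curvatureOn_add hcov hU hx ha hb
              (mdifferentiableAt_linExtend I _) (mdifferentiableAt_linExtend I _)]
          map_smul' c a := by
            obtain ⟨U, hU, hx, ha, -⟩ := exists_contMDiffOn_linExtend (I := I) (F := F) x a a
            rw [linExtend_smul, curvatureOn_smul hcov c hU hx ha
              (mdifferentiableAt_linExtend I _) (mdifferentiableAt_linExtend I _)]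
            rfl }
      map_add' Y Y' := by
        ext a
        obtain ⟨U, hU, hx, ha, -⟩ := exists_contMDiffOn_linExtend (I := I) (F := F) x a a
        simp only [LinearMap.coe_mk, AddHom.coe_mk, LinearMap.add_apply]
        rw [linExtend_add]
        exact (curvatureOn_tensorial₂ hcov hU hx ha _ (mdifferentiableAt_linExtend I _)).add
          (mdifferentiableAt_linExtend I _) (mdifferentiableAt_linExtend I _)
      map_smul' c Y := by
        ext a
        obtain ⟨U, hU, hx, ha, -⟩ := exists_contMDiffOn_linExtend (I := I) (F := F) x a a
        simp only [LinearMap.coe_mk, AddHom.coe_mk, LinearMap.smul_apply]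
        rw [linExtend_smul]
        exact (curvatureOn_tensorial₂ hcov hU hx ha _
          (mdifferentiableAt_linExtend I _)).smul (f := fun _ => c)
          mdifferentiableAt_const (mdifferentiableAt_linExtend I _) }
  map_add' X X' := by
    ext Y a
    obtain ⟨U, hU, hx, ha, -⟩ := exists_contMDiffOn_linExtend (I := I) (F := F) x a a
    simp only [LinearMap.coe_mk, AddHom.coe_mk, LinearMap.add_apply]
    rw [linExtend_add]
    exact (curvatureOn_tensorial₁ hcov hU hx ha _ (mdifferentiableAt_linExtend I _)).add
      (mdifferentiableAt_linExtend I _) (mdifferentiableAt_linExtend I _)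
  map_smul' c X := by
    ext Y a
    obtain ⟨U, hU, hx, ha, -⟩ := exists_contMDiffOn_linExtend (I := I) (F := F) x a a
    simp only [LinearMap.coe_mk, AddHom.coe_mk, LinearMap.smul_apply]
    rw [linExtend_smul]
    exact (curvatureOn_tensorial₁ hcov hU hx ha _
      (mdifferentiableAt_linExtend I _)).smul (f := fun _ => c)
      mdifferentiableAt_const (mdifferentiableAt_linExtend I _)

end Connection

/-! ### Quaternionic vector bundles and almost co-CR quaternionic structures -/

section Quaternionic

variable {B : Type*} [NormedAddCommGroup B] [NormedSpace ℝ B] [FiniteDimensional ℝ B]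
  {H : Type*} [TopologicalSpace H] (I : ModelWithCorners ℝ B H)
  {M : Type*} [TopologicalSpace M] [ChartedSpace H M] [IsManifold I ∞ M]
  (k : ℕ)
  (E : M → Type*) [TopologicalSpace (TotalSpace (HVec k) E)]
  [∀ x, AddCommGroup (E x)] [∀ x, Module ℝ (E x)] [∀ x, TopologicalSpace (E x)]
  [∀ x, IsTopologicalAddGroup (E x)] [∀ x, ContinuousSMul ℝ (E x)]
  [FiberBundle (HVec k) E] [VectorBundle ℝ (HVec k) E] [ContMDiffVectorBundle ∞ (HVec k) E I]

/-- The structure of a quaternionic vector bundle on a smooth real vector bundle `E` with typical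
fibre `ℍᵏ`: a smooth reduction of its frame bundle to the group `Sp(1)·GL(k,ℍ)`. It is given by
the set of admissible frames `u : ℍᵏ ≃ E x` at each point. -/
structure QuaternionicBundle where
  /-- The admissible frames at a point. -/
  frames : ∀ x : M, Set (HVec k ≃L[ℝ] E x)
  /-- The structural group acts simply transitively on the admissible frames at each point. -/
  mem_frames_iff : ∀ (x : M) (u v : HVec k ≃L[ℝ] E x), u ∈ frames x →
    (v ∈ frames x ↔ ∃ g ∈ SpGL k, v = g.trans u)
  /-- Around each point there is a smooth local section of the bundle of admissible frames. -/
  exists_smooth_frame : ∀ x : M, ∃ U : Set M, IsOpen U ∧ x ∈ U ∧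
    ∃ u : ∀ y : M, HVec k ≃L[ℝ] E y, (∀ y ∈ U, u y ∈ frames y) ∧
      ∀ q : HVec k, ContMDiffOn I (I.prod 𝓘(ℝ, HVec k)) ∞
        (fun y => TotalSpace.mk' (HVec k) y (u y q)) U

variable {I k E}

namespace QuaternionicBundle

/-- The rank three bundle induced by `Sp(1)·GL(k,ℍ) → SO(3)`: the endomorphisms of `E x` which are
left multiplications by imaginary quaternions with respect to the admissible frames. -/
def imEnd (Q : QuaternionicBundle I k E) (x : M) : Set (E x →L[ℝ] E x) :=
  {A | ∃ u ∈ Q.frames x, ∃ p : ℍ[ℝ], p.re = 0 ∧ ∀ q : HVec k, A (u q) = u (leftMul k p q)}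

/-- `J` is an admissible linear complex structure on `E x`: with respect to an admissible frame it
is the left multiplication by an imaginary quaternion of norm one. -/
def IsAdmissible (Q : QuaternionicBundle I k E) (x : M) (J : E x →L[ℝ] E x) : Prop :=
  ∃ u ∈ Q.frames x, ∃ p : ℍ[ℝ], p.re = 0 ∧ ‖p‖ = 1 ∧ ∀ q : HVec k, J (u q) = u (leftMul k p q)

/-- The connection `∇` is compatible with the structural group of `E`: its local connection forms,
with respect to the smooth local admissible frames, take values in the Lie algebra of
`Sp(1)·GL(k,ℍ)`. -/
def IsCompatible (Q : QuaternionicBundle I k E) (cov : CovariantDerivative I (HVec k) E) : Prop :=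
  ∀ (U : Set M) (u : ∀ y : M, HVec k ≃L[ℝ] E y), IsOpen U → (∀ y ∈ U, u y ∈ Q.frames y) →
    (∀ q : HVec k, ContMDiffOn I (I.prod 𝓘(ℝ, HVec k)) ∞
      (fun y => TotalSpace.mk' (HVec k) y (u y q)) U) →
    ∀ x ∈ U, ∀ v : TangentSpace I x,
      (fun q : HVec k => (u x).symm (cov (fun y => u y q) x v)) ∈ spglLie k

end QuaternionicBundle

variable (I k E) in
/-- An almost co-CR quaternionic structure `(E, ρ)` on `M`. -/
structure AlmostCoCRQuaternionic extends QuaternionicBundle I k E where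
  /-- The morphism `ρ : E → TM`. -/
  anchor : ∀ x : M, E x →L[ℝ] TangentSpace I x
  smooth_anchor : IsSmoothAnchor (F := HVec k) anchor
  surjective_anchor : ∀ x : M, Function.Surjective (anchor x)
  /-- The kernel of `ρ` contains no nonzero subspace preserved by some admissible linear complex
  structure. -/
  ker_anchor : ∀ (x : M) (J : E x →L[ℝ] E x), toQuaternionicBundle.IsAdmissible x J →
    ∀ W : Submodule ℝ (E x), (∀ w ∈ W, anchor x w = 0) → (∀ w ∈ W, J w ∈ W) → W = ⊥

/-! ### The bundle of admissible linear complex structures and its almost co-CR structure -/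

variable (k E) in
/-- The total space of the bundle `End(E)`. It is a smooth manifold, with the model
`I.prod 𝓘(ℝ, HVec k →L[ℝ] HVec k)`. -/
abbrev EndTotal : Type _ :=
  TotalSpace (HVec k →L[ℝ] HVec k) (fun x : M => E x →L[ℝ] E x)

variable (I k) in
/-- The model with corners of `End(E)`. -/
abbrev endModel := I.prod 𝓘(ℝ, HVec k →L[ℝ] HVec k)

/-- The bundle `Z` of admissible linear complex structures of `E`, a submanifold of `End(E)`. -/
def QuaternionicBundle.twistorBundle (Q : QuaternionicBundle I k E) : Set (EndTotal k E) :=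
  {J | Q.IsAdmissible J.proj J.2}

/-- The eigenspace `E^J = ker (J + i)`, in the complexification of `E x`. -/
def eigenMinus {x : M} (J : E x →L[ℝ] E x) : Submodule ℂ (ℂ ⊗[ℝ] E x) :=
  LinearMap.ker ((J : E x →ₗ[ℝ] E x).baseChange ℂ + Complex.I • LinearMap.id)

/-- The differential of the projection `π : End(E) → M`. -/
def dproj (A : EndTotal k E) : TangentSpace (endModel I k) A →L[ℝ] TangentSpace I A.proj :=
  mfderiv (endModel I k) I (fun A' : EndTotal k E => A'.proj) A

/-- The vertical tangent vector at `A` given by an endomorphism `V` of the same fibre: the velocity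
at `t = 0` of `t ↦ A + t V`. -/
def vertLift (A : EndTotal k E) (V : E A.proj →L[ℝ] E A.proj) : TangentSpace (endModel I k) A :=
  mfderiv 𝓘(ℝ, ℝ) (endModel I k)
    (fun t : ℝ => TotalSpace.mk' (HVec k →L[ℝ] HVec k)
      (E := fun x : M => E x →L[ℝ] E x) A.proj (A.2 + t • V)) 0 (1 : ℝ)

/-- The horizontal space at `A ∈ End(E)` of the connection induced by `∇`: it is formed of the
vectors `dσ(v)`, with `σ` a local section of `End(E)` through `A` such that `∇_v σ = 0`, that is,
`∇_v (σ s) = σ (∇_v s)` for any section `s` of `E`. -/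
def horizontalSpace (cov : CovariantDerivative I (HVec k) E) (A : EndTotal k E) :
    Submodule ℝ (TangentSpace (endModel I k) A) :=
  Submodule.span ℝ {w | ∃ (σ : ∀ x : M, E x →L[ℝ] E x) (v : TangentSpace I A.proj),
    σ A.proj = A.2 ∧
    ContMDiffAt I (endModel I k) ∞ (fun x => TotalSpace.mk' (HVec k →L[ℝ] HVec k) x (σ x)) A.proj ∧
    (∀ s : ∀ x : M, E x,
      ContMDiffAt I (I.prod 𝓘(ℝ, HVec k)) ∞ (fun x => TotalSpace.mk' (HVec k) x (s x)) A.proj →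
        cov (fun x => σ x (s x)) A.proj v = σ A.proj (cov s A.proj v)) ∧
    w = (mfderiv I (endModel I k)
      (fun x => TotalSpace.mk' (HVec k →L[ℝ] HVec k) x (σ x)) A.proj v)}

/-- The complex space `(ker dπ)^{0,1}` at `J ∈ Z`. The fibre of `Z` through `J` is an oriented
sphere, whose tangent space at `J` is formed of the `V ∈ imEnd` with `J V = - V J`, and whose
complex structure (the rotation by a right angle) is `V ↦ J V`. The `(0,1)` vectors are the
`V + i J V`. -/
def QuaternionicBundle.verticalZeroOne (Q : QuaternionicBundle I k E) (J : EndTotal k E) :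
    Submodule ℂ (ℂ ⊗[ℝ] TangentSpace (endModel I k) J) :=
  Submodule.span ℂ {w | ∃ V ∈ Q.imEnd J.proj, J.2.comp V = - V.comp J.2 ∧
    w = cvec (vertLift J V) (vertLift J (J.2.comp V))}

namespace AlmostCoCRQuaternionic

/-- The complex space `ρ(E^J)`. -/
def imEigenMinus (S : AlmostCoCRQuaternionic I k E) {x : M} (J : E x →L[ℝ] E x) :
    Submodule ℂ (ℂ ⊗[ℝ] TangentSpace I x) :=
  (eigenMinus J).map ((S.anchor x : E x →ₗ[ℝ] TangentSpace I x).baseChange ℂ)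

/-- The complex space `𝓑_J`, the horizontal lift at `J` of `ρ(E^J)` with respect to `∇`. -/
def horizontalLift (S : AlmostCoCRQuaternionic I k E) (cov : CovariantDerivative I (HVec k) E)
    (J : EndTotal k E) : Submodule ℂ (ℂ ⊗[ℝ] TangentSpace (endModel I k) J) :=
  (horizontalSpace cov J).baseChange ℂ ⊓ (S.imEigenMinus J.2).comap
    ((dproj (I := I) J : TangentSpace (endModel I k) J →ₗ[ℝ] TangentSpace I J.proj).baseChange ℂ)

/-- The almost co-CR structure `𝓒 = (ker dπ)^{0,1} ⊕ 𝓑` on `Z`. -/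
def coCRDistribution (S : AlmostCoCRQuaternionic I k E) (cov : CovariantDerivative I (HVec k) E)
    (J : EndTotal k E) : Submodule ℂ (ℂ ⊗[ℝ] TangentSpace (endModel I k) J) :=
  S.verticalZeroOne J ⊔ S.horizontalLift cov J

end AlmostCoCRQuaternionic

end Quaternionic

/-- Integrability of a complex distribution `C` on a submanifold `Z` of a manifold `N`: the smooth
local sections of `C` are closed under the (complex bilinear) Lie bracket. A local section of `C`
is (the restriction to `Z` of) a complex vector field `X₁ + i X₂`, with `X₁, X₂` smooth vector
fields on an open subset of `N`, whose values at the points of `Z` are in `C`; the values at the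
points of `Z` of the bracket of two such fields depend only on their restrictions to `Z`, as these
are tangent to `Z`. -/
def IsIntegrableAlong {B : Type*} [NormedAddCommGroup B] [NormedSpace ℝ B]
    {H : Type*} [TopologicalSpace H] (I : ModelWithCorners ℝ B H)
    {N : Type*} [TopologicalSpace N] [ChartedSpace H N] [IsManifold I ∞ N]
    (Z : Set N) (C : ∀ p : N, Submodule ℂ (ℂ ⊗[ℝ] TangentSpace I p)) : Prop :=
  ∀ (U : Set N) (X₁ X₂ Y₁ Y₂ : ∀ p : N, TangentSpace I p), IsOpen U →
    ContMDiffOn I I.tangent ∞ (fun p => (⟨p, X₁ p⟩ : TangentBundle I N)) U →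
    ContMDiffOn I I.tangent ∞ (fun p => (⟨p, X₂ p⟩ : TangentBundle I N)) U →
    ContMDiffOn I I.tangent ∞ (fun p => (⟨p, Y₁ p⟩ : TangentBundle I N)) U →
    ContMDiffOn I I.tangent ∞ (fun p => (⟨p, Y₂ p⟩ : TangentBundle I N)) U →
    (∀ p ∈ U ∩ Z, cvec (X₁ p) (X₂ p) ∈ C p) → (∀ p ∈ U ∩ Z, cvec (Y₁ p) (Y₂ p) ∈ C p) →
    ∀ p ∈ U ∩ Z,
      cvec (VectorField.mlieBracket I X₁ Y₁ p - VectorField.mlieBracket I X₂ Y₂ p)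
        (VectorField.mlieBracket I X₁ Y₂ p + VectorField.mlieBracket I X₂ Y₁ p) ∈ C p


end

/-! The question is local. In an admissible frame and a chart, `End(E)` becomes `V × End(ℍᵏ)`, the
connection becomes `d + Γ`, and `Z` becomes the product of an open set with the fixed sphere `S` of
left multiplications by unit imaginary quaternions. Let `τ` be the tautological section `(y, J) ↦ J`
of the pull-back of `End(E)`, and `D` the pulled-back connection. The vertical part of a tangent
vector `w` is `ν(w) = D_w τ`, so the curvature identity for `τ` reads `ν([X, Y]) = D_X ν(Y) - D_Y
ν(X) - [R(X, Y), J]` (`vertPart_lieBracket`). If `X`, `Y` project to `ρ ε`, `ρ η`, the definition of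
the torsion gives `dπ [X, Y] = ρ (D_X η - D_Y ε) - T(ε, η)` (`fst_lieBracket`).

Since `E^J` consists of the vectors `q + i J q`, a section of `𝓒` is a field `X₁ + i X₂` with `ν(X₂)
= J ν(X₁)` and projections `ρ ε`, `ρ (J ε)`. In the bracket of two such sections, all the terms
containing derivatives of the sections recombine into a vector of `𝓒`, by differentiating `J ν + ν J
= 0` and `ν(X₂) = J ν(X₁)`. What is left is a curvature commutator and a torsion term, both
depending only on the values at the point; hence the bracket lies in `𝓒` exactly when `R` and `T`
satisfy the stated conditions on the two vectors of `E^J` involved (`lieBracket_mem_iff`). This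
gives (ii) ⇒ (i) directly. For (i) ⇒ (ii), the horizontal lifts of `ρ q + i ρ (J q)`, with `q`
constant in the frame, are sections of `𝓒` that realise every pair of vectors of `E^J`.

Two hypotheses enter through `IsTwistorModel`. The condition on `ker ρ` makes `q ↦ (ρ q, ρ (J q))`
injective, so the lift `ε` is unique and differentiable. The compatibility of the connection makes
`Γ` normalise the space `L` of imaginary left multiplications, so horizontal vectors are tangent to
`Z`. The vector fields live on an open subset of `End(E)` but are constrained only on `Z`; every
identity is therefore differentiated only in directions tangent to `Z` (`fderiv_eq_zero`). -/

noncomputable section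

/-! ### Local model: twistor distributions over an open subset of a vector space -/

section LocalModel

set_option synthInstance.maxHeartbeats 400000

variable {B F : Type*} [NormedAddCommGroup B] [NormedSpace ℝ B]
  [NormedAddCommGroup F] [NormedSpace ℝ F]

/-- The curvature of the connection `d + Γ` on a trivial bundle. -/
def formCurvature (Γ : B → B →L[ℝ] F →L[ℝ] F) (y v w : B) : F →L[ℝ] F :=
  fderiv ℝ Γ y v w - fderiv ℝ Γ y w v + (Γ y v * Γ y w - Γ y w * Γ y v)

/-- The torsion of the connection `d + Γ` on a trivial bundle, with respect to the anchor `ρ`. -/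
def formTorsion (Γ : B → B →L[ℝ] F →L[ℝ] F) (ρ : B → F →L[ℝ] B) (y : B) (q r : F) : B :=
  ρ y (Γ y (ρ y q) r - Γ y (ρ y r) q) - (fderiv ℝ ρ y (ρ y q) r - fderiv ℝ ρ y (ρ y r) q)

/-- The vertical part, with respect to `d + Γ`, of a tangent vector to the bundle of
endomorphisms. -/
def vertPart (Γ : B → B →L[ℝ] F →L[ℝ] F) (z w : B × (F →L[ℝ] F)) : F →L[ℝ] F :=
  w.2 + (Γ z.1 w.1 * z.2 - z.2 * Γ z.1 w.1)

/-- The pairs (real part, imaginary part) of the vectors of the twistor distribution of the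
trivial bundle, at the endomorphism `z.2`. -/
def modelDistribution (Γ : B → B →L[ℝ] F →L[ℝ] F) (ρ : B → F →L[ℝ] B)
    (L : Submodule ℝ (F →L[ℝ] F)) (z : B × (F →L[ℝ] F)) :
    Set ((B × (F →L[ℝ] F)) × (B × (F →L[ℝ] F))) :=
  {w | (vertPart Γ z w.1 ∈ L ∧ z.2 * vertPart Γ z w.1 = -(vertPart Γ z w.1 * z.2) ∧
    vertPart Γ z w.2 = z.2 * vertPart Γ z w.1) ∧
    ∃ q, w.1.1 = ρ z.1 q ∧ w.2.1 = ρ z.1 (z.2 q)}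

/-- A connection form `Γ` and an anchor `ρ` on a trivial bundle, compatible with a family `S` of
linear complex structures spanning the space of endomorphisms `L`. -/
structure IsTwistorModel (Ω : Set B) (Γ : B → B →L[ℝ] F →L[ℝ] F) (ρ : B → F →L[ℝ] B)
    (S : Set (F →L[ℝ] F)) (L : Submodule ℝ (F →L[ℝ] F)) : Prop where
  isOpen : IsOpen Ω
  differentiableAt_form : ∀ y ∈ Ω, DifferentiableAt ℝ Γ y
  differentiableAt_anchor : ∀ y ∈ Ω, DifferentiableAt ℝ ρ y
  mem_span : ∀ J ∈ S, J ∈ L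
  mul_self : ∀ J ∈ S, J * J = -1
  mul_mem : ∀ J ∈ S, ∀ W ∈ L, J * W = -(W * J) → J * W ∈ L
  exists_curve : ∀ J ∈ S, ∀ W ∈ L, J * W = -(W * J) →
    ∃ c : ℝ → F →L[ℝ] F, c 0 = J ∧ HasDerivAt c W 0 ∧ ∀ t, c t ∈ S
  commutator_mem : ∀ y ∈ Ω, ∀ v, ∀ W ∈ L, Γ y v * W - W * Γ y v ∈ L
  eq_zero_of_anchor : ∀ y ∈ Ω, ∀ J ∈ S, ∀ q, ρ y q = 0 → ρ y (J q) = 0 → q = 0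

/-! ### Derivatives of the connection form and of the vertical part. -/

theorem hasFDerivAt_comp_fst {C G : Type*} [NormedAddCommGroup C] [NormedSpace ℝ C]
    [NormedAddCommGroup G] [NormedSpace ℝ G] {f : B → G} {z : B × C}
    (hf : DifferentiableAt ℝ f z.1) : HasFDerivAt (fun z : B × C => f z.1)
      ((fderiv ℝ f z.1).comp (ContinuousLinearMap.fst ℝ B C)) z :=
  hf.hasFDerivAt.comp z hasFDerivAt_fst

theorem hasFDerivAt_form {Γ : B → B →L[ℝ] F →L[ℝ] F} {z : B × (F →L[ℝ] F)}
    (hΓ : DifferentiableAt ℝ Γ z.1) : HasFDerivAt (fun z : B × (F →L[ℝ] F) => Γ z.1)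
      ((fderiv ℝ Γ z.1).comp (ContinuousLinearMap.fst ℝ B (F →L[ℝ] F))) z :=
  hasFDerivAt_comp_fst (C := F →L[ℝ] F) (f := Γ) (z := z) hΓ

theorem fderiv_form_apply {Γ : B → B →L[ℝ] F →L[ℝ] F} {z : B × (F →L[ℝ] F)}
    (hΓ : DifferentiableAt ℝ Γ z.1) {f : B × (F →L[ℝ] F) → B}
    (hf : DifferentiableAt ℝ f z) :
    DifferentiableAt ℝ (fun z => Γ z.1 (f z)) z ∧
    ∀ w, fderiv ℝ (fun z => Γ z.1 (f z)) z w =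
      fderiv ℝ Γ z.1 w.1 (f z) + Γ z.1 (fderiv ℝ f z w) := by
  have h := (hasFDerivAt_form hΓ).clm_apply hf.hasFDerivAt
  refine ⟨h.differentiableAt, fun w => ?_⟩
  rw [h.fderiv]
  simp only [add_apply, ContinuousLinearMap.comp_apply,
    ContinuousLinearMap.flip_apply, ContinuousLinearMap.coe_fst']
  exact add_comm _ _

theorem fderiv_add_commutator {V A : Type*} [NormedAddCommGroup V] [NormedSpace ℝ V]
    [NormedRing A] [NormedAlgebra ℝ A] {f g J : V → A} {z : V} (hf : DifferentiableAt ℝ f z)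
    (hg : DifferentiableAt ℝ g z) (hJ : DifferentiableAt ℝ J z) :
    DifferentiableAt ℝ (fun z => f z + (g z * J z - J z * g z)) z ∧
    ∀ w, fderiv ℝ (fun z => f z + (g z * J z - J z * g z)) z w = fderiv ℝ f z w +
      (fderiv ℝ g z w * J z + g z * fderiv ℝ J z w - fderiv ℝ J z w * g z -
        J z * fderiv ℝ g z w) := by
  have h := hf.hasFDerivAt.add
    ((hg.hasFDerivAt.mul' hJ.hasFDerivAt).sub (hJ.hasFDerivAt.mul' hg.hasFDerivAt))
  refine ⟨h.differentiableAt, fun w => ?_⟩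
  have := h.fderiv
  change fderiv ℝ (fun z => f z + (g z * J z - J z * g z)) z = _ at this
  rw [this]
  simp
  noncomm_ring

theorem fderiv_vertPart {Γ : B → B →L[ℝ] F →L[ℝ] F} {z : B × (F →L[ℝ] F)}
    (hΓ : DifferentiableAt ℝ Γ z.1) {X : B × (F →L[ℝ] F) → B × (F →L[ℝ] F)}
    (hX : DifferentiableAt ℝ X z) :
    DifferentiableAt ℝ (fun z => vertPart Γ z (X z)) z ∧
    ∀ w, fderiv ℝ (fun z => vertPart Γ z (X z)) z w = (fderiv ℝ X z w).2 +
      ((fderiv ℝ Γ z.1 w.1 (X z).1 + Γ z.1 (fderiv ℝ X z w).1) * z.2 + Γ z.1 (X z).1 * w.2 -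
        w.2 * Γ z.1 (X z).1 - z.2 * (fderiv ℝ Γ z.1 w.1 (X z).1 + Γ z.1 (fderiv ℝ X z w).1)) := by
  obtain ⟨h1, h1'⟩ := fderiv_form_apply hΓ hX.fst
  obtain ⟨h2, h2'⟩ := fderiv_add_commutator hX.snd h1 (differentiableAt_snd (p := z))
  refine ⟨h2, fun w => ?_⟩
  refine (h2' w).trans ?_
  rw [h1', hX.hasFDerivAt.fst.fderiv, hX.hasFDerivAt.snd.fderiv, fderiv_snd]
  rfl

/-- `vertPart` is the covariant derivative of the tautological endomorphism `z ↦ z.2` for the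
pulled-back connection. The formula is the curvature identity `D_X D_Y - D_Y D_X - D_[X,Y] = [R(X,
Y), ·]` applied to that section, solved for the term `D_[X,Y]`. -/
theorem vertPart_lieBracket {Γ : B → B →L[ℝ] F →L[ℝ] F} {z : B × (F →L[ℝ] F)}
    (hΓ : DifferentiableAt ℝ Γ z.1) {X Y : B × (F →L[ℝ] F) → B × (F →L[ℝ] F)}
    (hX : DifferentiableAt ℝ X z) (hY : DifferentiableAt ℝ Y z) :
    vertPart Γ z (VectorField.lieBracket ℝ X Y z) =
      (fderiv ℝ (fun z => vertPart Γ z (Y z)) z (X z) +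
        (Γ z.1 (X z).1 * vertPart Γ z (Y z) - vertPart Γ z (Y z) * Γ z.1 (X z).1)) -
      (fderiv ℝ (fun z => vertPart Γ z (X z)) z (Y z) +
        (Γ z.1 (Y z).1 * vertPart Γ z (X z) - vertPart Γ z (X z) * Γ z.1 (Y z).1)) -
      (formCurvature Γ z.1 (X z).1 (Y z).1 * z.2 -
        z.2 * formCurvature Γ z.1 (X z).1 (Y z).1) := by
  rw [(fderiv_vertPart hΓ hX).2, (fderiv_vertPart hΓ hY).2]
  simp only [VectorField.lieBracket, vertPart, formCurvature, Prod.fst_sub, Prod.snd_sub, map_sub]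
  noncomm_ring

/-! ### Differentiation along the sphere bundle, and projections of brackets to the base. -/

namespace IsTwistorModel

variable {Ω : Set B} {Γ : B → B →L[ℝ] F →L[ℝ] F} {ρ : B → F →L[ℝ] B}
    {S : Set (F →L[ℝ] F)} {L : Submodule ℝ (F →L[ℝ] F)} (h : IsTwistorModel Ω Γ ρ S L)
    {z : B × (F →L[ℝ] F)}

include h

/-- A function vanishing on the sphere bundle has null derivative along tangent vectors. -/
theorem fderiv_eq_zero {G : Type*} [NormedAddCommGroup G] [NormedSpace ℝ G] (hS : z.2 ∈ S)
    {f : B × (F →L[ℝ] F) → G} (hf : DifferentiableAt ℝ f z)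
    (h0 : ∀ᶠ z in 𝓝 z, z.2 ∈ S → f z = 0) {w : B × (F →L[ℝ] F)} (hw : w.2 ∈ L)
    (hw' : z.2 * w.2 = -(w.2 * z.2)) : fderiv ℝ f z w = 0 := by
  -- The function vanishes along `t ↦ (z.1 + t w.1, c t)`, a curve in the sphere bundle with
  -- velocity `w`.
  obtain ⟨c, hc0, hc, hcS⟩ := h.exists_curve _ hS _ hw hw'
  have h1 : HasDerivAt (fun t : ℝ => (z.1 + t • w.1, c t)) w 0 := by
    have : HasDerivAt (fun t : ℝ => z.1 + t • w.1) w.1 0 := by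
      simpa using ((hasDerivAt_id (0 : ℝ)).smul_const w.1).const_add z.1
    exact this.prodMk hc
  have h2 : (z.1 + (0 : ℝ) • w.1, c 0) = z := by simp [hc0]
  have h3 : HasDerivAt (fun t : ℝ => f (z.1 + t • w.1, c t)) (fderiv ℝ f z w) 0 := by
    have := hf.hasFDerivAt
    rw [← h2] at this
    have := this.comp_hasDerivAt (0 : ℝ) h1
    rwa [h2] at this
  have h4 : (fun t : ℝ => f (z.1 + t • w.1, c t)) =ᶠ[𝓝 0] fun _ => 0 := by
    have : Filter.Tendsto (fun t : ℝ => (z.1 + t • w.1, c t)) (𝓝 0) (𝓝 z) := by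
      have := h1.continuousAt.tendsto
      rwa [h2] at this
    filter_upwards [this.eventually h0] with t ht using ht (hcS t)
  exact h3.unique ((hasDerivAt_const (0 : ℝ) (0 : G)).congr_of_eventuallyEq h4)

/-- Compose with the projection onto a complement of `P`: the result vanishes on the sphere bundle,
which reduces the claim to `fderiv_eq_zero`. -/
theorem fderiv_mem {G : Type*} [NormedAddCommGroup G] [NormedSpace ℝ G] [FiniteDimensional ℝ G]
    (hS : z.2 ∈ S) (P : Submodule ℝ G)
    {f : B × (F →L[ℝ] F) → G} (hf : DifferentiableAt ℝ f z)
    (h0 : ∀ᶠ z in 𝓝 z, z.2 ∈ S → f z ∈ P) {w : B × (F →L[ℝ] F)} (hw : w.2 ∈ L)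
    (hw' : z.2 * w.2 = -(w.2 * z.2)) : fderiv ℝ f z w ∈ P := by
  obtain ⟨p, hp⟩ := Submodule.exists_isCompl P
  have hk : LinearMap.ker (P.projectionOnto p hp) = p := by simp
  set g : G →L[ℝ] G :=
    LinearMap.toContinuousLinearMap (LinearMap.id - P.subtype ∘ₗ P.projectionOnto p hp) with hg
  have hg0 : ∀ x, g x = x - P.projectionOnto p hp x := fun x => by simp [hg]
  have h1 : fderiv ℝ (fun z => g (f z)) z w = 0 := by
    refine h.fderiv_eq_zero hS (g.differentiableAt.comp z hf) ?_ hw hw'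
    filter_upwards [h0] with z hz hzS
    simp only [Function.comp_apply]
    rw [hg0, Submodule.projectionOnto_apply_left hp ⟨_, hz hzS⟩, sub_self]
  have h2 : fderiv ℝ (fun z => g (f z)) z w = g (fderiv ℝ f z w) := by
    have := (g.hasFDerivAt.comp z hf.hasFDerivAt).fderiv
    change fderiv ℝ (g ∘ f) z w = _
    rw [this]; rfl
  rw [h2, hg0, sub_eq_zero] at h1
  rw [h1]
  exact Submodule.coe_mem _

/-- The fibre component differs from the vertical part by the commutator of `Γ` with `J`. This lies
in `L` because `Γ` normalises `L`, and it anticommutes with `J` because `J² = -1` is central. -/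
theorem tangent_of_vertPart (hz : z.1 ∈ Ω) (hS : z.2 ∈ S) {w : B × (F →L[ℝ] F)}
    (hw : vertPart Γ z w ∈ L) (hw' : z.2 * vertPart Γ z w = -(vertPart Γ z w * z.2)) :
    w.2 ∈ L ∧ z.2 * w.2 = -(w.2 * z.2) := by
  have e : w.2 = vertPart Γ z w - (Γ z.1 w.1 * z.2 - z.2 * Γ z.1 w.1) := by simp [vertPart]
  have hJ := h.mul_self _ hS
  constructor
  · rw [e]
    exact L.sub_mem hw (h.commutator_mem _ hz _ _ (h.mem_span _ hS))
  · rw [e, mul_sub, sub_mul, hw', mul_sub, sub_mul, ← mul_assoc z.2 z.2, mul_assoc _ z.2 z.2, hJ]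
    noncomm_ring

/-- The horizontal part of a section of the twistor distribution is the image of a differentiable
function. -/
theorem exists_differentiable_lift [FiniteDimensional ℝ F] [FiniteDimensional ℝ B]
    (hz : z.1 ∈ Ω) (hS : z.2 ∈ S)
    {X₁ X₂ : B × (F →L[ℝ] F) → B × (F →L[ℝ] F)} (hX₁ : DifferentiableAt ℝ X₁ z)
    (hX₂ : DifferentiableAt ℝ X₂ z)
    (hX : ∀ᶠ z in 𝓝 z, z.2 ∈ S → (X₁ z, X₂ z) ∈ modelDistribution Γ ρ L z) :
    ∃ ε : B × (F →L[ℝ] F) → F, DifferentiableAt ℝ ε z ∧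
      ∀ᶠ z in 𝓝 z, z.2 ∈ S → (X₁ z).1 = ρ z.1 (ε z) ∧ (X₂ z).1 = ρ z.1 (z.2 (ε z)) := by
  have : CompleteSpace F := FiniteDimensional.complete ℝ F
  -- The two projections to the base of a vector of the distribution are the components of `K z q`.
  -- The kernel condition on the anchor makes `K z` injective at the given point.
  set K : B × (F →L[ℝ] F) → F →L[ℝ] B × B := fun z => (ρ z.1).prod ((ρ z.1).comp z.2) with hK
  have hρ : DifferentiableAt ℝ (fun z : B × (F →L[ℝ] F) => ρ z.1) z :=
    (h.differentiableAt_anchor _ hz).comp z differentiableAt_fst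
  have hKd : DifferentiableAt ℝ K z := by
    have := (hρ.clm_comp (differentiableAt_snd (p := z)))
    have e : K = fun z => (ContinuousLinearMap.inl ℝ B B).comp (ρ z.1) +
        (ContinuousLinearMap.inr ℝ B B).comp ((ρ z.1).comp z.2) := by
      ext z x <;> simp [hK]
    rw [e]
    exact ((differentiableAt_const _).clm_comp hρ).add ((differentiableAt_const _).clm_comp this)
  have hinj : Function.Injective (K z) := by
    rw [injective_iff_map_eq_zero]
    intro q hq
    simp only [hK, ContinuousLinearMap.prod_apply, Prod.mk_eq_zero] at hq
    exact h.eq_zero_of_anchor _ hz _ hS q hq.1 hq.2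
  obtain ⟨Λ₀, hΛ₀⟩ := LinearMap.exists_leftInverse_of_injective (K z : F →ₗ[ℝ] B × B)
    (LinearMap.ker_eq_bot.2 hinj)
  set Λ : B × B →L[ℝ] F := LinearMap.toContinuousLinearMap Λ₀ with hΛ
  have hM : Λ.comp (K z) = 1 := by
    ext q
    exact congrArg (fun f : F →ₗ[ℝ] F => f q) hΛ₀
  have hMd : DifferentiableAt ℝ (fun z => Λ.comp (K z)) z :=
    (differentiableAt_const _).clm_comp hKd
  -- `Λ` is a left inverse of `K` at the base point only. Nearby `Λ ∘ K` is still invertible and its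
  -- inverse is differentiable, so `(Λ ∘ K)⁻¹ ∘ Λ` is a differentiable family of left inverses.
  refine ⟨fun z => Ring.inverse (Λ.comp (K z)) (Λ ((X₁ z).1, (X₂ z).1)), ?_, ?_⟩
  · refine DifferentiableAt.clm_apply ?_ (Λ.differentiableAt.comp z (hX₁.fst.prodMk hX₂.fst))
    refine DifferentiableAt.comp (g := Ring.inverse) z ?_ hMd
    rw [hM]
    exact (contDiffAt_ringInverse (n := 1) ℝ (1 : (F →L[ℝ] F)ˣ)).differentiableAt (by simp)
  · have hu : ∀ᶠ z in 𝓝 z, IsUnit (Λ.comp (K z)) := by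
      have := hMd.continuousAt.tendsto
      rw [hM] at this
      exact this.eventually (Units.isOpen.mem_nhds isUnit_one)
    filter_upwards [hX, hu] with z hz1 hz2 hz3
    obtain ⟨-, q, hq1, hq2⟩ := hz1 hz3
    simp only at hq1 hq2
    have e : Λ ((X₁ z).1, (X₂ z).1) = (Λ.comp (K z)) q := by
      simp [hK, hq1, hq2]
    have e' : Ring.inverse (Λ.comp (K z)) (Λ ((X₁ z).1, (X₂ z).1)) = q := by
      rw [e, ← mul_apply_eq_comp, Ring.inverse_mul_cancel _ hz2]; rfl
    rw [e']
    exact ⟨hq1, hq2⟩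

/-- Differentiating `dπ(Y) = ρ η` along the tangent vector `X` gives `dρ(X) η + ρ (dη(X))`. After
antisymmetrisation, the `dρ` terms are those of the torsion; the `Γ` terms of the torsion turn `dη`
and `dε` into covariant derivatives. -/
theorem fst_lieBracket (hz : z.1 ∈ Ω) (hS : z.2 ∈ S)
    {X Y : B × (F →L[ℝ] F) → B × (F →L[ℝ] F)} (hX : DifferentiableAt ℝ X z)
    (hY : DifferentiableAt ℝ Y z) (hXt : (X z).2 ∈ L ∧ z.2 * (X z).2 = -((X z).2 * z.2))
    (hYt : (Y z).2 ∈ L ∧ z.2 * (Y z).2 = -((Y z).2 * z.2))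
    {ε η : B × (F →L[ℝ] F) → F} (hε : DifferentiableAt ℝ ε z) (hη : DifferentiableAt ℝ η z)
    (hXε : ∀ᶠ z in 𝓝 z, z.2 ∈ S → (X z).1 = ρ z.1 (ε z))
    (hYη : ∀ᶠ z in 𝓝 z, z.2 ∈ S → (Y z).1 = ρ z.1 (η z)) :
    (VectorField.lieBracket ℝ X Y z).1 = - formTorsion Γ ρ z.1 (ε z) (η z) +
      ρ z.1 ((fderiv ℝ η z (X z) + Γ z.1 (X z).1 (η z)) -
        (fderiv ℝ ε z (Y z) + Γ z.1 (Y z).1 (ε z))) := by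
  have key : ∀ {X Y : B × (F →L[ℝ] F) → B × (F →L[ℝ] F)} (hY : DifferentiableAt ℝ Y z)
      (hXt : (X z).2 ∈ L ∧ z.2 * (X z).2 = -((X z).2 * z.2))
      {η : B × (F →L[ℝ] F) → F} (hη : DifferentiableAt ℝ η z)
      (hYη : ∀ᶠ z in 𝓝 z, z.2 ∈ S → (Y z).1 = ρ z.1 (η z)),
      (fderiv ℝ Y z (X z)).1 =
        fderiv ℝ ρ z.1 (X z).1 (η z) + ρ z.1 (fderiv ℝ η z (X z)) := by
    intro X Y hY hXt η hη hYη
    have hρ : HasFDerivAt (fun z : B × (F →L[ℝ] F) => ρ z.1)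
        ((fderiv ℝ ρ z.1).comp (ContinuousLinearMap.fst ℝ B (F →L[ℝ] F))) z :=
      hasFDerivAt_comp_fst (h.differentiableAt_anchor _ hz)
    have h1 := hY.hasFDerivAt.fst.sub (hρ.clm_apply hη.hasFDerivAt)
    have h2 := h.fderiv_eq_zero (w := X z) hS h1.differentiableAt (by
      filter_upwards [hYη] with z hz hzS
      simp [hz hzS]) hXt.1 hXt.2
    rw [h1.fderiv] at h2
    simp at h2
    rw [← sub_eq_zero, ← h2]
    abel
  have e1 := hXε.self_of_nhds hS
  have e2 := hYη.self_of_nhds hS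
  simp only [VectorField.lieBracket, Prod.fst_sub]
  rw [key hY hXt hη hYη, key hX hYt hε hXε, e1, e2, formTorsion]
  simp only [map_sub, map_add]
  abel

end IsTwistorModel

/-- The conditions on the curvature and on the torsion of `d + Γ` at the complex structure `z.2`,
for the complex vectors `q - i J q` and `r - i J r`. -/
def ModelCondition (ρ : B → F →L[ℝ] B) (z : B × (F →L[ℝ] F))
    (R : B → B → F →L[ℝ] F) (T : F → F → B) (q r : F) : Prop :=
  (∃ a, T q r - T (z.2 q) (z.2 r) = ρ z.1 a ∧ T q (z.2 r) + T (z.2 q) r = ρ z.1 (z.2 a)) ∧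
  ((R (ρ z.1 q) (ρ z.1 (z.2 r)) + R (ρ z.1 (z.2 q)) (ρ z.1 r)) * z.2 -
    z.2 * (R (ρ z.1 q) (ρ z.1 (z.2 r)) + R (ρ z.1 (z.2 q)) (ρ z.1 r))) = 
  z.2 * ((R (ρ z.1 q) (ρ z.1 r) - R (ρ z.1 (z.2 q)) (ρ z.1 (z.2 r))) * z.2 -
    z.2 * (R (ρ z.1 q) (ρ z.1 r) - R (ρ z.1 (z.2 q)) (ρ z.1 (z.2 r))))

/-! ### The criterion for a bracket of sections to stay in the model distribution. -/

namespace IsTwistorModel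

variable {Ω : Set B} {Γ : B → B →L[ℝ] F →L[ℝ] F} {ρ : B → F →L[ℝ] B}
    {S : Set (F →L[ℝ] F)} {L : Submodule ℝ (F →L[ℝ] F)} (h : IsTwistorModel Ω Γ ρ S L)
    {z : B × (F →L[ℝ] F)}

include h

/-- The curvature normalises `L` because `Γ` does: for the derivative terms, differentiate the
membership `[Γ_y w, W] ∈ L` in `y`; for the quadratic terms, use the Jacobi identity. -/
theorem commutator_formCurvature_mem [FiniteDimensional ℝ F] (hz : z.1 ∈ Ω) (hS : z.2 ∈ S)
    (v w : B) {W : F →L[ℝ] F} (hW : W ∈ L) :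
    formCurvature Γ z.1 v w * W - W * formCurvature Γ z.1 v w ∈ L := by
  have key : ∀ v w, fderiv ℝ Γ z.1 v w * W - W * fderiv ℝ Γ z.1 v w ∈ L := by
    intro v w
    have h1 : HasFDerivAt (fun z : B × (F →L[ℝ] F) => Γ z.1)
        ((fderiv ℝ Γ z.1).comp (ContinuousLinearMap.fst ℝ B (F →L[ℝ] F))) z :=
      hasFDerivAt_form (h.differentiableAt_form _ hz)
    have h2 := h1.clm_apply (hasFDerivAt_const w z)
    have h3 := (h2.mul_const' W).sub (h2.const_mul W)
    have h4 := h.fderiv_mem (w := (v, 0)) hS L h3.differentiableAt (by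
      have : ∀ᶠ z' : B × (F →L[ℝ] F) in 𝓝 z, z'.1 ∈ Ω :=
        continuous_fst.continuousAt.eventually (h.isOpen.mem_nhds hz)
      filter_upwards [this] with z' hz' _
      exact h.commutator_mem _ hz' _ _ hW) L.zero_mem (by simp)
    rw [h3.fderiv] at h4
    simpa using h4
  -- The last two lines are the Jacobi identity for `[[Γ v, Γ w], W]`.
  have e : formCurvature Γ z.1 v w * W - W * formCurvature Γ z.1 v w =
      (fderiv ℝ Γ z.1 v w * W - W * fderiv ℝ Γ z.1 v w) -
      (fderiv ℝ Γ z.1 w v * W - W * fderiv ℝ Γ z.1 w v) +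
      ((Γ z.1 v * (Γ z.1 w * W - W * Γ z.1 w) - (Γ z.1 w * W - W * Γ z.1 w) * Γ z.1 v) -
        (Γ z.1 w * (Γ z.1 v * W - W * Γ z.1 v) - (Γ z.1 v * W - W * Γ z.1 v) * Γ z.1 w)) := by
    simp only [formCurvature]
    noncomm_ring
  rw [e]
  exact L.add_mem (L.sub_mem (key v w) (key w v)) (L.sub_mem
    (h.commutator_mem _ hz _ _ (h.commutator_mem _ hz _ _ hW))
    (h.commutator_mem _ hz _ _ (h.commutator_mem _ hz _ _ hW)))

/-- The covariant derivative of the vertical part `ν` of a section of the twistor distribution is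
in `L`, and anticommutes with the complex structure up to a symmetric term. -/
theorem covDeriv_vertPart [FiniteDimensional ℝ F] (hz : z.1 ∈ Ω) (hS : z.2 ∈ S)
    {ν : B × (F →L[ℝ] F) → F →L[ℝ] F} (hν : DifferentiableAt ℝ ν z)
    (hνL : ∀ᶠ z in 𝓝 z, z.2 ∈ S → ν z ∈ L ∧ z.2 * ν z = -(ν z * z.2))
    {w : B × (F →L[ℝ] F)} (hw : w.2 ∈ L ∧ z.2 * w.2 = -(w.2 * z.2)) :
    fderiv ℝ ν z w + (Γ z.1 w.1 * ν z - ν z * Γ z.1 w.1) ∈ L ∧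
    z.2 * (fderiv ℝ ν z w + (Γ z.1 w.1 * ν z - ν z * Γ z.1 w.1)) =
      -((fderiv ℝ ν z w + (Γ z.1 w.1 * ν z - ν z * Γ z.1 w.1)) * z.2) -
        (ν z * vertPart Γ z w + vertPart Γ z w * ν z) := by
  have h0 := hνL.self_of_nhds hS
  constructor
  · exact L.add_mem (h.fderiv_mem hS L hν (hνL.mono fun z hz hzS => (hz hzS).1) hw.1 hw.2)
      (h.commutator_mem _ hz _ _ h0.1)
  · have h1 := ((hasFDerivAt_snd (𝕜 := ℝ) (p := z)).mul' hν.hasFDerivAt).add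
      (hν.hasFDerivAt.mul' (hasFDerivAt_snd (𝕜 := ℝ) (p := z)))
    -- The function differentiated is `J ν + ν J`, null on the sphere bundle. The derivative falling
    -- on `J` produces the symmetric defect.
    have h2 := h.fderiv_eq_zero hS h1.differentiableAt (by
      filter_upwards [hνL] with z hz hzS
      simp [(hz hzS).2]) hw.1 hw.2
    rw [h1.fderiv] at h2
    simp at h2
    have e : z.2 * fderiv ℝ ν z w = -(fderiv ℝ ν z w * z.2) - (ν z * w.2 + w.2 * ν z) := by
      rw [← sub_eq_zero, ← h2]; noncomm_ring
    have e1 : z.2 * (Γ z.1 w.1 * ν z) = z.2 * Γ z.1 w.1 * ν z := by rw [mul_assoc]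
    have e2 : z.2 * (ν z * Γ z.1 w.1) = -(ν z * z.2 * Γ z.1 w.1) := by
      rw [← mul_assoc, h0.2, neg_mul]
    have e3 : Γ z.1 w.1 * z.2 * ν z = -(Γ z.1 w.1 * ν z * z.2) := by
      rw [mul_assoc, h0.2, mul_neg, mul_assoc]
    simp only [vertPart, mul_add, mul_sub, add_mul, sub_mul, e, e1, e2, e3]
    noncomm_ring

/-- The covariant derivative of the product of the tautological complex structure with `ν`. -/
theorem covDeriv_mul_vertPart (hS : z.2 ∈ S)
    {ν μ : B × (F →L[ℝ] F) → F →L[ℝ] F} (hν : DifferentiableAt ℝ ν z)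
    (hμ : DifferentiableAt ℝ μ z) (hνμ : ∀ᶠ z in 𝓝 z, z.2 ∈ S → μ z = z.2 * ν z)
    {w : B × (F →L[ℝ] F)} (hw : w.2 ∈ L ∧ z.2 * w.2 = -(w.2 * z.2)) :
    fderiv ℝ μ z w + (Γ z.1 w.1 * μ z - μ z * Γ z.1 w.1) =
      vertPart Γ z w * ν z +
        z.2 * (fderiv ℝ ν z w + (Γ z.1 w.1 * ν z - ν z * Γ z.1 w.1)) := by
  have h1 := hμ.hasFDerivAt.sub ((hasFDerivAt_snd (𝕜 := ℝ) (p := z)).mul' hν.hasFDerivAt)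
  have h2 := h.fderiv_eq_zero hS h1.differentiableAt (by
    filter_upwards [hνμ] with z hz hzS
    simp [hz hzS]) hw.1 hw.2
  rw [h1.fderiv] at h2
  simp at h2
  have e : fderiv ℝ μ z w = z.2 * fderiv ℝ ν z w + w.2 * ν z := by
    rw [← sub_eq_zero, ← h2]
  rw [e, hνμ.self_of_nhds hS, vertPart]
  noncomm_ring

/-- The real and imaginary vertical parts of the bracket turn out to be `P - [R₁, J]` and `J P -
[R₂, J]`, and its projections `ρ s - T₁` and `ρ (J s) - T₂`. The pairs `(P, J P)` and `(ρ s, ρ (J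
s))` satisfy the equations of the distribution by themselves, so membership is a condition on
curvature and torsion alone. -/
theorem lieBracket_mem_iff [FiniteDimensional ℝ F] [FiniteDimensional ℝ B]
    (hz : z.1 ∈ Ω) (hS : z.2 ∈ S)
    {X₁ X₂ Y₁ Y₂ : B × (F →L[ℝ] F) → B × (F →L[ℝ] F)} (hX₁ : DifferentiableAt ℝ X₁ z)
    (hX₂ : DifferentiableAt ℝ X₂ z) (hY₁ : DifferentiableAt ℝ Y₁ z)
    (hY₂ : DifferentiableAt ℝ Y₂ z)
    (hX : ∀ᶠ z in 𝓝 z, z.2 ∈ S → (X₁ z, X₂ z) ∈ modelDistribution Γ ρ L z)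
    (hY : ∀ᶠ z in 𝓝 z, z.2 ∈ S → (Y₁ z, Y₂ z) ∈ modelDistribution Γ ρ L z)
    {q r : F} (hq : (X₁ z).1 = ρ z.1 q ∧ (X₂ z).1 = ρ z.1 (z.2 q))
    (hr : (Y₁ z).1 = ρ z.1 r ∧ (Y₂ z).1 = ρ z.1 (z.2 r)) :
    (VectorField.lieBracket ℝ X₁ Y₁ z - VectorField.lieBracket ℝ X₂ Y₂ z,
      VectorField.lieBracket ℝ X₁ Y₂ z + VectorField.lieBracket ℝ X₂ Y₁ z) ∈
        modelDistribution Γ ρ L z ↔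
    ModelCondition ρ z (formCurvature Γ z.1) (formTorsion Γ ρ z.1) q r := by
  have hJ := h.mul_self _ hS
  have hΓ := h.differentiableAt_form _ hz
  obtain ⟨ε, hε, hXε⟩ := h.exists_differentiable_lift hz hS hX₁ hX₂ hX
  obtain ⟨η, hη, hYη⟩ := h.exists_differentiable_lift hz hS hY₁ hY₂ hY
  -- A vector is determined by its images under `ρ` and `ρ J`, so the differentiable lifts take the
  -- prescribed values `q` and `r` at the point.
  have huniq : ∀ {q q' : F}, ρ z.1 q = ρ z.1 q' → ρ z.1 (z.2 q) = ρ z.1 (z.2 q') → q = q' :=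
    fun h1 h2 => sub_eq_zero.1 (h.eq_zero_of_anchor _ hz _ hS _ (by simp [h1]) (by simp [h2]))
  have hεq : ε z = q := huniq ((hXε.self_of_nhds hS).1.symm.trans hq.1)
    ((hXε.self_of_nhds hS).2.symm.trans hq.2)
  have hηr : η z = r := huniq ((hYη.self_of_nhds hS).1.symm.trans hr.1)
    ((hYη.self_of_nhds hS).2.symm.trans hr.2)
  have anti : ∀ {J V : F →L[ℝ] F}, J * V = -(V * J) → J * (J * V) = -(J * V * J) := by
    intro J V e
    calc J * (J * V) = J * -(V * J) := by rw [e]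
      _ = -(J * V * J) := by rw [mul_neg, mul_assoc]
  have pairs : ∀ {X₁ X₂ : B × (F →L[ℝ] F) → B × (F →L[ℝ] F)},
      (∀ᶠ z in 𝓝 z, z.2 ∈ S → (X₁ z, X₂ z) ∈ modelDistribution Γ ρ L z) →
      (∀ᶠ z in 𝓝 z, z.2 ∈ S →
        (vertPart Γ z (X₁ z) ∈ L ∧ z.2 * vertPart Γ z (X₁ z) = -(vertPart Γ z (X₁ z) * z.2))) ∧
      (∀ᶠ z in 𝓝 z, z.2 ∈ S →
        (vertPart Γ z (X₂ z) ∈ L ∧ z.2 * vertPart Γ z (X₂ z) = -(vertPart Γ z (X₂ z) * z.2))) ∧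
      (∀ᶠ z in 𝓝 z, z.2 ∈ S → vertPart Γ z (X₂ z) = z.2 * vertPart Γ z (X₁ z)) := by
    intro X₁ X₂ hX
    refine ⟨hX.mono fun z hz hzS => ⟨(hz hzS).1.1, (hz hzS).1.2.1⟩, hX.mono fun z hz hzS => ?_,
      hX.mono fun z hz hzS => (hz hzS).1.2.2⟩
    obtain ⟨⟨h1, h2, h3⟩, -⟩ := hz hzS
    simp only at h3
    rw [h3]
    exact ⟨h.mul_mem _ hzS _ h1 h2, anti h2⟩
  obtain ⟨pX₁, pX₂, pX⟩ := pairs hX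
  obtain ⟨pY₁, pY₂, pY⟩ := pairs hY
  have tX₁ := h.tangent_of_vertPart hz hS (pX₁.self_of_nhds hS).1 (pX₁.self_of_nhds hS).2
  have tX₂ := h.tangent_of_vertPart hz hS (pX₂.self_of_nhds hS).1 (pX₂.self_of_nhds hS).2
  have tY₁ := h.tangent_of_vertPart hz hS (pY₁.self_of_nhds hS).1 (pY₁.self_of_nhds hS).2
  have tY₂ := h.tangent_of_vertPart hz hS (pY₂.self_of_nhds hS).1 (pY₂.self_of_nhds hS).2
  have eX := pX.self_of_nhds hS
  have eY := pY.self_of_nhds hS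
  have dX₁ := (fderiv_vertPart hΓ hX₁).1
  have dX₂ := (fderiv_vertPart hΓ hX₂).1
  have dY₁ := (fderiv_vertPart hΓ hY₁).1
  have dY₂ := (fderiv_vertPart hΓ hY₂).1
  -- the vertical part
  obtain ⟨P, hPL, hPJ, hP₁, hP₂⟩ : ∃ P ∈ L, z.2 * P = -(P * z.2) ∧
      vertPart Γ z (VectorField.lieBracket ℝ X₁ Y₁ z - VectorField.lieBracket ℝ X₂ Y₂ z) =
        P - ((formCurvature Γ z.1 (ρ z.1 q) (ρ z.1 r) -
          formCurvature Γ z.1 (ρ z.1 (z.2 q)) (ρ z.1 (z.2 r))) * z.2 -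
          z.2 * (formCurvature Γ z.1 (ρ z.1 q) (ρ z.1 r) -
          formCurvature Γ z.1 (ρ z.1 (z.2 q)) (ρ z.1 (z.2 r)))) ∧
      vertPart Γ z (VectorField.lieBracket ℝ X₁ Y₂ z + VectorField.lieBracket ℝ X₂ Y₁ z) =
        z.2 * P - ((formCurvature Γ z.1 (ρ z.1 q) (ρ z.1 (z.2 r)) +
          formCurvature Γ z.1 (ρ z.1 (z.2 q)) (ρ z.1 r)) * z.2 -
          z.2 * (formCurvature Γ z.1 (ρ z.1 q) (ρ z.1 (z.2 r)) +
          formCurvature Γ z.1 (ρ z.1 (z.2 q)) (ρ z.1 r))) := by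
    have b₁₁ := vertPart_lieBracket hΓ hX₁ hY₁
    have b₁₂ := vertPart_lieBracket hΓ hX₁ hY₂
    have b₂₁ := vertPart_lieBracket hΓ hX₂ hY₁
    have b₂₂ := vertPart_lieBracket hΓ hX₂ hY₂
    rw [hq.1, hr.1] at b₁₁
    rw [hq.1, hr.2] at b₁₂
    rw [hq.2, hr.1] at b₂₁
    rw [hq.2, hr.2] at b₂₂
    have c₁₁ := h.covDeriv_vertPart hz hS dY₁ pY₁ tX₁
    have c₂₂ := h.covDeriv_vertPart hz hS dY₂ pY₂ tX₂
    have c₁₁' := h.covDeriv_vertPart hz hS dX₁ pX₁ tY₁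
    have c₂₂' := h.covDeriv_vertPart hz hS dX₂ pX₂ tY₂
    have m₁₂ := h.covDeriv_mul_vertPart hS dY₁ dY₂ pY tX₁
    have m₂₂ := h.covDeriv_mul_vertPart hS dY₁ dY₂ pY tX₂
    have m₁₂' := h.covDeriv_mul_vertPart hS dX₁ dX₂ pX tY₁
    have m₂₂' := h.covDeriv_mul_vertPart hS dX₁ dX₂ pX tY₂
    rw [hq.1] at c₁₁ m₁₂
    rw [hq.2] at c₂₂ m₂₂
    rw [hr.1] at c₁₁' m₁₂'
    rw [hr.2] at c₂₂' m₂₂'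
    have hsub : ∀ v w, vertPart Γ z (v - w) = vertPart Γ z v - vertPart Γ z w := by
      intro v w; simp only [vertPart, Prod.snd_sub, Prod.fst_sub, map_sub]; noncomm_ring
    have hadd : ∀ v w, vertPart Γ z (v + w) = vertPart Γ z v + vertPart Γ z w := by
      intro v w; simp only [vertPart, Prod.snd_add, Prod.fst_add, map_add]; noncomm_ring
    rw [hsub, hadd, b₁₁, b₁₂, b₂₁, b₂₂]
    clear b₁₁ b₁₂ b₂₁ b₂₂
    generalize fderiv ℝ (fun z => vertPart Γ z (Y₁ z)) z (X₁ z) + (Γ z.1 (ρ z.1 q) *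
      vertPart Γ z (Y₁ z) - vertPart Γ z (Y₁ z) * Γ z.1 (ρ z.1 q)) = D₁₁ at *
    generalize fderiv ℝ (fun z => vertPart Γ z (Y₂ z)) z (X₁ z) + (Γ z.1 (ρ z.1 q) *
      vertPart Γ z (Y₂ z) - vertPart Γ z (Y₂ z) * Γ z.1 (ρ z.1 q)) = D₁₂ at *
    generalize fderiv ℝ (fun z => vertPart Γ z (Y₁ z)) z (X₂ z) + (Γ z.1 (ρ z.1 (z.2 q)) *
      vertPart Γ z (Y₁ z) - vertPart Γ z (Y₁ z) * Γ z.1 (ρ z.1 (z.2 q))) = D₂₁ at *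
    generalize fderiv ℝ (fun z => vertPart Γ z (Y₂ z)) z (X₂ z) + (Γ z.1 (ρ z.1 (z.2 q)) *
      vertPart Γ z (Y₂ z) - vertPart Γ z (Y₂ z) * Γ z.1 (ρ z.1 (z.2 q))) = D₂₂ at *
    generalize fderiv ℝ (fun z => vertPart Γ z (X₁ z)) z (Y₁ z) + (Γ z.1 (ρ z.1 r) *
      vertPart Γ z (X₁ z) - vertPart Γ z (X₁ z) * Γ z.1 (ρ z.1 r)) = E₁₁ at *
    generalize fderiv ℝ (fun z => vertPart Γ z (X₂ z)) z (Y₁ z) + (Γ z.1 (ρ z.1 r) *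
      vertPart Γ z (X₂ z) - vertPart Γ z (X₂ z) * Γ z.1 (ρ z.1 r)) = E₁₂ at *
    generalize fderiv ℝ (fun z => vertPart Γ z (X₁ z)) z (Y₂ z) + (Γ z.1 (ρ z.1 (z.2 r)) *
      vertPart Γ z (X₁ z) - vertPart Γ z (X₁ z) * Γ z.1 (ρ z.1 (z.2 r))) = E₂₁ at *
    generalize fderiv ℝ (fun z => vertPart Γ z (X₂ z)) z (Y₂ z) + (Γ z.1 (ρ z.1 (z.2 r)) *
      vertPart Γ z (X₂ z) - vertPart Γ z (X₂ z) * Γ z.1 (ρ z.1 (z.2 r))) = E₂₂ at *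
    have hJ' : ∀ A : F →L[ℝ] F, z.2 * (z.2 * A) = -A := fun A => by rw [← mul_assoc, hJ, neg_one_mul]
    -- `Dᵢⱼ` is the covariant derivative of `ν(Yⱼ)` along `Xᵢ`, and `Eᵢⱼ` that of `ν(Xⱼ)` along
    -- `Yᵢ`. The symmetric defects of anticommutation cancel within `D₁₁ - E₁₁` and within `D₂₂ -
    -- E₂₂`.
    refine ⟨D₁₁ - E₁₁ - (D₂₂ - E₂₂), L.sub_mem (L.sub_mem c₁₁.1 c₁₁'.1) (L.sub_mem c₂₂.1 c₂₂'.1),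
      ?_, ?_, ?_⟩
    · rw [mul_sub, mul_sub, mul_sub, c₁₁.2, c₁₁'.2, c₂₂.2, c₂₂'.2]
      noncomm_ring
    · noncomm_ring
    -- Differentiating `ν(Y₂) = J ν(Y₁)` along `X₁` and `X₂` gives `D₁₂ + D₂₁ = J (D₁₁ - D₂₂)`: the
    -- products `ν(X₁) ν(Y₁)` cancel since `ν(X₂) = J ν(X₁)`. The same holds for the `E` terms.
    · rw [m₁₂, m₁₂', m₂₂, m₂₂', eX, eY]
      simp only [mul_sub, mul_add, hJ', mul_assoc]
      noncomm_ring
  -- the horizontal part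
  obtain ⟨s, hs₁, hs₂⟩ : ∃ s,
      (VectorField.lieBracket ℝ X₁ Y₁ z - VectorField.lieBracket ℝ X₂ Y₂ z).1 =
        ρ z.1 s - (formTorsion Γ ρ z.1 q r - formTorsion Γ ρ z.1 (z.2 q) (z.2 r)) ∧
      (VectorField.lieBracket ℝ X₁ Y₂ z + VectorField.lieBracket ℝ X₂ Y₁ z).1 =
        ρ z.1 (z.2 s) - (formTorsion Γ ρ z.1 q (z.2 r) + formTorsion Γ ρ z.1 (z.2 q) r) := by
    have hXε' := hXε.mono fun z hz hzS => (hz hzS).1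
    have hYη' := hYη.mono fun z hz hzS => (hz hzS).1
    have hXε'' := hXε.mono fun z hz hzS => (hz hzS).2
    have hYη'' := hYη.mono fun z hz hzS => (hz hzS).2
    have hA : ∀ {ε : B × (F →L[ℝ] F) → F}, DifferentiableAt ℝ ε z →
        DifferentiableAt ℝ (fun z => z.2 (ε z)) z ∧ ∀ w, fderiv ℝ (fun z => z.2 (ε z)) z w +
          Γ z.1 w.1 (z.2 (ε z)) =
          vertPart Γ z w (ε z) + z.2 (fderiv ℝ ε z w + Γ z.1 w.1 (ε z)) := by
      intro ε hε
      have h1 := (hasFDerivAt_snd (𝕜 := ℝ) (p := z)).clm_apply hε.hasFDerivAt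
      refine ⟨h1.differentiableAt, fun w => ?_⟩
      rw [h1.fderiv]
      simp [vertPart]
      abel
    have b₁₁ := h.fst_lieBracket hz hS hX₁ hY₁ tX₁ tY₁ hε hη hXε' hYη'
    have b₁₂ := h.fst_lieBracket hz hS hX₁ hY₂ tX₁ tY₂ hε (hA hη).1 hXε' hYη''
    have b₂₁ := h.fst_lieBracket hz hS hX₂ hY₁ tX₂ tY₁ (hA hε).1 hη hXε'' hYη'
    have b₂₂ := h.fst_lieBracket hz hS hX₂ hY₂ tX₂ tY₂ (hA hε).1 (hA hη).1 hXε'' hYη''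
    rw [(hA hη).2] at b₁₂ b₂₂
    rw [(hA hε).2] at b₂₁ b₂₂
    rw [hεq, hηr] at b₁₁ b₁₂ b₂₁ b₂₂
    have hJ' : ∀ v : F, z.2 (z.2 v) = -v := fun v => by
      rw [← mul_apply_eq_comp, hJ]; simp
    -- The witness is the real part of the complex covariant derivative of `η + i J η` along `X₁ + i
    -- X₂`, minus the one with the two fields exchanged; `D (J η) = ν η + J D η` accounts for the
    -- `vertPart` terms.
    refine ⟨(fderiv ℝ η z (X₁ z) + Γ z.1 (X₁ z).1 r - (fderiv ℝ ε z (Y₁ z) + Γ z.1 (Y₁ z).1 q)) -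
      (vertPart Γ z (X₂ z) r + z.2 (fderiv ℝ η z (X₂ z) + Γ z.1 (X₂ z).1 r) -
        (vertPart Γ z (Y₂ z) q + z.2 (fderiv ℝ ε z (Y₂ z) + Γ z.1 (Y₂ z).1 q))), ?_, ?_⟩
    · rw [Prod.fst_sub, b₁₁, b₂₂]
      simp only [map_sub, map_add]
      abel
    · rw [Prod.fst_add, b₁₂, b₂₁, eX, eY]
      simp only [map_sub, map_add, mul_apply_eq_comp, hJ', map_neg]
      abel
  have aX : (VectorField.lieBracket ℝ X₁ Y₁ z - VectorField.lieBracket ℝ X₂ Y₂ z,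
      VectorField.lieBracket ℝ X₁ Y₂ z + VectorField.lieBracket ℝ X₂ Y₁ z) ∈
        modelDistribution Γ ρ L z ↔
      ((vertPart Γ z (VectorField.lieBracket ℝ X₁ Y₁ z - VectorField.lieBracket ℝ X₂ Y₂ z) ∈ L ∧
      z.2 * vertPart Γ z (VectorField.lieBracket ℝ X₁ Y₁ z - VectorField.lieBracket ℝ X₂ Y₂ z) =
      -(vertPart Γ z (VectorField.lieBracket ℝ X₁ Y₁ z - VectorField.lieBracket ℝ X₂ Y₂ z) * z.2) ∧
      vertPart Γ z (VectorField.lieBracket ℝ X₁ Y₂ z + VectorField.lieBracket ℝ X₂ Y₁ z) =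
      z.2 * vertPart Γ z (VectorField.lieBracket ℝ X₁ Y₁ z - VectorField.lieBracket ℝ X₂ Y₂ z)) ∧
    ∃ q, (VectorField.lieBracket ℝ X₁ Y₁ z - VectorField.lieBracket ℝ X₂ Y₂ z).1 = ρ z.1 q ∧
      (VectorField.lieBracket ℝ X₁ Y₂ z + VectorField.lieBracket ℝ X₂ Y₁ z).1 =
      ρ z.1 (z.2 q)) := Iff.rfl
  rw [aX, hP₁, hP₂, hs₁, hs₂, ModelCondition]
  have hR₁ : (formCurvature Γ z.1 (ρ z.1 q) (ρ z.1 r) -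
          formCurvature Γ z.1 (ρ z.1 (z.2 q)) (ρ z.1 (z.2 r))) * z.2 -
          z.2 * (formCurvature Γ z.1 (ρ z.1 q) (ρ z.1 r) -
          formCurvature Γ z.1 (ρ z.1 (z.2 q)) (ρ z.1 (z.2 r))) ∈ L := by
    have e₁ := h.commutator_formCurvature_mem hz hS (ρ z.1 q) (ρ z.1 r) (h.mem_span _ hS)
    have e₂ := h.commutator_formCurvature_mem hz hS (ρ z.1 (z.2 q)) (ρ z.1 (z.2 r))
      (h.mem_span _ hS)
    have := L.sub_mem e₁ e₂
    convert this using 1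
    noncomm_ring
  -- Any commutator with `J` anticommutes with `J`. With `hR₁`, this makes the conditions on the
  -- real vertical part automatic and leaves only the relation between the imaginary and the real
  -- one.
  have hanti : ∀ R : F →L[ℝ] F, z.2 * (R * z.2 - z.2 * R) = -((R * z.2 - z.2 * R) * z.2) := by
    intro R
    rw [mul_sub, sub_mul, ← mul_assoc z.2 z.2, mul_assoc R, hJ]
    noncomm_ring
  have hRJ := hanti (formCurvature Γ z.1 (ρ z.1 q) (ρ z.1 r) -
          formCurvature Γ z.1 (ρ z.1 (z.2 q)) (ρ z.1 (z.2 r)))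
  generalize (formCurvature Γ z.1 (ρ z.1 q) (ρ z.1 r) -
          formCurvature Γ z.1 (ρ z.1 (z.2 q)) (ρ z.1 (z.2 r))) * z.2 -
          z.2 * (formCurvature Γ z.1 (ρ z.1 q) (ρ z.1 r) -
          formCurvature Γ z.1 (ρ z.1 (z.2 q)) (ρ z.1 (z.2 r))) = R₁ at *
  generalize (formCurvature Γ z.1 (ρ z.1 q) (ρ z.1 (z.2 r)) +
          formCurvature Γ z.1 (ρ z.1 (z.2 q)) (ρ z.1 r)) * z.2 -
          z.2 * (formCurvature Γ z.1 (ρ z.1 q) (ρ z.1 (z.2 r)) +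
          formCurvature Γ z.1 (ρ z.1 (z.2 q)) (ρ z.1 r)) = R₂ at *
  generalize formTorsion Γ ρ z.1 q r - formTorsion Γ ρ z.1 (z.2 q) (z.2 r) = T₁ at *
  generalize formTorsion Γ ρ z.1 q (z.2 r) + formTorsion Γ ρ z.1 (z.2 q) r = T₂ at *
  constructor
  · rintro ⟨⟨-, -, hv⟩, a, ha₁, ha₂⟩
    refine ⟨⟨s - a, ?_, ?_⟩, ?_⟩
    · rw [map_sub, ← ha₁]; abel
    · rw [map_sub, map_sub, ← ha₂]; abel
    · rw [mul_sub] at hv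
      exact sub_right_injective hv
  · rintro ⟨⟨a, ha₁, ha₂⟩, hv⟩
    refine ⟨⟨L.sub_mem hPL hR₁, ?_, ?_⟩, s - a, ?_, ?_⟩
    · rw [mul_sub, hPJ, hRJ]; noncomm_ring
    · rw [mul_sub, hv]
    · rw [map_sub, ← ha₁]
    · rw [map_sub, map_sub, ← ha₂]

end IsTwistorModel
end LocalModel

/-! ### Linear algebra of complexifications -/

section Complexification

variable {U V W T : Type*} [AddCommGroup U] [Module ℝ U] [AddCommGroup V] [Module ℝ V]
  [AddCommGroup W] [Module ℝ W] [AddCommGroup T] [Module ℝ T]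

theorem cvec_add (a b c d : V) : cvec a b + cvec c d = cvec (a + c) (b + d) := by
  simp only [cvec, TensorProduct.tmul_add]; abel

theorem smul_cvec (z : ℂ) (a b : V) :
    z • cvec a b = cvec (z.re • a - z.im • b) (z.re • b + z.im • a) := by
  have h1 : z ⊗ₜ[ℝ] a = (1 : ℂ) ⊗ₜ[ℝ] (z.re • a) + Complex.I ⊗ₜ[ℝ] (z.im • a) := by
    rw [← TensorProduct.smul_tmul, ← TensorProduct.smul_tmul, ← TensorProduct.add_tmul]
    congr 1; apply Complex.ext <;> simp
  have h2 : (z * Complex.I) ⊗ₜ[ℝ] b = (1 : ℂ) ⊗ₜ[ℝ] (-z.im • b) + Complex.I ⊗ₜ[ℝ] (z.re • b) := by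
    rw [← TensorProduct.smul_tmul, ← TensorProduct.smul_tmul, ← TensorProduct.add_tmul]
    congr 1; apply Complex.ext <;> simp
  simp only [cvec, smul_add, TensorProduct.smul_tmul', smul_eq_mul, mul_one, h1, h2,
    TensorProduct.tmul_add, sub_eq_add_neg, neg_smul]
  abel

theorem exists_eq_cvec (w : ℂ ⊗[ℝ] V) : ∃ a b : V, w = cvec a b := by
  induction w using TensorProduct.induction_on with
  | zero => exact ⟨0, 0, by simp [cvec]⟩
  | tmul z v =>
    refine ⟨z.re • v, z.im • v, ?_⟩
    have := smul_cvec z v 0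
    simpa [cvec, TensorProduct.smul_tmul'] using this
  | add x y hx hy =>
    obtain ⟨a, b, rfl⟩ := hx
    obtain ⟨c, d, rfl⟩ := hy
    exact ⟨_, _, cvec_add _ _ _ _⟩

/-- The real and imaginary parts are recovered by the linear maps `z ⊗ v ↦ z.re • v` and `z ⊗ v ↦
z.im • v`. -/
theorem cvec_inj {a b c d : V} : cvec a b = cvec c d ↔ a = c ∧ b = d := by
  refine ⟨fun h => ?_, fun h => by rw [h.1, h.2]⟩
  have h1 := congrArg (TensorProduct.lift ((LinearMap.lsmul ℝ V).comp Complex.reLm)) h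
  have h2 := congrArg (TensorProduct.lift ((LinearMap.lsmul ℝ V).comp Complex.imLm)) h
  simp [cvec] at h1 h2
  exact ⟨h1, h2⟩

theorem baseChange_cvec (f : V →ₗ[ℝ] W) (a b : V) :
    f.baseChange ℂ (cvec a b) = cvec (f a) (f b) := by
  simp [cvec]

theorem cvec_mem_baseChange {S : Submodule ℝ V} {a b : V} :
    cvec a b ∈ S.baseChange ℂ ↔ a ∈ S ∧ b ∈ S := by
  constructor
  · intro h
    rw [Submodule.baseChange] at h
    obtain ⟨w, hw⟩ := h
    obtain ⟨c, d, rfl⟩ := exists_eq_cvec w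
    rw [baseChange_cvec, cvec_inj] at hw
    exact ⟨hw.1 ▸ c.2, hw.2 ▸ d.2⟩
  · rintro ⟨ha, hb⟩
    exact Submodule.add_mem _ (Submodule.tmul_mem_baseChange_of_mem _ ha)
      (Submodule.tmul_mem_baseChange_of_mem _ hb)

theorem complexify₂_cvec (B : U →ₗ[ℝ] V →ₗ[ℝ] W) (a b : U) (c d : V) :
    complexify₂ B (cvec a b) (cvec c d) = cvec (B a c - B b d) (B a d + B b c) := by
  have : ∀ (z w : ℂ) (u : U) (v : V),
      complexify₂ B (z ⊗ₜ[ℝ] u) (w ⊗ₜ[ℝ] v) = (z * w) ⊗ₜ[ℝ] B u v := by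
    intro z w u v
    simp [complexify₂, TensorProduct.smul_tmul']
  simp only [cvec, map_add, LinearMap.add_apply, this, one_mul, mul_one, Complex.I_mul_I,
    TensorProduct.neg_tmul, TensorProduct.tmul_sub, TensorProduct.tmul_add]
  abel

theorem complexify₃_cvec (B : T →ₗ[ℝ] U →ₗ[ℝ] V →ₗ[ℝ] W) (p q : T) (a b : U) (c d : V) :
    complexify₃ B (cvec p q) (cvec a b) (cvec c d) =
      cvec ((B p a - B q b) c - (B p b + B q a) d) ((B p a - B q b) d + (B p b + B q a) c) := by
  have : ∀ (x z w : ℂ) (t : T) (u : U) (v : V),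
      complexify₃ B (x ⊗ₜ[ℝ] t) (z ⊗ₜ[ℝ] u) (w ⊗ₜ[ℝ] v) = (x * (z * w)) ⊗ₜ[ℝ] B t u v := by
    intro x z w t u v
    simp [complexify₃, complexify₂, TensorProduct.smul_tmul']
  simp only [cvec, map_add, LinearMap.add_apply, LinearMap.sub_apply, this, one_mul, mul_one,
    Complex.I_mul_I, mul_neg, TensorProduct.neg_tmul, TensorProduct.tmul_sub,
    TensorProduct.tmul_add]
  abel

end Complexification

/-! ### Endomorphisms anticommuting with a complex structure, and normalized lines. -/

section Endomorphisms

variable {F : Type*} [NormedAddCommGroup F] [NormedSpace ℝ F]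

/-- For `P² = -1`, the map `W ↦ (W + P W P) / 2` is the projection onto the endomorphisms
anticommuting with `P`. -/
theorem eq_half_add_conj {P W : F →L[ℝ] F} (hP : P * P = -1) (h : P * W = -(W * P)) :
    W = (2⁻¹ : ℝ) • (W + P * W * P) := by
  rw [h, neg_mul, mul_assoc, hP]
  ext1 q
  simp [← two_smul ℝ]

/-- The normalizing factor is even in `t`, so its derivative at `0` vanishes and only `W` remains.
-/
theorem hasDerivAt_normalized_line (P W : F →L[ℝ] F) (c : ℝ) :
    HasDerivAt (fun t : ℝ => (Real.sqrt (1 + t ^ 2 * c))⁻¹ • (P + t • W)) W 0 := by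
  have h1 : HasDerivAt (fun t : ℝ => 1 + t ^ 2 * c) 0 0 := by
    simpa using (((hasDerivAt_id (0 : ℝ)).pow 2).mul_const c).const_add 1
  have h2 := (h1.sqrt (by simp)).fun_inv (by simp)
  have h3 := ((hasDerivAt_id (0 : ℝ)).smul_const W).const_add P
  simpa using h2.fun_smul h3

theorem normalized_line_zero (P W : F →L[ℝ] F) (c : ℝ) :
    (Real.sqrt (1 + (0 : ℝ) ^ 2 * c))⁻¹ • (P + (0 : ℝ) • W) = P := by simp

end Endomorphisms

/-! ### Left multiplications by quaternions -/

section LeftMul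

variable {k : ℕ}

@[simp] theorem leftMul_apply (p : ℍ[ℝ]) (q : HVec k) (i : Fin k) : leftMul k p q i = p * q i := rfl

theorem leftMul_add (p r : ℍ[ℝ]) : leftMul k (p + r) = leftMul k p + leftMul k r := by
  ext1 q; ext1 i; simp [add_mul]

theorem leftMul_smul (c : ℝ) (p : ℍ[ℝ]) : leftMul k (c • p) = c • leftMul k p := by
  ext1 q; ext1 i; simp

theorem leftMul_mul (p r : ℍ[ℝ]) : leftMul k (p * r) = leftMul k p * leftMul k r := by
  ext1 q; ext1 i; simp [mul_assoc]

theorem leftMul_one : leftMul k 1 = 1 := by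
  ext1 q; ext1 i; simp

theorem leftMul_neg (p : ℍ[ℝ]) : leftMul k (-p) = - leftMul k p := by
  ext1 q; ext1 i; simp

theorem vecMul_leftMul (c : ℍ[ℝ]) (v : HVec k) (C : Matrix (Fin k) (Fin k) ℍ[ℝ]) :
    Matrix.vecMul (leftMul k c v) C = leftMul k c (Matrix.vecMul v C) := by
  ext1 i
  simp [leftMul, Matrix.vecMul, dotProduct, mul_assoc]

variable (k) in
/-- The left multiplications by imaginary quaternions. -/
def imLeftMul : Submodule ℝ (HVec k →L[ℝ] HVec k) where
  carrier := {A | ∃ p : ℍ[ℝ], p.re = 0 ∧ A = leftMul k p}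
  zero_mem' := ⟨0, by simp, by ext1 q; ext1 i; simp⟩
  add_mem' := by
    rintro _ _ ⟨p, hp, rfl⟩ ⟨r, hr, rfl⟩
    exact ⟨p + r, by simp [hp, hr], (leftMul_add _ _).symm⟩
  smul_mem' := by
    rintro c _ ⟨p, hp, rfl⟩
    exact ⟨c • p, by simp [hp], (leftMul_smul _ _).symm⟩

variable (k) in
/-- The left multiplications by imaginary quaternions of norm one. -/
def unitImLeftMul : Set (HVec k →L[ℝ] HVec k) :=
  {A | ∃ p : ℍ[ℝ], p.re = 0 ∧ ‖p‖ = 1 ∧ A = leftMul k p}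

theorem Quaternion.mul_self_of_re_eq_zero {p : ℍ[ℝ]} (hp : p.re = 0) :
    p * p = -((‖p‖ ^ 2 : ℝ) : ℍ[ℝ]) := by
  have := Quaternion.sq_eq_neg_normSq.2 hp
  rw [← sq, this, Quaternion.normSq_eq_norm_mul_self, sq]

theorem Quaternion.re_mul_comm (p r : ℍ[ℝ]) : (p * r).re = (r * p).re := by
  simp; ring

theorem leftMul_mul_self {p : ℍ[ℝ]} (hp : p.re = 0) (hp' : ‖p‖ = 1) :
    leftMul k p * leftMul k p = -1 := by
  rw [← leftMul_mul, Quaternion.mul_self_of_re_eq_zero hp, hp']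
  simp [leftMul_neg, leftMul_one]

/-- An imaginary left multiplication which anticommutes with `leftMul k p` is given by an imaginary
quaternion which anticommutes with `p`. -/
theorem exists_anticommuting {p : ℍ[ℝ]} (hp : p.re = 0) (hp' : ‖p‖ = 1)
    {W : HVec k →L[ℝ] HVec k} (hW : W ∈ imLeftMul k)
    (h : leftMul k p * W = -(W * leftMul k p)) :
    ∃ w : ℍ[ℝ], w.re = 0 ∧ p * w = -(w * p) ∧ W = leftMul k w := by
  obtain ⟨w, hw, rfl⟩ := hW
  have hpp : p * p = -1 := by rw [Quaternion.mul_self_of_re_eq_zero hp, hp']; simp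
  -- The quaternion `w` need not anticommute with `p`, since `leftMul k` is not injective when `k =
  -- 0`. It is replaced by its anticommuting part, which represents the same endomorphism.
  refine ⟨(2⁻¹ : ℝ) • (w + p * w * p), ?_, ?_, ?_⟩
  · have : (p * w * p).re = 0 := by
      rw [Quaternion.re_mul_comm, ← mul_assoc, hpp]; simp [hw]
    simp only [Quaternion.re_smul, Quaternion.re_add, this, hw]; simp
  · have e1 : p * (p * w * p) = -(w * p) := by
      rw [mul_assoc p w p, ← mul_assoc, hpp]; simp
    have e2 : p * w * p * p = -(p * w) := by
      rw [mul_assoc, hpp]; simp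
    rw [mul_smul_comm, smul_mul_assoc, mul_add, add_mul, e1, e2, ← smul_neg]
    congr 1; abel
  · rw [leftMul_smul, leftMul_add, leftMul_mul, leftMul_mul]
    exact eq_half_add_conj (leftMul_mul_self hp hp') h

/-- The real part of a product is symmetric in its factors, so `p w = -w p` forces `p w` to be
imaginary. -/
theorem mul_mem_imLeftMul {J W : HVec k →L[ℝ] HVec k} (hJ : J ∈ unitImLeftMul k)
    (hW : W ∈ imLeftMul k) (h : J * W = -(W * J)) : J * W ∈ imLeftMul k := by
  obtain ⟨p, hp, hp', rfl⟩ := hJ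
  obtain ⟨w, hw, hpw, rfl⟩ := exists_anticommuting hp hp' hW h
  refine ⟨p * w, ?_, (leftMul_mul _ _).symm⟩
  have h1 := congrArg (fun q : ℍ[ℝ] => q.re) hpw
  have h2 := Quaternion.re_mul_comm p w
  simp only [Quaternion.re_neg] at h1
  linarith

/-- Anticommuting imaginary quaternions are orthogonal, so `|p + t w|² = 1 + t² |w|²`, and the line
`p + t w`, divided by its norm, is a curve in the sphere with velocity `w` at `p`. -/
theorem exists_curve_unitImLeftMul {J W : HVec k →L[ℝ] HVec k} (hJ : J ∈ unitImLeftMul k)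
    (hW : W ∈ imLeftMul k) (h : J * W = -(W * J)) :
    ∃ c : ℝ → HVec k →L[ℝ] HVec k, c 0 = J ∧ HasDerivAt c W 0 ∧ ∀ t, c t ∈ unitImLeftMul k := by
  obtain ⟨p, hp, hp', rfl⟩ := hJ
  obtain ⟨w, hw, hpw, rfl⟩ := exists_anticommuting hp hp' hW h
  have hnorm : ∀ t : ℝ, ‖p + t • w‖ ^ 2 = 1 + t ^ 2 * ‖w‖ ^ 2 := by
    intro t
    have hre : (p + t • w).re = 0 := by simp [hp, hw]
    have h1 := Quaternion.mul_self_of_re_eq_zero hre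
    have h2 : (p + t • w) * (p + t • w) = p * p + (t * t) • (w * w) := by
      simp only [mul_add, add_mul, smul_mul_assoc, mul_smul_comm, hpw, mul_smul]
      module
    rw [h2, Quaternion.mul_self_of_re_eq_zero hp, Quaternion.mul_self_of_re_eq_zero hw, hp'] at h1
    have h3 := congrArg (fun q : ℍ[ℝ] => q.re) h1
    simp only [Quaternion.re_add, Quaternion.re_neg, Quaternion.re_smul, Quaternion.re_coe,
      smul_eq_mul] at h3
    linarith
  have hpos : ∀ t : ℝ, 0 < 1 + t ^ 2 * ‖w‖ ^ 2 := fun t => by positivity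
  refine ⟨fun t => (Real.sqrt (1 + t ^ 2 * ‖w‖ ^ 2))⁻¹ • (leftMul k p + t • leftMul k w),
    normalized_line_zero _ _ _, ?_, fun t => ⟨(Real.sqrt (1 + t ^ 2 * ‖w‖ ^ 2))⁻¹ • (p + t • w), by simp [hp, hw],
      ?_, by rw [leftMul_smul, leftMul_add, leftMul_smul]⟩⟩
  · exact hasDerivAt_normalized_line _ _ _
  · rw [norm_smul, ← hnorm, Real.sqrt_sq (norm_nonneg _), norm_inv, norm_norm]
    apply inv_mul_cancel₀
    intro h0
    have := hnorm t
    rw [h0] at this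
    have := hpos t
    linarith

/-- The part `q ↦ q A` commutes with left multiplications, which leaves the commutator of two
quaternions, and this is imaginary. -/
theorem commutator_mem_of_mem_spglLie {G W : HVec k →L[ℝ] HVec k}
    (hG : (G : HVec k → HVec k) ∈ spglLie k) (hW : W ∈ imLeftMul k) :
    G * W - W * G ∈ imLeftMul k := by
  obtain ⟨a, ha, A, hA⟩ := hG
  obtain ⟨w, hw, rfl⟩ := hW
  refine ⟨a * w - w * a, by simp; ring, ?_⟩
  ext1 q
  have h1 : leftMul k (a * w - w * a) = leftMul k a * leftMul k w - leftMul k w * leftMul k a := by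
    rw [sub_eq_add_neg, leftMul_add, leftMul_neg, leftMul_mul, leftMul_mul, sub_eq_add_neg]
  rw [h1]
  simp only [sub_apply, mul_apply_eq_comp, hA, vecMul_leftMul, map_sub]
  abel

/-- Right multiplication by `A⁻¹` commutes with left multiplications, so conjugation by `g` acts on
`p` as conjugation by the unit quaternion `a`, which preserves the norm and the real part. -/
theorem SpGL.conj_leftMul {g : HVec k ≃L[ℝ] HVec k} (hg : g ∈ SpGL k) {p : ℍ[ℝ]} (hp : p.re = 0) :
    ∃ r : ℍ[ℝ], r.re = 0 ∧ ‖r‖ = ‖p‖ ∧ ∀ q, g (leftMul k p q) = leftMul k r (g q) := by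
  obtain ⟨a, ha, A, hA⟩ := hg
  have ha0 : a ≠ 0 := by rintro rfl; simp at ha
  refine ⟨a * p * a⁻¹, ?_, ?_, fun q => ?_⟩
  · rw [Quaternion.re_mul_comm, ← mul_assoc, inv_mul_cancel₀ ha0, one_mul, hp]
  · simp [ha]
  · rw [hA, hA, vecMul_leftMul]
    ext1 i
    simp [mul_assoc, ha0]

end LeftMul

/-! ### Smooth local frames -/

section Frames

set_option synthInstance.maxHeartbeats 400000
set_option linter.unusedSectionVars false

variable {B : Type*} [NormedAddCommGroup B] [NormedSpace ℝ B] [FiniteDimensional ℝ B]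
  {H : Type*} [TopologicalSpace H] {I : ModelWithCorners ℝ B H}
  {M : Type*} [TopologicalSpace M] [ChartedSpace H M] [IsManifold I ∞ M]
  {F : Type*} [NormedAddCommGroup F] [NormedSpace ℝ F] [FiniteDimensional ℝ F]
  {E : M → Type*} [TopologicalSpace (TotalSpace F E)]
  [∀ x, AddCommGroup (E x)] [∀ x, Module ℝ (E x)] [∀ x, TopologicalSpace (E x)]
  [∀ x, IsTopologicalAddGroup (E x)] [∀ x, ContinuousSMul ℝ (E x)]
  [FiberBundle F E] [VectorBundle ℝ F E] [ContMDiffVectorBundle ∞ F E I]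

theorem map_sum_smul_repr {ι V W K : Type*} [Fintype ι] [AddCommGroup V] [Module ℝ V]
    [AddCommGroup W] [Module ℝ W] [FunLike K V W] [LinearMapClass K ℝ V W]
    (b : Module.Basis ι ℝ V) (f : K) (q : V) : f q = ∑ i, b.repr q i • f (b i) := by
  conv_lhs => rw [← b.sum_repr q]
  simp only [map_sum, map_smul]

/-- In finite dimension a family of operators is a finite combination of its values on a basis, so
smoothness can be checked vector by vector. -/
theorem contMDiffAt_clm_of_apply {G : Type*} [NormedAddCommGroup G] [NormedSpace ℝ G]
    {f : M → F →L[ℝ] G} {x : M} {n : WithTop ℕ∞}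
    (h : ∀ q, ContMDiffAt I 𝓘(ℝ, G) n (fun y => f y q) x) :
    ContMDiffAt I 𝓘(ℝ, F →L[ℝ] G) n f x := by
  set b := Module.finBasis ℝ F
  have e : f = fun y => ∑ i, ContinuousLinearMap.smulRightL ℝ F G
      (LinearMap.toContinuousLinearMap (b.coord i)) (f y (b i)) := by
    ext1 y
    apply ContinuousLinearMap.ext
    intro q
    simpa using map_sum_smul_repr b (f y) q
  rw [e]
  exact contMDiffAt_finsetSum fun i _ =>
    (ContinuousLinearMap.contMDiff _).contMDiffAt.comp x (h (b i))

variable (I) in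
/-- A smooth frame of `E`, over an open set. -/
structure IsSmoothFrame (u : ∀ x, F ≃L[ℝ] E x) (U : Set M) : Prop where
  isOpen : IsOpen U
  contMDiffOn : ∀ q : F, ContMDiffOn I (I.prod 𝓘(ℝ, F)) ∞ (fun y => TotalSpace.mk' F y (u y q)) U

/-- The frame `u`, in a trivialization. -/
def frameMatrix (e : Trivialization F (TotalSpace.proj : TotalSpace F E → M))
    [MemTrivializationAtlas e] (u : ∀ x, F ≃L[ℝ] E x) (y : M) : F →L[ℝ] F :=
  (e.continuousLinearMapAt ℝ y).comp (u y : F →L[ℝ] E y)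

theorem frameMatrix_apply (e : Trivialization F (TotalSpace.proj : TotalSpace F E → M))
    [MemTrivializationAtlas e] (u : ∀ x, F ≃L[ℝ] E x) {y : M} (hy : y ∈ e.baseSet) (q : F) :
    frameMatrix e u y q = (e ⟨y, u y q⟩).2 := by
  simp [frameMatrix, Trivialization.coe_linearMapAt_of_mem _ hy]

theorem isUnit_frameMatrix (e : Trivialization F (TotalSpace.proj : TotalSpace F E → M))
    [MemTrivializationAtlas e] (u : ∀ x, F ≃L[ℝ] E x) {y : M} (hy : y ∈ e.baseSet) :
    IsUnit (frameMatrix e u y) := by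
  refine ⟨⟨frameMatrix e u y, ((u y).symm : E y →L[ℝ] F).comp (e.symmL ℝ y), ?_, ?_⟩, rfl⟩
  · ext1 q
    simp [frameMatrix, e.continuousLinearMapAt_symmL hy]
  · ext1 q
    change (u y).symm (e.symmL ℝ y (e.continuousLinearMapAt ℝ y (u y q))) = q
    rw [e.symmL_continuousLinearMapAt hy]
    simp

/-- Expresses the inverse frame through `Ring.inverse`, whose smoothness at units is known;
smoothness of components in a frame follows from it. -/
theorem inverse_frameMatrix (e : Trivialization F (TotalSpace.proj : TotalSpace F E → M))
    [MemTrivializationAtlas e] (u : ∀ x, F ≃L[ℝ] E x) {y : M} (hy : y ∈ e.baseSet) (s : E y) :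
    Ring.inverse (frameMatrix e u y) (e ⟨y, s⟩).2 = (u y).symm s := by
  have h1 : (e ⟨y, s⟩).2 = frameMatrix e u y ((u y).symm s) := by
    rw [frameMatrix_apply _ _ hy]; simp
  rw [h1, ← mul_apply_eq_comp, Ring.inverse_mul_cancel _ (isUnit_frameMatrix e u hy)]
  rfl

namespace IsSmoothFrame

variable {u : ∀ x, F ≃L[ℝ] E x} {U : Set M} (hu : IsSmoothFrame I u U)

include hu

theorem contMDiffAt_frameMatrix (e : Trivialization F (TotalSpace.proj : TotalSpace F E → M))
    [MemTrivializationAtlas e] {x : M} (hx : x ∈ U) (hxe : x ∈ e.baseSet) :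
    ContMDiffAt I 𝓘(ℝ, F →L[ℝ] F) ∞ (frameMatrix e u) x := by
  refine contMDiffAt_clm_of_apply fun q => ?_
  have h1 := (hu.contMDiffOn q).contMDiffAt (hu.isOpen.mem_nhds hx)
  have h2 := (e.contMDiffAt_section_iff hxe).1 h1
  refine h2.congr_of_eventuallyEq ?_
  filter_upwards [e.open_baseSet.mem_nhds hxe] with y hy using frameMatrix_apply _ _ hy _

theorem contMDiffAt_inverse_frameMatrix
    (e : Trivialization F (TotalSpace.proj : TotalSpace F E → M))
    [MemTrivializationAtlas e] {x : M} (hx : x ∈ U) (hxe : x ∈ e.baseSet) :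
    ContMDiffAt I 𝓘(ℝ, F →L[ℝ] F) ∞ (fun y => Ring.inverse (frameMatrix e u y)) x := by
  have : CompleteSpace F := FiniteDimensional.complete ℝ F
  obtain ⟨g, hg⟩ := isUnit_frameMatrix e u hxe
  have h1 : ContMDiffAt 𝓘(ℝ, F →L[ℝ] F) 𝓘(ℝ, F →L[ℝ] F) ∞ Ring.inverse (frameMatrix e u x) := by
    rw [← hg]
    exact (contDiffAt_ringInverse ℝ g).contMDiffAt
  exact h1.comp x (hu.contMDiffAt_frameMatrix e hx hxe)

/-- The components of a smooth section in a smooth frame are smooth. -/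
theorem contMDiffAt_coeff {s : ∀ x, E x} {x : M} (hx : x ∈ U)
    (hs : ContMDiffAt I (I.prod 𝓘(ℝ, F)) ∞ (fun y => TotalSpace.mk' F y (s y)) x) :
    ContMDiffAt I 𝓘(ℝ, F) ∞ (fun y => (u y).symm (s y)) x := by
  set e := trivializationAt F E x
  have hxe : x ∈ e.baseSet := FiberBundle.mem_baseSet_trivializationAt' x
  have h1 := (hu.contMDiffAt_inverse_frameMatrix e hx hxe).clm_apply
    ((e.contMDiffAt_section_iff hxe).1 hs)
  refine h1.congr_of_eventuallyEq ?_
  filter_upwards [e.open_baseSet.mem_nhds hxe] with y hy using (inverse_frameMatrix e u hy _).symm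

end IsSmoothFrame

/-- The connection form of `∇` with respect to the frame `u`. -/
def frameForm (cov : CovariantDerivative I F E) (u : ∀ x, F ≃L[ℝ] E x) (x : M) :
    TangentSpace I x →L[ℝ] F →L[ℝ] F :=
  ∑ i, (ContinuousLinearMap.smulRightL ℝ F F
    (LinearMap.toContinuousLinearMap ((Module.finBasis ℝ F).coord i))).comp
      (((u x).symm : E x →L[ℝ] F).comp (cov (fun y => u y (Module.finBasis ℝ F i)) x))

theorem cov_sum (cov : CovariantDerivative I F E) {ι : Type*} (t : Finset ι)
    {s : ι → ∀ x, E x} {x : M} (hs : ∀ i ∈ t, MDiffAt (T% (s i)) x) :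
    cov (fun y => ∑ i ∈ t, s i y) x = ∑ i ∈ t, cov (s i) x := by
  classical
  induction t using Finset.induction_on with
  | empty =>
    simp only [Finset.sum_empty]
    exact congrFun cov.zero x
  | insert i t hi ih =>
    simp only [Finset.sum_insert hi]
    rw [← ih fun j hj => hs j (Finset.mem_insert_of_mem hj)]
    exact cov.isCovariantDerivativeOnUniv.add (hs i (Finset.mem_insert_self _ _))
      (MDifferentiableAt.sum_section fun j hj => hs j (Finset.mem_insert_of_mem hj))

namespace IsSmoothFrame

variable {u : ∀ x, F ≃L[ℝ] E x} {U : Set M} (hu : IsSmoothFrame I u U)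

include hu

/-- The covariant derivative of a section, in terms of its components in a smooth frame. -/
theorem cov_eq (cov : CovariantDerivative I F E) {s : ∀ x, E x} {x : M} (hx : x ∈ U)
    (hs : ContMDiffAt I (I.prod 𝓘(ℝ, F)) ∞ (fun y => TotalSpace.mk' F y (s y)) x)
    (v : TangentSpace I x) :
    cov s x v = u x (mvfderiv I (fun y => (u y).symm (s y)) x v +
      frameForm cov u x v ((u x).symm (s x))) := by
  set b := Module.finBasis ℝ F with hb
  have hf := hu.contMDiffAt_coeff hx hs
  set f : M → F := fun y => (u y).symm (s y) with hf_def
  have hc : ∀ i, ContMDiffAt I 𝓘(ℝ, ℝ) ∞ (fun y => b.coord i (f y)) x := fun i =>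
    (LinearMap.toContinuousLinearMap (b.coord i)).contMDiff.contMDiffAt.comp x hf
  have hσ : ∀ i, MDiffAt (T% (fun y => u y (b i))) x := fun i =>
    ((hu.contMDiffOn (b i)).contMDiffAt (hu.isOpen.mem_nhds hx)).mdifferentiableAt (by simp)
  -- Expand `s` in the frame sections `u (b i)`. The Leibniz rule then gives the derivative of the
  -- coefficients plus the connection form, which is defined on the same basis.
  have e : s = fun y => ∑ i, ((fun y => b.coord i (f y)) • fun y => u y (b i)) y := by
    ext1 y
    have : u y (f y) = s y := by simp [hf_def]
    rw [← this, map_sum_smul_repr b (u y)]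
    rfl
  have hd : ∀ i, mvfderiv I (fun y => b.coord i (f y)) x v = b.coord i (mvfderiv I f x v) := by
    intro i
    have h1 := (LinearMap.toContinuousLinearMap (b.coord i)).contMDiff (n := 1)
    have h2 := mfderiv_comp_apply (f := f) (g := LinearMap.toContinuousLinearMap (b.coord i)) x
      (h1.contMDiffAt.mdifferentiableAt (by simp)) (hf.mdifferentiableAt (by simp)) v
    rw [ContinuousLinearMap.mfderiv_eq] at h2
    exact h2
  have h1 : cov s x = ∑ i, cov ((fun y => b.coord i (f y)) • fun y => u y (b i)) x := by
    conv_lhs => rw [e]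
    exact cov_sum cov Finset.univ fun i _ =>
      ((hc i).mdifferentiableAt (by simp)).smul_section (hσ i)
  rw [h1]
  have h2 : ∀ i, cov ((fun y => b.coord i (f y)) • fun y => u y (b i)) x v =
      b.coord i (f x) • cov (fun y => u y (b i)) x v + b.coord i (mvfderiv I f x v) • u x (b i) := by
    intro i
    rw [cov.isCovariantDerivativeOnUniv.leibniz (hσ i) ((hc i).mdifferentiableAt (by simp)), ← hd]
    simp
  rw [_root_.sum_apply]
  simp only [h2, Finset.sum_add_distrib]
  have h3 : ∑ i, b.coord i (mvfderiv I f x v) • u x (b i) = u x (mvfderiv I f x v) := by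
    rw [map_sum_smul_repr b (u x)]
    rfl
  rw [h3, map_add, add_comm]
  congr 1
  simp [frameForm, _root_.sum_apply, ← hb]
  rfl

theorem frameForm_apply (cov : CovariantDerivative I F E) {x : M} (hx : x ∈ U)
    (v : TangentSpace I x) (q : F) :
    frameForm cov u x v q = (u x).symm (cov (fun y => u y q) x v) := by
  rw [hu.cov_eq cov hx ((hu.contMDiffOn q).contMDiffAt (hu.isOpen.mem_nhds hx))]
  have : (fun y => (u y).symm (u y q)) = fun _ => q := by ext1 y; simp
  rw [this]
  simp [mvfderiv]

end IsSmoothFrame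

end Frames

/-! ### Vector fields in flat coordinates -/

section FlatChart

set_option linter.unusedSectionVars false

variable {B : Type*} [NormedAddCommGroup B] [NormedSpace ℝ B] [CompleteSpace B]
  {H : Type*} [TopologicalSpace H] {I : ModelWithCorners ℝ B H}
  {N : Type*} [TopologicalSpace N] [ChartedSpace H N] [IsManifold I ∞ N]
  {V : Type*} [NormedAddCommGroup V] [NormedSpace ℝ V] [CompleteSpace V]
  {G : Type*} [NormedAddCommGroup G] [NormedSpace ℝ G]

theorem mlieBracket_vectorSpace (X Y : ∀ z : V, TangentSpace 𝓘(ℝ, V) z) (z : V) :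
    VectorField.mlieBracket 𝓘(ℝ, V) X Y z = VectorField.lieBracket ℝ X Y z := by
  rw [← VectorField.mlieBracketWithin_univ, VectorField.mlieBracketWithin_eq_lieBracketWithin]
  exact congrFun (VectorField.lieBracketWithin_univ (𝕜 := ℝ) (E := V) (V := X) (W := Y)) z

variable (I) in
/-- `ψ` and `φ` are inverse diffeomorphisms between an open subset `O` of the manifold `N` and
an open subset `W` of a normed space. -/
structure IsFlatChart (ψ : N → V) (φ : V → N) (O : Set N) (W : Set V) : Prop where
  isOpen_source : IsOpen O
  isOpen_target : IsOpen W
  contMDiffOn : ContMDiffOn I 𝓘(ℝ, V) ∞ ψ O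
  contMDiffOn_symm : ContMDiffOn 𝓘(ℝ, V) I ∞ φ W
  map_source : ∀ p ∈ O, ψ p ∈ W
  map_target : ∀ z ∈ W, φ z ∈ O
  left_inv : ∀ p ∈ O, φ (ψ p) = p
  right_inv : ∀ z ∈ W, ψ (φ z) = z

variable (I) in
/-- The differential of a map to a normed space. -/
def flatDeriv (ψ : N → V) (p : N) : TangentSpace I p →L[ℝ] V :=
  mfderiv I 𝓘(ℝ, V) ψ p

variable (I) in
/-- The expression of a vector field in flat coordinates. -/
def flatField (ψ : N → V) (φ : V → N) (X : ∀ p : N, TangentSpace I p) (z : V) : V :=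
  flatDeriv I ψ (φ z) (X (φ z))

variable (I) in
/-- The vector field with a given expression in flat coordinates. -/
def unflatField (ψ : N → V) (X : V → V) (p : N) : TangentSpace I p :=
  (mfderiv I 𝓘(ℝ, V) ψ p).inverse (X (ψ p))

namespace IsFlatChart

variable {ψ : N → V} {φ : V → N} {O : Set N} {W : Set V} (h : IsFlatChart I ψ φ O W)

include h

theorem contMDiffAt {p : N} (hp : p ∈ O) : ContMDiffAt I 𝓘(ℝ, V) ∞ ψ p :=
  h.contMDiffOn.contMDiffAt (h.isOpen_source.mem_nhds hp)

theorem contMDiffAt_symm {z : V} (hz : z ∈ W) : ContMDiffAt 𝓘(ℝ, V) I ∞ φ z :=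
  h.contMDiffOn_symm.contMDiffAt (h.isOpen_target.mem_nhds hz)

theorem mfderiv_comp_symm {z : V} (hz : z ∈ W) :
    (mfderiv I 𝓘(ℝ, V) ψ (φ z)).comp (mfderiv 𝓘(ℝ, V) I φ z) = ContinuousLinearMap.id ℝ _ := by
  have h1 := mfderiv_comp z ((h.contMDiffAt (h.map_target z hz)).mdifferentiableAt (by simp))
    ((h.contMDiffAt_symm hz).mdifferentiableAt (by simp))
  rw [← h1, ← mfderiv_id (I := 𝓘(ℝ, V)) (x := z)]
  apply Filter.EventuallyEq.mfderiv_eq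
  filter_upwards [h.isOpen_target.mem_nhds hz] with y hy using h.right_inv y hy

theorem mfderiv_symm_comp {p : N} (hp : p ∈ O) :
    (mfderiv 𝓘(ℝ, V) I φ (ψ p)).comp (mfderiv I 𝓘(ℝ, V) ψ p) = ContinuousLinearMap.id ℝ _ := by
  have h1 := mfderiv_comp p ((h.contMDiffAt_symm (h.map_source p hp)).mdifferentiableAt (by simp))
    ((h.contMDiffAt hp).mdifferentiableAt (by simp))
  rw [← h1, ← mfderiv_id (I := I) (x := p)]
  apply Filter.EventuallyEq.mfderiv_eq
  filter_upwards [h.isOpen_source.mem_nhds hp] with y hy using h.left_inv y hy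

theorem isInvertible_mfderiv {p : N} (hp : p ∈ O) : (mfderiv I 𝓘(ℝ, V) ψ p).IsInvertible := by
  have h1 := h.mfderiv_symm_comp hp
  have h2 := h.mfderiv_comp_symm (h.map_source p hp)
  have e := h.left_inv p hp
  -- Writing `p` as `φ z` identifies the tangent spaces at `p` and at `φ (ψ p)`, which are equal
  -- only through `left_inv`.
  generalize hz : ψ p = z at *
  subst e
  exact ContinuousLinearMap.IsInvertible.of_inverse h2 h1

theorem isInvertible_mfderiv_symm {z : V} (hz : z ∈ W) :
    (mfderiv 𝓘(ℝ, V) I φ z).IsInvertible := by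
  have h1 := h.mfderiv_symm_comp (h.map_target z hz)
  have h2 := h.mfderiv_comp_symm hz
  rw [h.right_inv z hz] at h1
  exact ContinuousLinearMap.IsInvertible.of_inverse h1 h2

theorem inverse_mfderiv_symm {z : V} (hz : z ∈ W) :
    (mfderiv 𝓘(ℝ, V) I φ z).inverse = mfderiv I 𝓘(ℝ, V) ψ (φ z) := by
  have h1 := h.mfderiv_symm_comp (h.map_target z hz)
  have h2 := h.mfderiv_comp_symm hz
  rw [h.right_inv z hz] at h1
  exact ContinuousLinearMap.inverse_eq h1 h2

theorem flatDeriv_injective {p : N} (hp : p ∈ O) : Function.Injective (flatDeriv I ψ p) :=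
  (h.isInvertible_mfderiv hp).injective

theorem flatDeriv_unflatField {p : N} (hp : p ∈ O) (X : V → V) :
    flatDeriv I ψ p (unflatField I ψ X p) = X (ψ p) :=
  (h.isInvertible_mfderiv hp).self_apply_inverse _

theorem flatField_unflatField {z : V} (hz : z ∈ W) (X : V → V) :
    flatField I ψ φ (unflatField I ψ X) z = X z := by
  rw [flatField, h.flatDeriv_unflatField (h.map_target z hz), h.right_inv z hz]

theorem flatField_apply {p : N} (hp : p ∈ O) (X : ∀ p : N, TangentSpace I p) :
    flatField I ψ φ X (ψ p) = flatDeriv I ψ p (X p) := by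
  rw [flatField, h.left_inv p hp]

theorem mpullback_eventuallyEq {z : V} (hz : z ∈ W) (X : ∀ p : N, TangentSpace I p) :
    VectorField.mpullback 𝓘(ℝ, V) I φ X =ᶠ[𝓝 z] flatField I ψ φ X := by
  filter_upwards [h.isOpen_target.mem_nhds hz] with y hy
  rw [VectorField.mpullback_apply, h.inverse_mfderiv_symm hy]
  rfl

theorem contDiffAt_flatField {z : V} (hz : z ∈ W) {X : ∀ p : N, TangentSpace I p}
    (hX : ContMDiffAt I I.tangent ∞ (fun p => (⟨p, X p⟩ : TangentBundle I N)) (φ z)) :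
    ContDiffAt ℝ ∞ (flatField I ψ φ X) z := by
  have : IsManifold I 1 N := .of_le (n := ∞) (by simp)
  have h1 := ContMDiffAt.mpullback_vectorField_preimage hX (h.contMDiffAt_symm hz)
    (h.isInvertible_mfderiv_symm hz) (by simp)
  have h2 := (contMDiff_snd_tangentBundle_modelSpace V 𝓘(ℝ, V)).contMDiffAt.comp z h1
  exact contMDiffAt_iff_contDiffAt.1 (h2.congr_of_eventuallyEq (h.mpullback_eventuallyEq hz X).symm)

theorem contMDiffAt_unflatField {p : N} (hp : p ∈ O) {X : V → V}
    (hX : ContDiffAt ℝ ∞ X (ψ p)) :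
    ContMDiffAt I I.tangent ∞ (fun p => (⟨p, unflatField I ψ X p⟩ : TangentBundle I N)) p := by
  have : IsManifold I 1 N := .of_le (n := ∞) (by simp)
  have h0 : ContMDiffAt 𝓘(ℝ, V) 𝓘(ℝ, V).tangent ∞
      (fun z => (⟨z, X z⟩ : TangentBundle 𝓘(ℝ, V) V)) (ψ p) :=
    contMDiffAt_vectorSpace_iff_contDiffAt.2 hX
  exact ContMDiffAt.mpullback_vectorField_preimage h0 (h.contMDiffAt hp)
    (h.isInvertible_mfderiv hp) (by simp)

/-- Naturality of the bracket under pull-back by the parametrization `φ`, whose differential has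
inverse the differential of `ψ`. -/
theorem flatDeriv_mlieBracket {p : N} (hp : p ∈ O) {X Y : ∀ p : N, TangentSpace I p}
    (hX : MDiffAt (T% X) p) (hY : MDiffAt (T% Y) p) :
    flatDeriv I ψ p (VectorField.mlieBracket I X Y p) =
      VectorField.lieBracket ℝ (flatField I ψ φ X) (flatField I ψ φ Y) (ψ p) := by
  have i1 : IsManifold I (minSmoothness ℝ 3) N := .of_le (n := ∞) (by simp; exact ENat.LEInfty.out)
  have hz := h.map_source p hp
  have e := h.left_inv p hp
  generalize ψ p = z at *
  subst e
  have h1 := VectorField.mpullback_mlieBracket hX hY ((h.contMDiffAt_symm hz))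
    (by simp; exact ENat.LEInfty.out)
  rw [VectorField.mpullback_apply, h.inverse_mfderiv_symm hz] at h1
  refine h1.trans ?_
  rw [Filter.EventuallyEq.mlieBracket_vectorField_eq (h.mpullback_eventuallyEq hz X)
    (h.mpullback_eventuallyEq hz Y)]
  exact mlieBracket_vectorSpace _ _ z

theorem mvfderiv_eq {p : N} (hp : p ∈ O) {f : N → G}
    (hf : MDiffAt f p) (v : TangentSpace I p) :
    mvfderiv I f p v = fderiv ℝ (fun z => f (φ z)) (ψ p) (flatDeriv I ψ p v) := by
  have h1 : MDiffAt (fun z => f (φ z)) (ψ p) :=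
    MDifferentiableAt.comp (I' := I) (g := f) (ψ p) (by rwa [h.left_inv p hp])
      ((h.contMDiffAt_symm (h.map_source p hp)).mdifferentiableAt (by simp))
  have h2 := mfderiv_comp_apply (g := fun z => f (φ z)) p h1
    ((h.contMDiffAt hp).mdifferentiableAt (by simp)) v
  have h3 : mfderiv I 𝓘(ℝ, G) ((fun z => f (φ z)) ∘ ψ) p = mfderiv I 𝓘(ℝ, G) f p := by
    apply Filter.EventuallyEq.mfderiv_eq
    filter_upwards [h.isOpen_source.mem_nhds hp] with y hy
    simp [h.left_inv y hy]
  rw [h3, mfderiv_eq_fderiv] at h2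
  exact h2

theorem contDiffAt_comp_symm {z : V} (hz : z ∈ W) {f : N → G}
    (hf : ContMDiffAt I 𝓘(ℝ, G) ∞ f (φ z)) : ContDiffAt ℝ ∞ (fun z => f (φ z)) z :=
  contMDiffAt_iff_contDiffAt.1 (hf.comp z (h.contMDiffAt_symm hz))

end IsFlatChart

variable [I.Boundaryless]

/-- The absence of boundary is what makes the target of the extended chart open in the model vector
space. -/
theorem isFlatChart_extChartAt (x : N) {U : Set N} (hU : IsOpen U) :
    IsFlatChart I (extChartAt I x) (extChartAt I x).symm (U ∩ (extChartAt I x).source)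
      ((extChartAt I x).target ∩ (extChartAt I x).symm ⁻¹' U) where
  isOpen_source := hU.inter (isOpen_extChartAt_source x)
  isOpen_target := (continuousOn_extChartAt_symm x).isOpen_inter_preimage
    (isOpen_extChartAt_target x) hU
  contMDiffOn := (contMDiffOn_extChartAt (n := ∞)).mono (by
    rw [extChartAt_source]; exact Set.inter_subset_right)
  contMDiffOn_symm := (contMDiffOn_extChartAt_symm x).mono Set.inter_subset_left
  map_source p hp := ⟨(extChartAt I x).map_source hp.2, by
    rw [Set.mem_preimage, (extChartAt I x).left_inv hp.2]; exact hp.1⟩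
  map_target z hz := ⟨hz.2, (extChartAt I x).map_target hz.1⟩
  left_inv p hp := (extChartAt I x).left_inv hp.2
  right_inv z hz := (extChartAt I x).right_inv hz.1

end FlatChart

/-! ### Connections and anchors in flat coordinates -/

section FlatConnection

set_option synthInstance.maxHeartbeats 400000
set_option linter.unusedSectionVars false

variable {B : Type*} [NormedAddCommGroup B] [NormedSpace ℝ B] [FiniteDimensional ℝ B]
  {H : Type*} [TopologicalSpace H] {I : ModelWithCorners ℝ B H}
  {M : Type*} [TopologicalSpace M] [ChartedSpace H M] [IsManifold I ∞ M]
  {F : Type*} [NormedAddCommGroup F] [NormedSpace ℝ F] [FiniteDimensional ℝ F]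
  {E : M → Type*} [TopologicalSpace (TotalSpace F E)]
  [∀ x, AddCommGroup (E x)] [∀ x, Module ℝ (E x)] [∀ x, TopologicalSpace (E x)]
  [∀ x, IsTopologicalAddGroup (E x)] [∀ x, ContinuousSMul ℝ (E x)]
  [FiberBundle F E] [VectorBundle ℝ F E] [ContMDiffVectorBundle ∞ F E I]
  {V : Type*} [NormedAddCommGroup V] [NormedSpace ℝ V] [FiniteDimensional ℝ V]

/-- The connection form of `∇`, with respect to the frame `u`, in flat coordinates. -/
def flatForm (cov : CovariantDerivative I F E) (u : ∀ x, F ≃L[ℝ] E x) (ψ : M → V) (φ : V → M)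
    (y : V) : V →L[ℝ] F →L[ℝ] F :=
  (frameForm cov u (φ y)).comp (flatDeriv I ψ (φ y)).inverse

/-- The anchor, with respect to the frame `u`, in flat coordinates. -/
def flatAnchor (ρ : ∀ x : M, E x →L[ℝ] TangentSpace I x) (u : ∀ x, F ≃L[ℝ] E x) (ψ : M → V)
    (φ : V → M) (y : V) : F →L[ℝ] V :=
  (flatDeriv I ψ (φ y)).comp ((ρ (φ y)).comp (u (φ y) : F →L[ℝ] E (φ y)))

variable {u : ∀ x, F ≃L[ℝ] E x} {U : Set M} (hu : IsSmoothFrame I u U)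
  {ψ : M → V} {φ : V → M} {O : Set M} {W : Set V} (h : IsFlatChart I ψ φ O W) (hO : O ⊆ U)
  {cov : CovariantDerivative I F E} {ρ : ∀ x : M, E x →L[ℝ] TangentSpace I x}

include h

theorem flatForm_flatDeriv {p : M} (hp : p ∈ O) (v : TangentSpace I p) :
    flatForm cov u ψ φ (ψ p) (flatDeriv I ψ p v) = frameForm cov u p v := by
  have : CompleteSpace B := FiniteDimensional.complete ℝ B
  have : CompleteSpace V := FiniteDimensional.complete ℝ V
  rw [flatForm, h.left_inv p hp]
  simp only [ContinuousLinearMap.comp_apply]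
  congr 1
  exact (h.isInvertible_mfderiv hp).inverse_apply_self _

omit [FiniteDimensional ℝ V] in
theorem flatAnchor_apply {p : M} (hp : p ∈ O) (q : F) :
    flatAnchor ρ u ψ φ (ψ p) q = flatDeriv I ψ p (ρ p (u p q)) := by
  rw [flatAnchor, h.left_inv p hp]
  rfl

include hu hO

/-- On constants `v` and `q`, the form is the component vector in the frame of `∇_X (u q)`, with `X`
the coordinate field of `v`; this is smooth because `∇` is. -/
theorem contDiffAt_flatForm (hcov : IsSmoothConnection cov) {y : V} (hy : y ∈ W) :
    ContDiffAt ℝ ∞ (flatForm cov u ψ φ) y := by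
  have : CompleteSpace B := FiniteDimensional.complete ℝ B
  have : CompleteSpace V := FiniteDimensional.complete ℝ V
  rw [← contMDiffAt_iff_contDiffAt]
  refine contMDiffAt_clm_of_apply fun v => contMDiffAt_clm_of_apply fun q => ?_
  rw [contMDiffAt_iff_contDiffAt]
  have hp := h.map_target y hy
  have h1 : ContMDiffAt I I.tangent ∞
      (fun p => (⟨p, unflatField I ψ (fun _ => v) p⟩ : TangentBundle I M)) (φ y) :=
    h.contMDiffAt_unflatField hp contDiffAt_const
  have h2 := ((hcov U hu.isOpen).contMDiff (σ := fun y => u y q)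
    (by simpa using hu.contMDiffOn q)).contMDiffAt (hu.isOpen.mem_nhds (hO hp))
  have h3 := ContMDiffAt.clm_bundle_apply (b := id) h2 h1
  have h4 := h.contDiffAt_comp_symm hy (hu.contMDiffAt_coeff (hO hp) h3)
  refine h4.congr_of_eventuallyEq ?_
  filter_upwards [h.isOpen_target.mem_nhds hy] with z hz
  rw [← hu.frameForm_apply cov (hO (h.map_target z hz))]
  simp only [flatForm, ContinuousLinearMap.comp_apply, unflatField]
  rfl

theorem contMDiffAt_anchor_frame (hρ : IsSmoothAnchor (F := F) ρ) {p : M} (hp : p ∈ O) (q : F) :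
    ContMDiffAt I I.tangent ∞ (fun p => (⟨p, ρ p (u p q)⟩ : TangentBundle I M)) p :=
  ContMDiffAt.clm_bundle_apply (b := id) (hρ p)
    ((hu.contMDiffOn q).contMDiffAt (hu.isOpen.mem_nhds (hO hp)))

theorem contDiffAt_flatAnchor (hρ : IsSmoothAnchor (F := F) ρ) {y : V} (hy : y ∈ W) :
    ContDiffAt ℝ ∞ (flatAnchor ρ u ψ φ) y := by
  have : CompleteSpace B := FiniteDimensional.complete ℝ B
  have : CompleteSpace V := FiniteDimensional.complete ℝ V
  rw [← contMDiffAt_iff_contDiffAt]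
  refine contMDiffAt_clm_of_apply fun q => ?_
  rw [contMDiffAt_iff_contDiffAt]
  exact h.contDiffAt_flatField hy
    (contMDiffAt_anchor_frame hu h hO hρ (h.map_target y hy) q)

/-- By tensoriality the torsion may be computed on the frame sections `u q` and `u r`, whose
components are constant, so their covariant derivatives reduce to the connection form. -/
theorem flatDeriv_anchoredTorsion (hρ : IsSmoothAnchor (F := F) ρ) {p : M} (hp : p ∈ O)
    (q r : F) :
    flatDeriv I ψ p (anchoredTorsion cov ρ hρ p (u p q) (u p r)) =
      formTorsion (flatForm cov u ψ φ) (flatAnchor ρ u ψ φ) (ψ p) q r := by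
  have : CompleteSpace B := FiniteDimensional.complete ℝ B
  have : CompleteSpace V := FiniteDimensional.complete ℝ V
  have hs : ∀ q, MDiffAt (T% (fun y => u y q)) p := fun q =>
    ((hu.contMDiffOn q).contMDiffAt (hu.isOpen.mem_nhds (hO hp))).mdifferentiableAt (by simp)
  have hd : DifferentiableAt ℝ (flatAnchor ρ u ψ φ) (ψ p) :=
    (contDiffAt_flatAnchor hu h hO hρ (h.map_source p hp)).differentiableAt (by simp)
  have hc : ∀ q r, cov (fun y => u y r) p (ρ p (u p q)) =
      u p (flatForm cov u ψ φ (ψ p) (flatAnchor ρ u ψ φ (ψ p) q) r) := by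
    intro q r
    rw [flatAnchor_apply h hp, flatForm_flatDeriv h hp, hu.frameForm_apply cov (hO hp)]
    simp
  have hf : ∀ q, flatField I ψ φ (fun y => ρ y (u y q)) = fun y => flatAnchor ρ u ψ φ y q :=
    fun q => rfl
  have hfd : ∀ q w, fderiv ℝ (fun y => flatAnchor ρ u ψ φ y q) (ψ p) w =
      fderiv ℝ (flatAnchor ρ u ψ φ) (ψ p) w q := by
    intro q w
    rw [fderiv_clm_apply hd (differentiableAt_const _)]
    simp
  have e := anchoredTorsion_apply cov ρ hρ p (hs q) (hs r)
  rw [e, torsionOn, map_sub, h.flatDeriv_mlieBracket hp (hρ.mdiffAt (hs q)) (hρ.mdiffAt (hs r)),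
    hc, hc, ← map_sub, ← flatAnchor_apply h hp, hf, hf, VectorField.lieBracket, hfd, hfd]
  rfl

/-- By tensoriality the two tangent vectors may be extended by coordinate fields, whose bracket
vanishes. The section stays the one from the definition of `curvatureForm`; its components `g` in
the frame are not constant, and their derivatives cancel on antisymmetrising, the second-order ones
by symmetry of the Hessian. -/
theorem curvatureForm_frame (hcov : IsSmoothConnection cov) {p : M} (hp : p ∈ O)
    (v w : TangentSpace I p) (q : F) :
    curvatureForm cov hcov p v w (u p q) =
      u p (formCurvature (flatForm cov u ψ φ) (ψ p) (flatDeriv I ψ p v) (flatDeriv I ψ p w) q) := by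
  have : CompleteSpace B := FiniteDimensional.complete ℝ B
  have : CompleteSpace V := FiniteDimensional.complete ℝ V
  set s := linExtend F (u p q) with hs_def
  obtain ⟨U', hU', hpU', hs, -⟩ := exists_contMDiffOn_linExtend (I := I) (F := F) p (u p q) (u p q)
  have hsp : s p = u p q := linExtend_self _
  let X : TangentSpace I p → ∀ y : M, TangentSpace I y :=
    fun v => unflatField I ψ (fun _ => flatDeriv I ψ p v)
  have hX : ∀ v, ∀ y ∈ O, ContMDiffAt I I.tangent ∞
      (fun p => (⟨p, X v p⟩ : TangentBundle I M)) y :=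
    fun v y hy => h.contMDiffAt_unflatField hy contDiffAt_const
  have hXD : ∀ v, ∀ y ∈ O, flatDeriv I ψ y (X v y) = flatDeriv I ψ p v :=
    fun v y hy => h.flatDeriv_unflatField hy _
  have hXp : ∀ v, X v p = v := fun v => h.flatDeriv_injective hp (hXD v p hp)
  have hXd : ∀ v, MDiffAt (T% (X v)) p := fun v => (hX v p hp).mdifferentiableAt (by simp)
  -- The two slots are changed one at a time, since tensoriality in one slot is available with the
  -- other field fixed.
  have e1 : curvatureForm cov hcov p v w (u p q) = curvatureOn cov (X v) (X w) s p := by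
    have a1 := (curvatureOn_tensorial₁ hcov hU' hpU' hs (linExtend B w)
      (mdifferentiableAt_linExtend I _)).pointwise (mdifferentiableAt_linExtend I v) (hXd v)
      (by rw [hXp, linExtend_self])
    have a2 := (curvatureOn_tensorial₂ hcov hU' hpU' hs (X v) (hXd v)).pointwise
      (mdifferentiableAt_linExtend I w) (hXd w) (by rw [hXp, linExtend_self])
    exact a1.trans a2
  have hbr : VectorField.mlieBracket I (X v) (X w) p = 0 := by
    apply h.flatDeriv_injective hp
    rw [h.flatDeriv_mlieBracket hp (hXd v) (hXd w), map_zero]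
    have hc : ∀ v, flatField I ψ φ (X v) =ᶠ[𝓝 (ψ p)] fun _ => flatDeriv I ψ p v := by
      intro v
      filter_upwards [h.isOpen_target.mem_nhds (h.map_source p hp)] with y hy
      exact h.flatField_unflatField hy _
    rw [(hc v).lieBracket_vectorField_eq (hc w)]
    simp [VectorField.lieBracket]
  set Γ := flatForm cov u ψ φ with hΓ
  have hΓd : DifferentiableAt ℝ Γ (ψ p) :=
    (contDiffAt_flatForm hu h hO hcov (h.map_source p hp)).differentiableAt (by simp)
  set f : M → F := fun y => (u y).symm (s y) with hf_def
  have hf : ∀ y ∈ O ∩ U', ContMDiffAt I 𝓘(ℝ, F) ∞ f y := fun y hy =>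
    hu.contMDiffAt_coeff (hO hy.1) (hs.contMDiffAt (hU'.mem_nhds hy.2))
  set g : V → F := fun z => f (φ z) with hg_def
  have hg : ContDiffAt ℝ ∞ g (ψ p) := h.contDiffAt_comp_symm (h.map_source p hp)
    (by rw [h.left_inv p hp]; exact hf p ⟨hp, hpU'⟩)
  have hgf : ∀ y ∈ O, g (ψ y) = f y := fun y hy => congrArg f (h.left_inv y hy)
  have hgp : g (ψ p) = q := by rw [hgf p hp, hf_def]; simp only [hsp]; simp
  have hcoef : ∀ w, ∀ y ∈ O ∩ U', (u y).symm (cov s y (X w y)) =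
      fderiv ℝ g (ψ y) (flatDeriv I ψ p w) + Γ (ψ y) (flatDeriv I ψ p w) (g (ψ y)) := by
    intro w y hy
    rw [hu.cov_eq cov (hO hy.1) (hs.contMDiffAt (hU'.mem_nhds hy.2)),
      h.mvfderiv_eq hy.1 ((hf y hy).mdifferentiableAt (by simp)), ← flatForm_flatDeriv h hy.1,
      hXD w y hy.1, hgf y hy.1, (u y).symm_apply_apply]
  have hcs : ∀ w, ContMDiffAt I (I.prod 𝓘(ℝ, F)) ∞
      (fun y => TotalSpace.mk' F y (cov s y (X w y))) p := fun w =>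
    ContMDiffAt.clm_bundle_apply (b := id)
      (((hcov U' hU').contMDiff (σ := s) (by simpa using hs)).contMDiffAt (hU'.mem_nhds hpU'))
      (hX w p hp)
  have hd2 : DifferentiableAt ℝ (fderiv ℝ g) (ψ p) :=
    (hg.fderiv_right (m := ∞) (by simp)).differentiableAt (by simp)
  have hgd : DifferentiableAt ℝ g (ψ p) := hg.differentiableAt (by simp)
  have hcc : ∀ v w, cov (fun y => cov s y (X w y)) p (X v p) =
      u p (fderiv ℝ (fderiv ℝ g) (ψ p) (flatDeriv I ψ p v) (flatDeriv I ψ p w) +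
        fderiv ℝ Γ (ψ p) (flatDeriv I ψ p v) (flatDeriv I ψ p w) q +
        Γ (ψ p) (flatDeriv I ψ p w) (fderiv ℝ g (ψ p) (flatDeriv I ψ p v)) +
        Γ (ψ p) (flatDeriv I ψ p v) (fderiv ℝ g (ψ p) (flatDeriv I ψ p w)) +
        Γ (ψ p) (flatDeriv I ψ p v) (Γ (ψ p) (flatDeriv I ψ p w) q)) := by
    intro v w
    rw [hu.cov_eq cov (hO hp) (hcs w), ← flatForm_flatDeriv h hp,
      h.mvfderiv_eq hp ((hu.contMDiffAt_coeff (hO hp) (hcs w)).mdifferentiableAt (by simp)),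
      hXD v p hp, hcoef w p ⟨hp, hpU'⟩]
    have hev : (fun z => (u (φ z)).symm (cov s (φ z) (X w (φ z)))) =ᶠ[𝓝 (ψ p)] fun z =>
        fderiv ℝ g z (flatDeriv I ψ p w) + Γ z (flatDeriv I ψ p w) (g z) := by
      have hU2 : ∀ᶠ z in 𝓝 (ψ p), φ z ∈ U' :=
        (h.contMDiffAt_symm (h.map_source p hp)).continuousAt.preimage_mem_nhds
          (by rw [h.left_inv p hp]; exact hU'.mem_nhds hpU')
      filter_upwards [h.isOpen_target.mem_nhds (h.map_source p hp), hU2] with z hz hz'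
      have := hcoef w (φ z) ⟨h.map_target z hz, hz'⟩
      rwa [h.right_inv z hz] at this
    have hder : HasFDerivAt (fun z =>
        fderiv ℝ g z (flatDeriv I ψ p w) + Γ z (flatDeriv I ψ p w) (g z)) _ (ψ p) :=
      (hd2.hasFDerivAt.clm_apply (hasFDerivAt_const _ _)).add
        ((hΓd.hasFDerivAt.clm_apply (hasFDerivAt_const _ _)).clm_apply hgd.hasFDerivAt)
    rw [hev.fderiv_eq, hder.fderiv, hgp]
    simp
    abel
  have hsym : fderiv ℝ (fderiv ℝ g) (ψ p) (flatDeriv I ψ p v) (flatDeriv I ψ p w) =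
      fderiv ℝ (fderiv ℝ g) (ψ p) (flatDeriv I ψ p w) (flatDeriv I ψ p v) :=
    (hg.isSymmSndFDerivAt (by simp; exact ENat.LEInfty.out)).eq _ _
  rw [e1, curvatureOn, hbr, map_zero, sub_zero, hcc v w, hcc w v, ← map_sub, hsym]
  congr 1
  simp only [formCurvature, add_apply, sub_apply, mul_apply_eq_comp]
  abel

end FlatConnection

/-! ### The bundle of endomorphisms in flat coordinates -/

section FlatEnd

set_option synthInstance.maxHeartbeats 400000
set_option linter.unusedSectionVars false

variable {B : Type*} [NormedAddCommGroup B] [NormedSpace ℝ B] [FiniteDimensional ℝ B]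
  {H : Type*} [TopologicalSpace H] {I : ModelWithCorners ℝ B H}
  {M : Type*} [TopologicalSpace M] [ChartedSpace H M] [IsManifold I ∞ M]
  {F : Type*} [NormedAddCommGroup F] [NormedSpace ℝ F] [FiniteDimensional ℝ F]
  {E : M → Type*} [TopologicalSpace (TotalSpace F E)]
  [∀ x, AddCommGroup (E x)] [∀ x, Module ℝ (E x)] [∀ x, TopologicalSpace (E x)]
  [∀ x, IsTopologicalAddGroup (E x)] [∀ x, ContinuousSMul ℝ (E x)]
  [FiberBundle F E] [VectorBundle ℝ F E] [ContMDiffVectorBundle ∞ F E I]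
  {V : Type*} [NormedAddCommGroup V] [NormedSpace ℝ V] [FiniteDimensional ℝ V]

/-- The expression of an endomorphism in a frame. -/
def frameConj {x : M} (u : F ≃L[ℝ] E x) (A : E x →L[ℝ] E x) : F →L[ℝ] F :=
  (u.symm : E x →L[ℝ] F).comp (A.comp (u : F →L[ℝ] E x))

/-- The endomorphism with a given expression in a frame. -/
def frameUnconj {x : M} (u : F ≃L[ℝ] E x) (A : F →L[ℝ] F) : E x →L[ℝ] E x :=
  (u : F →L[ℝ] E x).comp (A.comp (u.symm : E x →L[ℝ] F))

@[simp] theorem frameConj_apply {x : M} (u : F ≃L[ℝ] E x) (A : E x →L[ℝ] E x) (q : F) :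
    frameConj u A q = u.symm (A (u q)) := rfl

@[simp] theorem frameUnconj_apply {x : M} (u : F ≃L[ℝ] E x) (A : F →L[ℝ] F) (e : E x) :
    frameUnconj u A e = u (A (u.symm e)) := rfl

theorem frameConj_frameUnconj {x : M} (u : F ≃L[ℝ] E x) (A : F →L[ℝ] F) :
    frameConj u (frameUnconj u A) = A := by
  ext1 q; simp

theorem frameUnconj_frameConj {x : M} (u : F ≃L[ℝ] E x) (A : E x →L[ℝ] E x) :
    frameUnconj u (frameConj u A) = A := by
  ext1 q; simp

/-- The coordinates on the bundle of endomorphisms given by a frame and by coordinates on the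
base. -/
def endChart (u : ∀ x, F ≃L[ℝ] E x) (ψ : M → V)
    (p : TotalSpace (F →L[ℝ] F) (fun x : M => E x →L[ℝ] E x)) : V × (F →L[ℝ] F) :=
  (ψ p.proj, frameConj (u p.proj) p.2)

/-- The parametrization inverse to `endChart`. -/
def endChartSymm (u : ∀ x, F ≃L[ℝ] E x) (φ : V → M) (z : V × (F →L[ℝ] F)) :
    TotalSpace (F →L[ℝ] F) (fun x : M => E x →L[ℝ] E x) :=
  ⟨φ z.1, frameUnconj (u (φ z.1)) z.2⟩

/-- With this form of the inverse, conjugation by the frame matrix of the trivialized endomorphism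
is conjugation by the frame itself. -/
theorem inverse_frameMatrix_eq (e : Trivialization F (TotalSpace.proj : TotalSpace F E → M))
    [MemTrivializationAtlas e] (u : ∀ x, F ≃L[ℝ] E x) {y : M} (hy : y ∈ e.baseSet) :
    Ring.inverse (frameMatrix e u y) = ((u y).symm : E y →L[ℝ] F).comp (e.symmL ℝ y) := by
  ext1 q
  have h1 := e.continuousLinearMapAt_symmL (R := ℝ) hy q
  rw [Trivialization.continuousLinearMapAt_apply, Trivialization.coe_linearMapAt_of_mem _ hy] at h1
  have h2 := inverse_frameMatrix e u hy (e.symmL ℝ y q)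
  rwa [show (e ⟨y, e.symmL ℝ y q⟩).2 = q from h1] at h2

variable {u : ∀ x, F ≃L[ℝ] E x} {U : Set M} (hu : IsSmoothFrame I u U)
  {ψ : M → V} {φ : V → M} {O : Set M} {W : Set V} (h : IsFlatChart I ψ φ O W) (hO : O ⊆ U)
  {cov : CovariantDerivative I F E} {ρ : ∀ x : M, E x →L[ℝ] TangentSpace I x}

include hu

/-- The expression of a smooth family of endomorphisms in a smooth frame is smooth. -/
theorem contMDiffAt_frameConj {B' : Type*} [NormedAddCommGroup B'] [NormedSpace ℝ B']
    {H' : Type*} [TopologicalSpace H'] {I' : ModelWithCorners ℝ B' H'}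
    {N : Type*} [TopologicalSpace N] [ChartedSpace H' N]
    {f : N → TotalSpace (F →L[ℝ] F) (fun x : M => E x →L[ℝ] E x)} {p : N}
    (hp : (f p).proj ∈ U) (hf : ContMDiffAt I' (I.prod 𝓘(ℝ, F →L[ℝ] F)) ∞ f p) :
    ContMDiffAt I' 𝓘(ℝ, F →L[ℝ] F) ∞ (fun p => frameConj (u (f p).proj) (f p).2) p := by
  obtain ⟨h1, h2⟩ := (contMDiffAt_hom_bundle f).1 hf
  set e := trivializationAt F E (f p).proj
  have hpe : (f p).proj ∈ e.baseSet := FiberBundle.mem_baseSet_trivializationAt' _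
  have h3 := (hu.contMDiffAt_frameMatrix e hp hpe).comp p h1
  have h4 := (hu.contMDiffAt_inverse_frameMatrix e hp hpe).comp p h1
  refine ((h4.clm_comp h2).clm_comp h3).congr_of_eventuallyEq ?_
  filter_upwards [h1.continuousAt.preimage_mem_nhds (e.open_baseSet.mem_nhds hpe)] with y hy
  simp only [Function.comp_apply]
  rw [inverse_frameMatrix_eq e u hy]
  ext1 q
  simp only [frameConj_apply, ContinuousLinearMap.inCoordinates, frameMatrix,
    ContinuousLinearMap.comp_apply]
  rw [e.symmL_continuousLinearMapAt hy, e.symmL_continuousLinearMapAt hy]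
  rfl

theorem contMDiffAt_frameUnconj {B' : Type*} [NormedAddCommGroup B'] [NormedSpace ℝ B']
    {H' : Type*} [TopologicalSpace H'] {I' : ModelWithCorners ℝ B' H'}
    {N : Type*} [TopologicalSpace N] [ChartedSpace H' N]
    {f : N → M} {A : N → F →L[ℝ] F} {p : N}
    (hp : f p ∈ U) (hf : ContMDiffAt I' I ∞ f p) (hA : ContMDiffAt I' 𝓘(ℝ, F →L[ℝ] F) ∞ A p) :
    ContMDiffAt I' (I.prod 𝓘(ℝ, F →L[ℝ] F)) ∞ (fun p => TotalSpace.mk' (F →L[ℝ] F)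
      (E := fun x : M => E x →L[ℝ] E x) (f p) (frameUnconj (u (f p)) (A p))) p := by
  rw [contMDiffAt_hom_bundle]
  refine ⟨hf, ?_⟩
  set e := trivializationAt F E (f p)
  have hpe : f p ∈ e.baseSet := FiberBundle.mem_baseSet_trivializationAt' _
  have h3 := (hu.contMDiffAt_frameMatrix e hp hpe).comp p hf
  have h4 := (hu.contMDiffAt_inverse_frameMatrix e hp hpe).comp p hf
  refine ((h3.clm_comp hA).clm_comp h4).congr_of_eventuallyEq ?_
  filter_upwards [hf.continuousAt.preimage_mem_nhds (e.open_baseSet.mem_nhds hpe)] with y hy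
  simp only [Function.comp_apply]
  rw [inverse_frameMatrix_eq e u hy]
  rfl

include h hO

theorem isFlatChart_endChart :
    IsFlatChart (I.prod 𝓘(ℝ, F →L[ℝ] F)) (endChart (E := E) u ψ) (endChartSymm u φ)
      (TotalSpace.proj ⁻¹' O) (W ×ˢ Set.univ) where
  isOpen_source := h.isOpen_source.preimage
    (FiberBundle.continuous_proj (F →L[ℝ] F) (fun x : M => E x →L[ℝ] E x))
  isOpen_target := h.isOpen_target.prod isOpen_univ
  contMDiffOn p hp := by
    refine ContMDiffAt.contMDiffWithinAt ?_
    refine ContMDiffAt.prodMk_space ?_ (contMDiffAt_frameConj hu (hO hp) contMDiffAt_id)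
    exact (h.contMDiffAt hp).comp p (contMDiffAt_proj _)
  contMDiffOn_symm z hz := by
    refine ContMDiffAt.contMDiffWithinAt ?_
    exact contMDiffAt_frameUnconj hu (hO (h.map_target _ hz.1))
      ((h.contMDiffAt_symm hz.1).comp z contDiff_fst.contMDiff.contMDiffAt)
      contDiff_snd.contMDiff.contMDiffAt
  map_source p hp := ⟨h.map_source _ hp, trivial⟩
  map_target z hz := h.map_target _ hz.1
  left_inv p hp := by
    obtain ⟨x, A⟩ := p
    have : φ (ψ x) = x := h.left_inv x hp
    simp only [endChartSymm, endChart]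
    rw [this, frameUnconj_frameConj]
  right_inv z hz := by
    simp only [endChartSymm, endChart]
    rw [frameConj_frameUnconj, h.right_inv _ hz.1]

end FlatEnd

/-! ### Vertical and horizontal vectors in flat coordinates -/

section FlatHorizontal

set_option synthInstance.maxHeartbeats 400000
set_option linter.unusedSectionVars false

theorem flatDeriv_mfderiv {B : Type*} [NormedAddCommGroup B] [NormedSpace ℝ B]
    {H : Type*} [TopologicalSpace H] {I : ModelWithCorners ℝ B H}
    {N : Type*} [TopologicalSpace N] [ChartedSpace H N]
    {B' : Type*} [NormedAddCommGroup B'] [NormedSpace ℝ B']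
    {H' : Type*} [TopologicalSpace H'] {I' : ModelWithCorners ℝ B' H'}
    {N' : Type*} [TopologicalSpace N'] [ChartedSpace H' N']
    {V : Type*} [NormedAddCommGroup V] [NormedSpace ℝ V]
    {ψ : N → V} {f : N' → N} {p : N'} (hψ : MDiffAt ψ (f p)) (hf : MDiffAt f p)
    (v : TangentSpace I' p) :
    flatDeriv I ψ (f p) (mfderiv I' I f p v) = flatDeriv I' (ψ ∘ f) p v :=
  (mfderiv_comp_apply p hψ hf v).symm

theorem flatDeriv_clm {B : Type*} [NormedAddCommGroup B] [NormedSpace ℝ B]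
    {H : Type*} [TopologicalSpace H] {I : ModelWithCorners ℝ B H}
    {N : Type*} [TopologicalSpace N] [ChartedSpace H N]
    {V : Type*} [NormedAddCommGroup V] [NormedSpace ℝ V]
    {G : Type*} [NormedAddCommGroup G] [NormedSpace ℝ G] (T : V →L[ℝ] G)
    {ψ : N → V} {p : N} (hψ : MDiffAt ψ p) (v : TangentSpace I p) :
    flatDeriv I (fun p => T (ψ p)) p v = T (flatDeriv I ψ p v) := by
  have h1 := mfderiv_comp_apply p (g := T) T.mdifferentiableAt hψ v
  rw [ContinuousLinearMap.mfderiv_eq] at h1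
  exact h1

variable {B : Type*} [NormedAddCommGroup B] [NormedSpace ℝ B] [FiniteDimensional ℝ B]
  {H : Type*} [TopologicalSpace H] {I : ModelWithCorners ℝ B H}
  {M : Type*} [TopologicalSpace M] [ChartedSpace H M] [IsManifold I ∞ M]
  {F : Type*} [NormedAddCommGroup F] [NormedSpace ℝ F] [FiniteDimensional ℝ F]
  {E : M → Type*} [TopologicalSpace (TotalSpace F E)]
  [∀ x, AddCommGroup (E x)] [∀ x, Module ℝ (E x)] [∀ x, TopologicalSpace (E x)]
  [∀ x, IsTopologicalAddGroup (E x)] [∀ x, ContinuousSMul ℝ (E x)]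
  [FiberBundle F E] [VectorBundle ℝ F E] [ContMDiffVectorBundle ∞ F E I]
  {V : Type*} [NormedAddCommGroup V] [NormedSpace ℝ V] [FiniteDimensional ℝ V]

/-- The velocity `dσ(v)` of a local section `σ` of `End(E)` such that `∇_v σ = 0`. -/
def IsHorizontalVector (cov : CovariantDerivative I F E)
    (A : TotalSpace (F →L[ℝ] F) (fun x : M => E x →L[ℝ] E x))
    (w : TangentSpace (I.prod 𝓘(ℝ, F →L[ℝ] F)) A) : Prop :=
  ∃ (σ : ∀ x : M, E x →L[ℝ] E x) (v : TangentSpace I A.proj),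
    σ A.proj = A.2 ∧
    ContMDiffAt I (I.prod 𝓘(ℝ, F →L[ℝ] F)) ∞
      (fun x => TotalSpace.mk' (F →L[ℝ] F) x (σ x)) A.proj ∧
    (∀ s : ∀ x : M, E x,
      ContMDiffAt I (I.prod 𝓘(ℝ, F)) ∞ (fun x => TotalSpace.mk' F x (s x)) A.proj →
        cov (fun x => σ x (s x)) A.proj v = σ A.proj (cov s A.proj v)) ∧
    w = (mfderiv I (I.prod 𝓘(ℝ, F →L[ℝ] F))
      (fun x => TotalSpace.mk' (F →L[ℝ] F) x (σ x)) A.proj v)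

variable {u : ∀ x, F ≃L[ℝ] E x} {U : Set M} (hu : IsSmoothFrame I u U)
  {ψ : M → V} {φ : V → M} {O : Set M} {W : Set V} (h : IsFlatChart I ψ φ O W) (hO : O ⊆ U)
  {cov : CovariantDerivative I F E}
  {p : TotalSpace (F →L[ℝ] F) (fun x : M => E x →L[ℝ] E x)} (hp : p.proj ∈ O)

include hu h hO hp

theorem flatDeriv_endChart_fst (w : TangentSpace (I.prod 𝓘(ℝ, F →L[ℝ] F)) p) :
    (flatDeriv (I.prod 𝓘(ℝ, F →L[ℝ] F)) (endChart u ψ) p w).1 =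
      flatDeriv I ψ p.proj (mfderiv (I.prod 𝓘(ℝ, F →L[ℝ] F)) I
        (fun A : TotalSpace (F →L[ℝ] F) (fun x : M => E x →L[ℝ] E x) => A.proj) p w) := by
  have h1 := ((isFlatChart_endChart (E := E) hu h hO).contMDiffAt (p := p) hp).mdifferentiableAt
    (by simp)
  rw [flatDeriv_mfderiv ((h.contMDiffAt hp).mdifferentiableAt (by simp))
    ((contMDiffAt_proj (n := ∞) _).mdifferentiableAt (by simp))]
  exact (flatDeriv_clm (ContinuousLinearMap.fst ℝ V (F →L[ℝ] F)) h1 w).symm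

theorem flatDeriv_endChart_vertical (A : E p.proj →L[ℝ] E p.proj) :
    flatDeriv (I.prod 𝓘(ℝ, F →L[ℝ] F)) (endChart u ψ) p
      (mfderiv 𝓘(ℝ, ℝ) (I.prod 𝓘(ℝ, F →L[ℝ] F)) (fun t : ℝ => TotalSpace.mk' (F →L[ℝ] F)
        (E := fun x : M => E x →L[ℝ] E x) p.proj (p.2 + t • A)) 0 (1 : ℝ)) =
      (0, frameConj (u p.proj) A) := by
  set c : ℝ → TotalSpace (F →L[ℝ] F) (fun x : M => E x →L[ℝ] E x) := fun t =>
    TotalSpace.mk' (F →L[ℝ] F) (E := fun x : M => E x →L[ℝ] E x) p.proj (p.2 + t • A) with hc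
  have hlin : ∀ t : ℝ, frameUnconj (u p.proj)
      (frameConj (u p.proj) p.2 + t • frameConj (u p.proj) A) = p.2 + t • A := by
    intro t
    ext1 q
    simp
  have hcd : ContMDiffAt 𝓘(ℝ, ℝ) (I.prod 𝓘(ℝ, F →L[ℝ] F)) ∞ c 0 := by
    have := contMDiffAt_frameUnconj (I' := 𝓘(ℝ, ℝ)) (f := fun _ : ℝ => p.proj) (p := (0 : ℝ))
      (A := fun t => frameConj (u p.proj) p.2 + t • frameConj (u p.proj) A) hu (hO hp)
      contMDiffAt_const (ContDiff.contMDiff (by fun_prop)).contMDiffAt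
    simp only [hlin] at this
    exact this
  have hc0 : c 0 = p := by simp [hc]
  have h1 := ((isFlatChart_endChart (E := E) hu h hO).contMDiffAt (p := c 0)
    (by rw [hc0]; exact hp)).mdifferentiableAt (by simp)
  have h2 := flatDeriv_mfderiv h1 (hcd.mdifferentiableAt (by simp)) (1 : ℝ)
  have e : endChart u ψ ∘ c = fun t : ℝ =>
      (ψ p.proj, frameConj (u p.proj) p.2 + t • frameConj (u p.proj) A) := by
    ext1 t
    simp only [hc, endChart, Function.comp_apply]
    congr 1
    ext1 q
    simp
  have h3 : HasDerivAt (fun t : ℝ =>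
      (ψ p.proj, frameConj (u p.proj) p.2 + t • frameConj (u p.proj) A))
      (0, frameConj (u p.proj) A) 0 := by
    refine (hasDerivAt_const _ _).prodMk ?_
    simpa using ((hasDerivAt_id (0 : ℝ)).smul_const (frameConj (u p.proj) A)).const_add
      (frameConj (u p.proj) p.2)
  have h4 : flatDeriv 𝓘(ℝ, ℝ) (endChart u ψ ∘ c) 0 (1 : ℝ) = (0, frameConj (u p.proj) A) := by
    rw [e, flatDeriv, mfderiv_eq_fderiv]
    exact h3.deriv
  rw [h4] at h2
  rw [hc0] at h2
  exact h2

omit hp in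
theorem flatDeriv_endChart_section {σ : ∀ x : M, E x →L[ℝ] E x} {x : M} (hx : x ∈ O)
    (hσ : ContMDiffAt I (I.prod 𝓘(ℝ, F →L[ℝ] F)) ∞
      (fun x => TotalSpace.mk' (F →L[ℝ] F) x (σ x)) x) (v : TangentSpace I x) :
    flatDeriv (I.prod 𝓘(ℝ, F →L[ℝ] F)) (endChart u ψ) (TotalSpace.mk' (F →L[ℝ] F) x (σ x))
      (mfderiv I (I.prod 𝓘(ℝ, F →L[ℝ] F))
        (fun x => TotalSpace.mk' (F →L[ℝ] F) x (σ x)) x v) =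
      (flatDeriv I ψ x v, mvfderiv I (fun y => frameConj (u y) (σ y)) x v) := by
  have hc := isFlatChart_endChart (E := E) hu h hO
  have h1 := (hc.contMDiffAt (p := TotalSpace.mk' (F →L[ℝ] F) x (σ x)) hx).mdifferentiableAt
    (by simp)
  have h2 := hσ.mdifferentiableAt (by simp)
  have h3 : MDifferentiableAt I 𝓘(ℝ, V × (F →L[ℝ] F))
      (endChart u ψ ∘ fun x => TotalSpace.mk' (F →L[ℝ] F) x (σ x)) x :=
    MDifferentiableAt.comp (g := endChart u ψ)
      (f := fun x => TotalSpace.mk' (F →L[ℝ] F) x (σ x)) x h1 h2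
  rw [flatDeriv_mfderiv (f := fun x => TotalSpace.mk' (F →L[ℝ] F) x (σ x)) h1 h2]
  exact Prod.ext (flatDeriv_clm (ContinuousLinearMap.fst ℝ V (F →L[ℝ] F)) h3 v).symm
    (flatDeriv_clm (ContinuousLinearMap.snd ℝ V (F →L[ℝ] F)) h3 v).symm

omit hp in
/-- The covariant derivative of an endomorphism, in a smooth frame. -/
theorem cov_endomorphism {σ : ∀ x : M, E x →L[ℝ] E x} {x : M} (hx : x ∈ O)
    (hσ : ContMDiffAt I (I.prod 𝓘(ℝ, F →L[ℝ] F)) ∞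
      (fun x => TotalSpace.mk' (F →L[ℝ] F) x (σ x)) x) (v : TangentSpace I x)
    {s : ∀ x : M, E x}
    (hs : ContMDiffAt I (I.prod 𝓘(ℝ, F)) ∞ (fun x => TotalSpace.mk' F x (s x)) x) :
    cov (fun x => σ x (s x)) x v = σ x (cov s x v) +
      u x ((mvfderiv I (fun y => frameConj (u y) (σ y)) x v +
        (frameForm cov u x v * frameConj (u x) (σ x) -
          frameConj (u x) (σ x) * frameForm cov u x v)) ((u x).symm (s x))) := by
  have hσs : ContMDiffAt I (I.prod 𝓘(ℝ, F)) ∞ (fun x => TotalSpace.mk' F x (σ x (s x))) x :=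
    ContMDiffAt.clm_bundle_apply (b := id) hσ hs
  have ha : ContMDiffAt I 𝓘(ℝ, F →L[ℝ] F) ∞ (fun y => frameConj (u y) (σ y)) x :=
    contMDiffAt_frameConj hu (f := fun x => TotalSpace.mk' (F →L[ℝ] F) x (σ x)) (hO hx) hσ
  have hf := hu.contMDiffAt_coeff (hO hx) hs
  have e : (fun y => (u y).symm (σ y (s y))) =
      fun y => frameConj (u y) (σ y) ((u y).symm (s y)) := by
    ext1 y; simp
  have hd : mvfderiv I (fun y => frameConj (u y) (σ y) ((u y).symm (s y))) x v =
      mvfderiv I (fun y => frameConj (u y) (σ y)) x v ((u x).symm (s x)) +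
        frameConj (u x) (σ x) (mvfderiv I (fun y => (u y).symm (s y)) x v) := by
    have ha' := (h.contDiffAt_comp_symm (h.map_source x hx)
      (by rw [h.left_inv x hx]; exact ha)).differentiableAt (by simp)
    have hf' := (h.contDiffAt_comp_symm (h.map_source x hx)
      (by rw [h.left_inv x hx]; exact hf)).differentiableAt (by simp)
    have hx' : φ (ψ x) = x := h.left_inv x hx
    have e1 : frameConj (u (φ (ψ x))) (σ (φ (ψ x))) = frameConj (u x) (σ x) := by rw [hx']
    have e2 : (u (φ (ψ x))).symm (s (φ (ψ x))) = (u x).symm (s x) := by rw [hx']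
    have := (ha'.hasFDerivAt.clm_apply hf'.hasFDerivAt).fderiv
    rw [h.mvfderiv_eq hx ((ha.clm_apply hf).mdifferentiableAt (by simp)),
      h.mvfderiv_eq hx (ha.mdifferentiableAt (by simp)),
      h.mvfderiv_eq hx (hf.mdifferentiableAt (by simp)), this, e1, e2]
    simp [add_comm]
  rw [hu.cov_eq cov (hO hx) hσs, hu.cov_eq cov (hO hx) hs, e, hd]
  simp only [add_apply, sub_apply, mul_apply_eq_comp, frameConj_apply, map_add, map_sub,
    ContinuousLinearEquiv.apply_symm_apply]
  abel

/-- Tested on the frame sections `u q`, the condition `∇_v σ = 0` says that the derivative of the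
matrix of `σ` plus its commutator with `Γ` is null. -/
theorem vertPart_of_isHorizontalVector {w : TangentSpace (I.prod 𝓘(ℝ, F →L[ℝ] F)) p}
    (hw : IsHorizontalVector cov p w) :
    vertPart (flatForm cov u ψ φ) (endChart u ψ p)
      (flatDeriv (I.prod 𝓘(ℝ, F →L[ℝ] F)) (endChart u ψ) p w) = 0 := by
  obtain ⟨x, A⟩ := p
  obtain ⟨σ, v, hσx, hσ, hcov, rfl⟩ := hw
  obtain rfl : σ x = A := hσx
  have := flatDeriv_endChart_section hu h hO hp hσ v
  simp only [TotalSpace.mk'] at this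
  rw [this]
  ext1 q
  have h1 := hcov (fun y => u y q)
    ((hu.contMDiffOn q).contMDiffAt (hu.isOpen.mem_nhds (hO hp)))
  rw [cov_endomorphism hu h hO hp hσ v
    ((hu.contMDiffOn q).contMDiffAt (hu.isOpen.mem_nhds (hO hp)))] at h1
  simp only [add_eq_left] at h1
  have h2 := (u x).injective (h1.trans (map_zero (u x)).symm)
  simp only [ContinuousLinearEquiv.symm_apply_apply] at h2
  simp only [vertPart, endChart]
  rw [flatForm_flatDeriv h hp]
  exact h2

theorem isHorizontalVector_of_vertPart {w : TangentSpace (I.prod 𝓘(ℝ, F →L[ℝ] F)) p}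
    (hw : vertPart (flatForm cov u ψ φ) (endChart u ψ p)
      (flatDeriv (I.prod 𝓘(ℝ, F →L[ℝ] F)) (endChart u ψ) p w) = 0) :
    IsHorizontalVector cov p w := by
  have hinj := (isFlatChart_endChart (E := E) hu h hO).flatDeriv_injective (p := p) hp
  have hfst := flatDeriv_endChart_fst (E := E) hu h hO hp w
  obtain ⟨x, A⟩ := p
  set v : TangentSpace I x := mfderiv (I.prod 𝓘(ℝ, F →L[ℝ] F)) I
        (fun A : TotalSpace (F →L[ℝ] F) (fun x : M => E x →L[ℝ] E x) => A.proj) ⟨x, A⟩ w with hv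
  set a : F →L[ℝ] F := frameConj (u x) A with ha
  set Γ := frameForm cov u x v with hΓ
  -- The section sought has, in the frame, the affine expression `a + T (ψ y - ψ x)`; its derivative
  -- `T = [a, Γ]` is exactly what makes its covariant derivative vanish at `x`.
  set T : V →L[ℝ] F →L[ℝ] F :=
    ((ContinuousLinearMap.mul ℝ (F →L[ℝ] F) a) -
      (ContinuousLinearMap.mul ℝ (F →L[ℝ] F)).flip a).comp (flatForm cov u ψ φ (ψ x)) with hT
  have hTv : T (flatDeriv I ψ x v) = a * Γ - Γ * a := by
    simp only [hT, ContinuousLinearMap.comp_apply, flatForm_flatDeriv h hp]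
    rfl
  set α : M → F →L[ℝ] F := fun y => a + T (ψ y - ψ x) with hα
  have hαx : α x = a := by simp [hα]
  have hαd : ContMDiffAt I 𝓘(ℝ, F →L[ℝ] F) ∞ α x :=
    contMDiffAt_const.add (T.contMDiff.contMDiffAt.comp x
      ((h.contMDiffAt hp).sub contMDiffAt_const))
  have hαv : mvfderiv I α x v = a * Γ - Γ * a := by
    have e1 : (fun z => α (φ z)) =ᶠ[𝓝 (ψ x)] fun z => a + T (z - ψ x) := by
      filter_upwards [h.isOpen_target.mem_nhds (h.map_source x hp)] with z hz
      simp only [hα, h.right_inv z hz]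
    have e2 : HasFDerivAt (fun z => a + T (z - ψ x)) T (ψ x) := by
      simpa using (T.hasFDerivAt.comp (ψ x) ((hasFDerivAt_id (ψ x)).sub_const (ψ x))).const_add a
    rw [h.mvfderiv_eq hp (hαd.mdifferentiableAt (by simp)), e1.fderiv_eq, e2.fderiv, hTv]
  set σ : ∀ y : M, E y →L[ℝ] E y := fun y => frameUnconj (u y) (α y) with hσ
  have hconj : (fun y => frameConj (u y) (σ y)) = α := by
    ext1 y; exact frameConj_frameUnconj _ _
  have hσx : σ x = A := by
    simp only [hσ, hαx, ha, frameUnconj_frameConj]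
  have hσd : ContMDiffAt I (I.prod 𝓘(ℝ, F →L[ℝ] F)) ∞
      (fun x => TotalSpace.mk' (F →L[ℝ] F) x (σ x)) x :=
    contMDiffAt_frameUnconj hu (hO hp) contMDiffAt_id hαd
  refine ⟨σ, v, hσx, hσd, fun s hs => ?_, ?_⟩
  · have h1 := cov_endomorphism (cov := cov) hu h hO hp hσd v hs
    rw [hconj, hαv] at h1
    have h2 : frameConj (u x) (σ x) = a := by rw [hσx]
    rw [h2] at h1
    rw [show cov (fun x => σ x (s x)) x v = _ from h1]
    simp [hΓ]
  · apply hinj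
    have h1 := flatDeriv_endChart_section hu h hO hp hσd v
    rw [hσx, hconj, hαv] at h1
    refine Eq.trans ?_ h1.symm
    refine Prod.ext hfst ?_
    rw [vertPart, hfst] at hw
    simp only [endChart, flatForm_flatDeriv h hp] at hw
    rw [← neg_sub]
    exact eq_neg_of_add_eq_zero_left hw

end FlatHorizontal

/-! ### The twistor distribution in flat coordinates -/

theorem vertPart_add {B F : Type*} [NormedAddCommGroup B] [NormedSpace ℝ B]
    [NormedAddCommGroup F] [NormedSpace ℝ F] (Γ : B → B →L[ℝ] F →L[ℝ] F)
    (z w w' : B × (F →L[ℝ] F)) : vertPart Γ z (w + w') = vertPart Γ z w + vertPart Γ z w' := by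
  simp only [vertPart, Prod.snd_add, Prod.fst_add, map_add, add_mul, mul_add]
  abel

theorem vertPart_smul {B F : Type*} [NormedAddCommGroup B] [NormedSpace ℝ B]
    [NormedAddCommGroup F] [NormedSpace ℝ F] (Γ : B → B →L[ℝ] F →L[ℝ] F) (c : ℝ)
    (z w : B × (F →L[ℝ] F)) : vertPart Γ z (c • w) = c • vertPart Γ z w := by
  simp only [vertPart, Prod.smul_snd, Prod.smul_fst, map_smul, smul_mul_assoc, mul_smul_comm,
    smul_add, smul_sub]

theorem vertPart_vertical {B F : Type*} [NormedAddCommGroup B] [NormedSpace ℝ B]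
    [NormedAddCommGroup F] [NormedSpace ℝ F] (Γ : B → B →L[ℝ] F →L[ℝ] F)
    (z : B × (F →L[ℝ] F)) (A : F →L[ℝ] F) : vertPart Γ z (0, A) = A := by
  simp [vertPart]

section Twistor

set_option synthInstance.maxHeartbeats 400000
set_option linter.unusedSectionVars false

variable {B : Type*} [NormedAddCommGroup B] [NormedSpace ℝ B] [FiniteDimensional ℝ B]
  {H : Type*} [TopologicalSpace H] {I : ModelWithCorners ℝ B H}
  {M : Type*} [TopologicalSpace M] [ChartedSpace H M] [IsManifold I ∞ M]
  {k : ℕ}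
  {E : M → Type*} [TopologicalSpace (TotalSpace (HVec k) E)]
  [∀ x, AddCommGroup (E x)] [∀ x, Module ℝ (E x)] [∀ x, TopologicalSpace (E x)]
  [∀ x, IsTopologicalAddGroup (E x)] [∀ x, ContinuousSMul ℝ (E x)]
  [FiberBundle (HVec k) E] [VectorBundle ℝ (HVec k) E] [ContMDiffVectorBundle ∞ (HVec k) E I]
  {V : Type*} [NormedAddCommGroup V] [NormedSpace ℝ V] [FiniteDimensional ℝ V]

namespace QuaternionicBundle

variable (Q : QuaternionicBundle I k E) {x : M} {u v : HVec k ≃L[ℝ] E x}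

/-- Two admissible frames differ by an element of `SpGL k`, which conjugates imaginary left
multiplications into imaginary ones of the same norm. Membership in `Q` or `Z` can thus be tested in
any single admissible frame. -/
theorem exists_leftMul_of_mem_frames (hu : u ∈ Q.frames x) (hv : v ∈ Q.frames x) {p : ℍ[ℝ]}
    (hp : p.re = 0) {A : E x →L[ℝ] E x} (hA : ∀ q, A (v q) = v (leftMul k p q)) :
    ∃ r : ℍ[ℝ], r.re = 0 ∧ ‖r‖ = ‖p‖ ∧ frameConj u A = leftMul k r := by
  obtain ⟨g, hg, rfl⟩ := (Q.mem_frames_iff x u v hu).1 hv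
  obtain ⟨r, hr, hr', h⟩ := SpGL.conj_leftMul hg hp
  refine ⟨r, hr, hr', ?_⟩
  ext1 q
  have h1 := hA (g.symm q)
  simp only [ContinuousLinearEquiv.trans_apply, h, ContinuousLinearEquiv.apply_symm_apply] at h1
  rw [frameConj_apply, h1, ContinuousLinearEquiv.symm_apply_apply]

theorem mem_imEnd_iff (hu : u ∈ Q.frames x) {A : E x →L[ℝ] E x} :
    A ∈ Q.imEnd x ↔ frameConj u A ∈ imLeftMul k := by
  constructor
  · rintro ⟨v, hv, p, hp, hA⟩
    obtain ⟨r, hr, -, h⟩ := Q.exists_leftMul_of_mem_frames hu hv hp hA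
    exact ⟨r, hr, h⟩
  · rintro ⟨p, hp, hA⟩
    refine ⟨u, hu, p, hp, fun q => ?_⟩
    rw [← hA]
    simp

theorem isAdmissible_iff (hu : u ∈ Q.frames x) {A : E x →L[ℝ] E x} :
    Q.IsAdmissible x A ↔ frameConj u A ∈ unitImLeftMul k := by
  constructor
  · rintro ⟨v, hv, p, hp, hp', hA⟩
    obtain ⟨r, hr, hr', h⟩ := Q.exists_leftMul_of_mem_frames hu hv hp hA
    exact ⟨r, hr, hr'.trans hp', h⟩
  · rintro ⟨p, hp, hp', hA⟩
    refine ⟨u, hu, p, hp, hp', fun q => ?_⟩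
    rw [← hA]
    simp

variable {Q}

theorem IsAdmissible.apply_apply {J : E x →L[ℝ] E x} (hJ : Q.IsAdmissible x J) (e : E x) :
    J (J e) = - e := by
  obtain ⟨u, hu, p, hp, hp', h⟩ := hJ
  have h1 := h (u.symm e)
  have h2 := h (leftMul k p (u.symm e))
  have h3 : leftMul k p (leftMul k p (u.symm e)) = - u.symm e :=
    congrArg (fun T : HVec k →L[ℝ] HVec k => T (u.symm e)) (leftMul_mul_self hp hp')
  rw [u.apply_symm_apply] at h1
  rw [h1, h2, h3, map_neg, u.apply_symm_apply]

/-- The real part of `(J + i)(a + i b) = 0` is `J a = b`; the imaginary part `J b = -a` then follows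
from `J² = -1`. -/
theorem IsAdmissible.cvec_mem_eigenMinus {J : E x →L[ℝ] E x} (hJ : Q.IsAdmissible x J)
    {a b : E x} : cvec a b ∈ eigenMinus J ↔ b = J a := by
  have h0 : cvec (0 : E x) 0 = 0 := by simp [cvec]
  rw [eigenMinus, LinearMap.mem_ker, LinearMap.add_apply, baseChange_cvec, LinearMap.smul_apply,
    LinearMap.id_apply, smul_cvec, cvec_add, ← h0, cvec_inj]
  simp only [ContinuousLinearMap.coe_coe, Complex.I_re, Complex.I_im, zero_smul, one_smul,
    zero_sub, zero_add]
  constructor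
  · rintro ⟨h1, -⟩
    exact (eq_of_sub_eq_zero (by rwa [sub_eq_add_neg])).symm
  · rintro rfl
    simp [hJ.apply_apply]

end QuaternionicBundle

variable {S : AlmostCoCRQuaternionic I k E} {x : M}

theorem cvec_mem_imEigenMinus {J : E x →L[ℝ] E x} (hJ : S.IsAdmissible x J)
    {a b : TangentSpace I x} :
    cvec a b ∈ S.imEigenMinus J ↔ ∃ e, a = S.anchor x e ∧ b = S.anchor x (J e) := by
  constructor
  · rintro ⟨w, hw, h⟩
    obtain ⟨c, d, rfl⟩ := exists_eq_cvec w
    obtain rfl := hJ.cvec_mem_eigenMinus.1 hw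
    rw [baseChange_cvec, cvec_inj] at h
    exact ⟨c, h.1.symm, h.2.symm⟩
  · rintro ⟨e, rfl, rfl⟩
    exact ⟨cvec e (J e), hJ.cvec_mem_eigenMinus.2 rfl, baseChange_cvec _ _ _⟩

variable {u : ∀ x, HVec k ≃L[ℝ] E x} {U : Set M} (hu : IsSmoothFrame I u U)
  {ψ : M → V} {φ : V → M} {O : Set M} {W : Set V} (h : IsFlatChart I ψ φ O W) (hO : O ⊆ U)
  {cov : CovariantDerivative I (HVec k) E}
  {p : EndTotal k E} (hp : p.proj ∈ O)

include hu h hO hp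

theorem flatDeriv_vertLift (A : E p.proj →L[ℝ] E p.proj) :
    flatDeriv (endModel I k) (endChart u ψ) p (vertLift p A) = (0, frameConj (u p.proj) A) :=
  flatDeriv_endChart_vertical hu h hO hp A

theorem flatDeriv_dproj (w : TangentSpace (endModel I k) p) :
    flatDeriv I ψ p.proj (dproj p w) = (flatDeriv (endModel I k) (endChart u ψ) p w).1 :=
  (flatDeriv_endChart_fst hu h hO hp w).symm

/-- The vanishing of `vertPart` is a linear condition, so the span in the definition of the
horizontal space adds nothing to its generators. -/
theorem mem_horizontalSpace_iff {w : TangentSpace (endModel I k) p} :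
    w ∈ horizontalSpace cov p ↔ vertPart (flatForm cov u ψ φ) (endChart u ψ p)
      (flatDeriv (endModel I k) (endChart u ψ) p w) = 0 := by
  constructor
  · intro hw
    induction hw using Submodule.span_induction with
    | mem w hw => exact vertPart_of_isHorizontalVector hu h hO hp hw
    | zero => simp [vertPart]
    | add a b _ _ ha hb => rw [map_add, vertPart_add, ha, hb, add_zero]
    | smul c a _ ha => rw [map_smul, vertPart_smul, ha, smul_zero]
  · intro hw
    exact Submodule.subset_span (isHorizontalVector_of_vertPart hu h hO hp hw)

theorem flatDeriv_endChart_injective :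
    Function.Injective (flatDeriv (endModel I k) (endChart (E := E) u ψ) p) :=
  (isFlatChart_endChart hu h hO).flatDeriv_injective hp

theorem vertLift_add (A A' : E p.proj →L[ℝ] E p.proj) :
    vertLift (I := I) p (A + A') = vertLift p A + vertLift p A' := by
  apply flatDeriv_endChart_injective hu h hO hp
  rw [map_add, flatDeriv_vertLift hu h hO hp, flatDeriv_vertLift hu h hO hp,
    flatDeriv_vertLift hu h hO hp]
  refine Prod.ext (add_zero _).symm ?_
  ext1 q
  simp

theorem vertLift_smul (c : ℝ) (A : E p.proj →L[ℝ] E p.proj) :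
    vertLift (I := I) p (c • A) = c • vertLift p A := by
  apply flatDeriv_endChart_injective hu h hO hp
  rw [map_smul, flatDeriv_vertLift hu h hO hp, flatDeriv_vertLift hu h hO hp]
  refine Prod.ext (smul_zero _).symm ?_
  ext1 q
  simp

/-- The generators `A + i J A` already form a complex subspace: multiplication by `c` replaces `A`
by `(re c) A - (im c) J A`, again imaginary and anticommuting with `J`. The span can therefore be
dropped. -/
theorem mem_verticalZeroOne_iff (hfr : u p.proj ∈ S.frames p.proj)
    (hJ : S.IsAdmissible p.proj p.2) {w : ℂ ⊗[ℝ] TangentSpace (endModel I k) p} :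
    w ∈ S.verticalZeroOne p ↔ ∃ A ∈ S.imEnd p.proj, p.2.comp A = - A.comp p.2 ∧
      w = cvec (vertLift p A) (vertLift p (p.2.comp A)) := by
  refine ⟨fun hw => ?_, fun hw => Submodule.subset_span hw⟩
  have hJJ : ∀ A : E p.proj →L[ℝ] E p.proj, p.2.comp (p.2.comp A) = - A := fun A => by
    ext1 e; simp [hJ.apply_apply]
  induction hw using Submodule.span_induction with
  | mem w hw => exact hw
  | zero =>
    refine ⟨0, (S.mem_imEnd_iff hfr).2 ?_, by simp, ?_⟩
    · convert (imLeftMul k).zero_mem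
      ext1 q; simp
    · have : vertLift (I := I) p 0 = 0 := by
        simpa using vertLift_smul hu h hO hp 0 0
      simp [cvec, this]
  | add a b _ _ ha hb =>
    obtain ⟨A, hA, hA', rfl⟩ := ha
    obtain ⟨A', hA₁, hA₁', rfl⟩ := hb
    refine ⟨A + A', (S.mem_imEnd_iff hfr).2 ?_, ?_, ?_⟩
    · convert (imLeftMul k).add_mem ((S.mem_imEnd_iff hfr).1 hA) ((S.mem_imEnd_iff hfr).1 hA₁)
      ext1 q; simp
    · rw [ContinuousLinearMap.comp_add, ContinuousLinearMap.add_comp, hA', hA₁', neg_add]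
    · rw [cvec_add, ContinuousLinearMap.comp_add, vertLift_add hu h hO hp,
        vertLift_add hu h hO hp]
  | smul c a _ ha =>
    obtain ⟨A, hA, hA', rfl⟩ := ha
    have hmem : frameConj (u p.proj) (p.2.comp A) ∈ imLeftMul k := by
      have := mul_mem_imLeftMul ((S.isAdmissible_iff hfr).1 hJ) ((S.mem_imEnd_iff hfr).1 hA) (by
        ext1 q
        have := congrArg (fun T : E p.proj →L[ℝ] E p.proj => T (u p.proj q)) hA'
        simpa using congrArg (u p.proj).symm this)
      convert this using 1
      ext1 q; simp
    have hcc : p.2.comp (c.re • A - c.im • p.2.comp A) = c.re • p.2.comp A + c.im • A := by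
      rw [ContinuousLinearMap.comp_sub, ContinuousLinearMap.comp_smul,
        ContinuousLinearMap.comp_smul, hJJ]
      module
    refine ⟨c.re • A - c.im • p.2.comp A, (S.mem_imEnd_iff hfr).2 ?_, ?_, ?_⟩
    · convert (imLeftMul k).sub_mem ((imLeftMul k).smul_mem c.re ((S.mem_imEnd_iff hfr).1 hA))
        ((imLeftMul k).smul_mem c.im hmem)
      ext1 q; simp
    · rw [hcc, ContinuousLinearMap.sub_comp, ContinuousLinearMap.smul_comp,
        ContinuousLinearMap.smul_comp, hA', ContinuousLinearMap.neg_comp,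
        ContinuousLinearMap.comp_assoc]
      have h1 : A.comp (p.2.comp p.2) = - A := by ext1 e; simp [hJ.apply_apply]
      rw [h1]
      module
    · rw [smul_cvec, hcc, sub_eq_add_neg, ← neg_smul, sub_eq_add_neg, ← neg_smul,
        vertLift_add hu h hO hp, vertLift_add hu h hO hp, vertLift_smul hu h hO hp,
        vertLift_smul hu h hO hp, vertLift_smul hu h hO hp, vertLift_smul hu h hO hp]

theorem mem_modelDistribution_of_mem (hfr : u p.proj ∈ S.frames p.proj)
    (hJ : S.IsAdmissible p.proj p.2) {a b : TangentSpace (endModel I k) p}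
    (hab : cvec a b ∈ S.coCRDistribution cov p) :
    (flatDeriv (endModel I k) (endChart u ψ) p a, flatDeriv (endModel I k) (endChart u ψ) p b) ∈
      modelDistribution (flatForm cov u ψ φ) (flatAnchor S.anchor u ψ φ) (imLeftMul k)
        (endChart u ψ p) := by
  set D := flatDeriv (endModel I k) (endChart u ψ) p with hD
  have hanch : ∀ q, flatAnchor S.anchor u ψ φ (endChart u ψ p).1 q =
      flatDeriv I ψ p.proj (S.anchor p.proj (u p.proj q)) := fun q => flatAnchor_apply h hp q
  have hJq : ∀ q, u p.proj ((endChart u ψ p).2 q) = p.2 (u p.proj q) := fun q => by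
    simp [endChart]
  obtain ⟨v, hv, w, hw, hvw⟩ := Submodule.mem_sup.1 hab
  obtain ⟨A, hA, hA', rfl⟩ := (mem_verticalZeroOne_iff hu h hO hp hfr hJ).1 hv
  obtain ⟨c, d, rfl⟩ := exists_eq_cvec w
  rw [cvec_add, cvec_inj] at hvw
  obtain ⟨rfl, rfl⟩ := hvw
  obtain ⟨hw1, hw2⟩ := hw
  obtain ⟨hc, hd⟩ := cvec_mem_baseChange.1 hw1
  have hw3 : cvec (dproj p c) (dproj p d) ∈ S.imEigenMinus p.2 := by
    have := Submodule.mem_comap.1 hw2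
    rwa [baseChange_cvec] at this
  obtain ⟨e, he, he'⟩ := (cvec_mem_imEigenMinus hJ).1 hw3
  have hvc : vertPart (flatForm cov u ψ φ) (endChart u ψ p) (D (vertLift p A + c)) =
      frameConj (u p.proj) A := by
    rw [map_add, vertPart_add, (mem_horizontalSpace_iff hu h hO hp).1 hc,
      flatDeriv_vertLift hu h hO hp, vertPart_vertical, add_zero]
  have hvd : vertPart (flatForm cov u ψ φ) (endChart u ψ p) (D (vertLift p (p.2.comp A) + d)) =
      frameConj (u p.proj) (p.2.comp A) := by
    rw [map_add, vertPart_add, (mem_horizontalSpace_iff hu h hO hp).1 hd,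
      flatDeriv_vertLift hu h hO hp, vertPart_vertical, add_zero]
  refine ⟨⟨?_, ?_, ?_⟩, (u p.proj).symm e, ?_, ?_⟩
  · simp only [hvc]
    exact (S.mem_imEnd_iff hfr).1 hA
  · simp only [hvc]
    ext1 q
    have := congrArg (fun T : E p.proj →L[ℝ] E p.proj => T (u p.proj q)) hA'
    simpa [endChart] using congrArg (u p.proj).symm this
  · simp only [hvc, hvd]
    ext1 q
    simp [endChart]
  · simp only
    rw [hanch, map_add, Prod.fst_add, flatDeriv_vertLift hu h hO hp,
      ← flatDeriv_dproj hu h hO hp, he]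
    simp
  · simp only
    rw [hanch, map_add, Prod.fst_add, flatDeriv_vertLift hu h hO hp,
      ← flatDeriv_dproj hu h hO hp, he', hJq]
    simp
set_option maxHeartbeats 400000 in
theorem mem_coCRDistribution_of_mem (hfr : u p.proj ∈ S.frames p.proj)
    (hJ : S.IsAdmissible p.proj p.2) {a b : TangentSpace (endModel I k) p}
    (hab : (flatDeriv (endModel I k) (endChart u ψ) p a, flatDeriv (endModel I k) (endChart u ψ) p b) ∈
      modelDistribution (flatForm cov u ψ φ) (flatAnchor S.anchor u ψ φ) (imLeftMul k)
        (endChart u ψ p)) :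
    cvec a b ∈ S.coCRDistribution cov p := by
  set D := flatDeriv (endModel I k) (endChart u ψ) p with hD
  have hanch : ∀ q, flatAnchor S.anchor u ψ φ (endChart u ψ p).1 q =
      flatDeriv I ψ p.proj (S.anchor p.proj (u p.proj q)) := fun q => flatAnchor_apply h hp q
  have hJq : ∀ q, u p.proj ((endChart u ψ p).2 q) = p.2 (u p.proj q) := fun q => by
    simp [endChart]
  obtain ⟨⟨h1, h2, h3⟩, q, hq, hq'⟩ := hab
  simp only at h1 h2 h3 hq hq'
  set C := vertPart (flatForm cov u ψ φ) (endChart u ψ p) (D a) with hC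
  -- The vertical summand must be given by the vertical part of `a`. What remains of `a + i b` is
  -- horizontal and keeps its projection, which lies in `ρ(E^J)`.
  set A := frameUnconj (u p.proj) C with hA
  have hAC : frameConj (u p.proj) A = C := frameConj_frameUnconj _ _
  have hAC' : frameConj (u p.proj) (p.2.comp A) = (endChart u ψ p).2 * C := by
    ext1 q; simp [hA, endChart]
  have hv : cvec (vertLift p A) (vertLift p (p.2.comp A)) ∈ S.verticalZeroOne p := by
    refine Submodule.subset_span ⟨A, (S.mem_imEnd_iff hfr).2 (by rwa [hAC]), ?_, rfl⟩
    ext1 e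
    have := congrArg (fun T : HVec k →L[ℝ] HVec k => T ((u p.proj).symm e)) h2
    have := congrArg (u p.proj) this
    simpa [endChart, hA] using this
  have hw : cvec (a - vertLift p A) (b - vertLift p (p.2.comp A)) ∈ S.horizontalLift cov p := by
    refine ⟨cvec_mem_baseChange.2 ⟨?_, ?_⟩, Submodule.mem_comap.2 ?_⟩
    · rw [mem_horizontalSpace_iff hu h hO hp, sub_eq_add_neg, ← neg_one_smul ℝ, map_add,
        map_smul, vertPart_add, vertPart_smul, flatDeriv_vertLift hu h hO hp,
        vertPart_vertical, hAC, ← hC]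
      module
    · rw [mem_horizontalSpace_iff hu h hO hp, sub_eq_add_neg, ← neg_one_smul ℝ, map_add,
        map_smul, vertPart_add, vertPart_smul, flatDeriv_vertLift hu h hO hp,
        vertPart_vertical, hAC', h3]
      module
    · rw [baseChange_cvec]
      refine (cvec_mem_imEigenMinus hJ).2 ⟨u p.proj q, ?_, ?_⟩
      · apply h.flatDeriv_injective hp
        refine (flatDeriv_dproj hu h hO hp _).trans ?_
        rw [map_sub, flatDeriv_vertLift hu h hO hp, ← hanch, ← hq]
        exact sub_zero _
      · apply h.flatDeriv_injective hp
        refine (flatDeriv_dproj hu h hO hp _).trans ?_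
        rw [map_sub, flatDeriv_vertLift hu h hO hp, ← hJq, ← hanch, ← hq']
        exact sub_zero _
  have := Submodule.add_mem_sup hv hw
  rw [cvec_add, add_sub_cancel, add_sub_cancel] at this
  exact this

theorem cvec_mem_coCRDistribution (hfr : u p.proj ∈ S.frames p.proj)
    (hJ : S.IsAdmissible p.proj p.2) {a b : TangentSpace (endModel I k) p} :
    cvec a b ∈ S.coCRDistribution cov p ↔
      (flatDeriv (endModel I k) (endChart u ψ) p a, flatDeriv (endModel I k) (endChart u ψ) p b) ∈
      modelDistribution (flatForm cov u ψ φ) (flatAnchor S.anchor u ψ φ) (imLeftMul k)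
        (endChart u ψ p) :=
  ⟨mem_modelDistribution_of_mem hu h hO hp hfr hJ, mem_coCRDistribution_of_mem hu h hO hp hfr hJ⟩

omit hp in
theorem isTwistorModel (hfr : ∀ y ∈ U, u y ∈ S.frames y) (hcov : IsSmoothConnection cov)
    (hcomp : S.IsCompatible cov) :
    IsTwistorModel W (flatForm cov u ψ φ) (flatAnchor S.anchor u ψ φ) (unitImLeftMul k)
      (imLeftMul k) where
  isOpen := h.isOpen_target
  differentiableAt_form y hy :=
    (contDiffAt_flatForm hu h hO hcov hy).differentiableAt (by simp)
  differentiableAt_anchor y hy :=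
    (contDiffAt_flatAnchor hu h hO S.smooth_anchor hy).differentiableAt (by simp)
  mem_span := by
    rintro _ ⟨p, hp, -, rfl⟩
    exact ⟨p, hp, rfl⟩
  mul_self := by
    rintro _ ⟨p, hp, hp', rfl⟩
    exact leftMul_mul_self hp hp'
  mul_mem J hJ A hA hJA := mul_mem_imLeftMul hJ hA hJA
  exists_curve J hJ A hA hJA := exists_curve_unitImLeftMul hJ hA hJA
  commutator_mem y hy v A hA := by
    have hx := hO (h.map_target y hy)
    refine commutator_mem_of_mem_spglLie ?_ hA
    have := hcomp U u hu.isOpen hfr hu.contMDiffOn (φ y) hx ((flatDeriv I ψ (φ y)).inverse v)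
    convert this using 1
    ext1 q
    exact hu.frameForm_apply cov hx _ q
  eq_zero_of_anchor y hy J hJ q hq hq' := by
    have hx := h.map_target y hy
    have hfx := hfr _ (hO hx)
    set x := φ y with hxy
    have e := h.right_inv y hy
    rw [← e, flatAnchor_apply h hx] at hq hq'
    have h1 := h.flatDeriv_injective hx (hq.trans (map_zero _).symm)
    have h2 := h.flatDeriv_injective hx (hq'.trans (map_zero _).symm)
    set J' := frameUnconj (u x) J with hJ'
    have hadm : S.IsAdmissible x J' := (S.isAdmissible_iff hfx).2 (by
      rw [hJ', frameConj_frameUnconj]; exact hJ)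
    have hJq : u x (J q) = J' (u x q) := by simp [hJ']
    -- The span of `u q` and `J (u q)` is preserved by `J` and lies in the kernel of the anchor,
    -- hence is null.
    have h3 := S.ker_anchor x J' hadm (Submodule.span ℝ {u x q, J' (u x q)}) ?_ ?_
    · have : u x q ∈ (⊥ : Submodule ℝ (E x)) := by
        rw [← h3]; exact Submodule.subset_span (by simp)
      exact (u x).injective (((Submodule.mem_bot ℝ).1 this).trans (map_zero _).symm)
    · intro w hw
      obtain ⟨c, d, rfl⟩ := Submodule.mem_span_pair.1 hw
      rw [map_add, map_smul, map_smul, h1, ← hJq, h2]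
      simp
    · intro w hw
      obtain ⟨c, d, rfl⟩ := Submodule.mem_span_pair.1 hw
      rw [map_add, map_smul, map_smul, hadm.apply_apply]
      exact Submodule.mem_span_pair.2 ⟨-d, c, by module⟩

end Twistor

/-! ### Integrability of the twistor distribution -/

/-- The operator `R₁ + i R₂` preserves the vectors `a + i J a`, in terms of commutators. -/
theorem commutator_condition_iff {F : Type*} [NormedAddCommGroup F] [NormedSpace ℝ F]
    {J R₁ R₂ : F →L[ℝ] F} (hJ : J * J = -1) :
    (∀ a, R₁ (J a) + R₂ a = J (R₁ a - R₂ (J a))) ↔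
      R₂ * J - J * R₂ = J * (R₁ * J - J * R₁) := by
  have hJJ : ∀ a, J (J a) = - a := fun a => congrArg (fun T : F →L[ℝ] F => T a) hJ
  constructor
  · intro h
    ext1 a
    -- Substituting `J a` for `a` turns one identity into the other, since `J² = -1`; the converse
    -- uses the same substitution.
    have := h (J a)
    simp only [hJJ, map_neg, map_sub, sub_apply, mul_apply_eq_comp] at this ⊢
    rw [← sub_eq_zero] at this ⊢
    rw [← this]
    abel
  · intro h a
    have := congrArg (fun T : F →L[ℝ] F => T (J a)) h
    simp only [hJJ, map_neg, map_sub, sub_apply, mul_apply_eq_comp] at this ⊢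
    rw [← sub_eq_zero] at this
    rw [← sub_eq_zero, ← neg_eq_zero, ← this]
    abel

/-! ### The curvature and torsion conditions in real terms and in flat coordinates. -/

section Twistor

set_option synthInstance.maxHeartbeats 400000
set_option linter.unusedSectionVars false

variable {B : Type*} [NormedAddCommGroup B] [NormedSpace ℝ B] [FiniteDimensional ℝ B]
  {H : Type*} [TopologicalSpace H] {I : ModelWithCorners ℝ B H}
  {M : Type*} [TopologicalSpace M] [ChartedSpace H M] [IsManifold I ∞ M]
  {k : ℕ}
  {E : M → Type*} [TopologicalSpace (TotalSpace (HVec k) E)]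
  [∀ x, AddCommGroup (E x)] [∀ x, Module ℝ (E x)] [∀ x, TopologicalSpace (E x)]
  [∀ x, IsTopologicalAddGroup (E x)] [∀ x, ContinuousSMul ℝ (E x)]
  [FiberBundle (HVec k) E] [VectorBundle ℝ (HVec k) E] [ContMDiffVectorBundle ∞ (HVec k) E I]
  {V : Type*} [NormedAddCommGroup V] [NormedSpace ℝ V] [FiniteDimensional ℝ V]
  {S : AlmostCoCRQuaternionic I k E}

/-- Parametrising `E^J` by `a ↦ a + i J a`, the complex curvature operator of two such vectors is
`R₁ + i R₂`, where `R₁` and `R₂` are the combinations of real curvatures displayed. -/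
theorem curvature_condition_iff {x : M} {J : E x →L[ℝ] E x} (hJ : S.IsAdmissible x J)
    (R : TangentSpace I x →ₗ[ℝ] TangentSpace I x →ₗ[ℝ] E x →ₗ[ℝ] E x) :
    (∀ X ∈ S.imEigenMinus J, ∀ Y ∈ S.imEigenMinus J, ∀ e ∈ eigenMinus J,
      complexify₃ R X Y e ∈ eigenMinus J) ↔
    ∀ a b c, (R (S.anchor x a) (S.anchor x b) - R (S.anchor x (J a)) (S.anchor x (J b))) (J c) +
        (R (S.anchor x a) (S.anchor x (J b)) + R (S.anchor x (J a)) (S.anchor x b)) c =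
      J ((R (S.anchor x a) (S.anchor x b) - R (S.anchor x (J a)) (S.anchor x (J b))) c -
        (R (S.anchor x a) (S.anchor x (J b)) + R (S.anchor x (J a)) (S.anchor x b)) (J c)) := by
  constructor
  · intro h a b c
    have := h _ ((cvec_mem_imEigenMinus hJ).2 ⟨a, rfl, rfl⟩) _
      ((cvec_mem_imEigenMinus hJ).2 ⟨b, rfl, rfl⟩) _ (hJ.cvec_mem_eigenMinus.2 (rfl : J c = J c))
    rw [complexify₃_cvec] at this
    exact hJ.cvec_mem_eigenMinus.1 this
  · intro h X hX Y hY e he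
    obtain ⟨X₁, X₂, rfl⟩ := exists_eq_cvec X
    obtain ⟨Y₁, Y₂, rfl⟩ := exists_eq_cvec Y
    obtain ⟨c, d, rfl⟩ := exists_eq_cvec e
    obtain ⟨a, rfl, rfl⟩ := (cvec_mem_imEigenMinus hJ).1 hX
    obtain ⟨b, rfl, rfl⟩ := (cvec_mem_imEigenMinus hJ).1 hY
    obtain rfl := hJ.cvec_mem_eigenMinus.1 he
    rw [complexify₃_cvec]
    exact hJ.cvec_mem_eigenMinus.2 (h a b c)

theorem torsion_condition_iff {x : M} {J : E x →L[ℝ] E x} (hJ : S.IsAdmissible x J)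
    (T : E x →ₗ[ℝ] E x →ₗ[ℝ] TangentSpace I x) :
    (∀ e₁ ∈ eigenMinus J, ∀ e₂ ∈ eigenMinus J, complexify₂ T e₁ e₂ ∈ S.imEigenMinus J) ↔
    ∀ a b, ∃ c, T a b - T (J a) (J b) = S.anchor x c ∧
      T a (J b) + T (J a) b = S.anchor x (J c) := by
  constructor
  · intro h a b
    have := h _ (hJ.cvec_mem_eigenMinus.2 (rfl : J a = J a)) _ (hJ.cvec_mem_eigenMinus.2 (rfl : J b = J b))
    rw [complexify₂_cvec] at this
    exact (cvec_mem_imEigenMinus hJ).1 this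
  · intro h e₁ h₁ e₂ h₂
    obtain ⟨a, a', rfl⟩ := exists_eq_cvec e₁
    obtain ⟨b, b', rfl⟩ := exists_eq_cvec e₂
    obtain rfl := hJ.cvec_mem_eigenMinus.1 h₁
    obtain rfl := hJ.cvec_mem_eigenMinus.1 h₂
    rw [complexify₂_cvec]
    exact (cvec_mem_imEigenMinus hJ).2 (h a b)

variable {u : ∀ x, HVec k ≃L[ℝ] E x} {U : Set M} (hu : IsSmoothFrame I u U)
  {ψ : M → V} {φ : V → M} {O : Set M} {W : Set V} (h : IsFlatChart I ψ φ O W) (hO : O ⊆ U)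
  {cov : CovariantDerivative I (HVec k) E}

include hu h hO

theorem modelCondition_iff (hfr : ∀ y ∈ U, u y ∈ S.frames y) (hcov : IsSmoothConnection cov)
    {p : EndTotal k E} (hp : p.proj ∈ O) (hJ : S.IsAdmissible p.proj p.2) :
    (∀ q r, ModelCondition (flatAnchor S.anchor u ψ φ) (endChart u ψ p)
      (formCurvature (flatForm cov u ψ φ) (ψ p.proj))
      (formTorsion (flatForm cov u ψ φ) (flatAnchor S.anchor u ψ φ) (ψ p.proj)) q r) ↔
    (∀ X ∈ S.imEigenMinus p.2, ∀ Y ∈ S.imEigenMinus p.2, ∀ e ∈ eigenMinus p.2,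
      complexify₃ (curvatureForm cov hcov p.proj) X Y e ∈ eigenMinus p.2) ∧
    (∀ e₁ ∈ eigenMinus p.2, ∀ e₂ ∈ eigenMinus p.2,
      complexify₂ (anchoredTorsion cov S.anchor S.smooth_anchor p.proj).toLinearMap₁₂ e₁ e₂ ∈
        S.imEigenMinus p.2) := by
  obtain ⟨x, J⟩ := p
  simp only at hp hJ ⊢
  rw [curvature_condition_iff hJ, torsion_condition_iff hJ]
  have hJ' : frameConj (u x) J ∈ unitImLeftMul k := (S.isAdmissible_iff (hfr x (hO hp))).1 hJ
  have hJJ : frameConj (u x) J * frameConj (u x) J = -1 := by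
    obtain ⟨p, hp, hp', e⟩ := hJ'
    rw [e]
    exact leftMul_mul_self hp hp'
  have hρ : ∀ q, flatDeriv I ψ x (S.anchor x (u x q)) = flatAnchor S.anchor u ψ φ (ψ x) q :=
    fun q => (flatAnchor_apply h hp q).symm
  have hJu : ∀ q, J (u x q) = u x (frameConj (u x) J q) := fun q => by simp
  have hT : ∀ q r, flatDeriv I ψ x ((anchoredTorsion cov S.anchor S.smooth_anchor x).toLinearMap₁₂
      (u x q) (u x r)) =
      formTorsion (flatForm cov u ψ φ) (flatAnchor S.anchor u ψ φ) (ψ x) q r := fun q r =>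
    flatDeriv_anchoredTorsion hu h hO S.smooth_anchor hp q r
  have hR := fun q r a => curvatureForm_frame hu h hO hcov hp (S.anchor x (u x q))
    (S.anchor x (u x r)) a
  simp only [hρ] at hR
  simp only [ModelCondition, forall_and]
  rw [and_comm]
  refine and_congr ?_ ?_
  · rw [(u x).surjective.forall]
    refine forall_congr' fun q => ?_
    rw [(u x).surjective.forall]
    refine forall_congr' fun r => ?_
    rw [(u x).surjective.forall]
    -- The model condition is a commutator identity, while preservation of `E^J` is tested vector by
    -- vector.
    refine (commutator_condition_iff hJJ).symm.trans (forall_congr' fun a => ?_)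
    simp only [hJu, LinearMap.sub_apply, LinearMap.add_apply, hR]
    rw [← map_sub, ← map_add, ← map_add, ← map_sub, ← map_add, ← map_sub, hJu, (u x).injective.eq_iff]
    rfl
  · rw [(u x).surjective.forall]
    refine forall_congr' fun q => ?_
    rw [(u x).surjective.forall]
    refine forall_congr' fun r => ?_
    rw [(u x).surjective.exists]
    refine exists_congr fun a => ?_
    simp only [hJu]
    rw [← (h.flatDeriv_injective hp).eq_iff, ← (h.flatDeriv_injective hp).eq_iff, map_sub, map_add,
      hT, hT, hT, hT, hρ, hρ]
    rfl

end Twistor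

/-! ### Transfer of the bracket criterion to the manifold. -/

section Integrability

set_option synthInstance.maxHeartbeats 400000
set_option linter.unusedSectionVars false

variable {B : Type*} [NormedAddCommGroup B] [NormedSpace ℝ B] [FiniteDimensional ℝ B]
  {H : Type*} [TopologicalSpace H] {I : ModelWithCorners ℝ B H}
  {M : Type*} [TopologicalSpace M] [ChartedSpace H M] [IsManifold I ∞ M]
  {k : ℕ}
  {E : M → Type*} [TopologicalSpace (TotalSpace (HVec k) E)]
  [∀ x, AddCommGroup (E x)] [∀ x, Module ℝ (E x)] [∀ x, TopologicalSpace (E x)]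
  [∀ x, IsTopologicalAddGroup (E x)] [∀ x, ContinuousSMul ℝ (E x)]
  [FiberBundle (HVec k) E] [VectorBundle ℝ (HVec k) E] [ContMDiffVectorBundle ∞ (HVec k) E I]
  {V : Type*} [NormedAddCommGroup V] [NormedSpace ℝ V] [FiniteDimensional ℝ V]
  {S : AlmostCoCRQuaternionic I k E}
  {u : ∀ x, HVec k ≃L[ℝ] E x} {U : Set M} (hu : IsSmoothFrame I u U)
  {ψ : M → V} {φ : V → M} {O : Set M} {W : Set V} (h : IsFlatChart I ψ φ O W) (hO : O ⊆ U)
  {cov : CovariantDerivative I (HVec k) E}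

include hu h hO

theorem mem_modelDistribution_flatField (hfr : ∀ y ∈ U, u y ∈ S.frames y)
    {X₁ X₂ : ∀ p : EndTotal k E, TangentSpace (endModel I k) p} {z : V × (HVec k →L[ℝ] HVec k)}
    (hz : z.1 ∈ W) (hS : z.2 ∈ unitImLeftMul k)
    (hX : endChartSymm u φ z ∈ S.twistorBundle →
      cvec (X₁ (endChartSymm u φ z)) (X₂ (endChartSymm u φ z)) ∈
        S.coCRDistribution cov (endChartSymm u φ z)) :
    (flatField (endModel I k) (endChart u ψ) (endChartSymm u φ) X₁ z,
      flatField (endModel I k) (endChart u ψ) (endChartSymm u φ) X₂ z) ∈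
      modelDistribution (flatForm cov u ψ φ) (flatAnchor S.anchor u ψ φ) (imLeftMul k) z := by
  have hc := isFlatChart_endChart (E := E) hu h hO
  have hp : (endChartSymm (E := E) u φ z).proj ∈ O := h.map_target _ hz
  have hfx := hfr _ (hO hp)
  have hJ : S.IsAdmissible (endChartSymm u φ z).proj (endChartSymm u φ z).2 :=
    (S.isAdmissible_iff hfx).2 (by
      rw [show frameConj (u (endChartSymm u φ z).proj) (endChartSymm u φ z).2 = z.2 from
        frameConj_frameUnconj _ _]
      exact hS)
  have h1 := mem_modelDistribution_of_mem hu h hO hp hfx hJ (hX hJ)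
  rwa [hc.right_inv z ⟨hz, trivial⟩] at h1

-- Brackets, the distribution and smoothness all pass to flat coordinates, where
-- `lieBracket_mem_iff` decides. The right-hand side involves the fields only through `q` and `r`,
-- that is, through their projections at `p`.
set_option maxHeartbeats 1000000 in
theorem cvec_mlieBracket_mem_iff (hfr : ∀ y ∈ U, u y ∈ S.frames y)
    (hcov : IsSmoothConnection cov) (hcomp : S.IsCompatible cov) {p : EndTotal k E}
    (hp : p.proj ∈ O) (hJ : S.IsAdmissible p.proj p.2)
    {X₁ X₂ Y₁ Y₂ : ∀ p : EndTotal k E, TangentSpace (endModel I k) p}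
    (hX₁ : ContMDiffAt (endModel I k) (endModel I k).tangent ∞
      (fun p => (⟨p, X₁ p⟩ : TangentBundle (endModel I k) (EndTotal k E))) p)
    (hX₂ : ContMDiffAt (endModel I k) (endModel I k).tangent ∞
      (fun p => (⟨p, X₂ p⟩ : TangentBundle (endModel I k) (EndTotal k E))) p)
    (hY₁ : ContMDiffAt (endModel I k) (endModel I k).tangent ∞
      (fun p => (⟨p, Y₁ p⟩ : TangentBundle (endModel I k) (EndTotal k E))) p)
    (hY₂ : ContMDiffAt (endModel I k) (endModel I k).tangent ∞
      (fun p => (⟨p, Y₂ p⟩ : TangentBundle (endModel I k) (EndTotal k E))) p)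
    (hX : ∀ᶠ p in 𝓝 p, p ∈ S.twistorBundle → cvec (X₁ p) (X₂ p) ∈ S.coCRDistribution cov p)
    (hY : ∀ᶠ p in 𝓝 p, p ∈ S.twistorBundle → cvec (Y₁ p) (Y₂ p) ∈ S.coCRDistribution cov p)
    {q r : HVec k}
    (hq : (flatDeriv (endModel I k) (endChart u ψ) p (X₁ p)).1 =
        flatAnchor S.anchor u ψ φ (ψ p.proj) q ∧
      (flatDeriv (endModel I k) (endChart u ψ) p (X₂ p)).1 =
        flatAnchor S.anchor u ψ φ (ψ p.proj) (frameConj (u p.proj) p.2 q))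
    (hr : (flatDeriv (endModel I k) (endChart u ψ) p (Y₁ p)).1 =
        flatAnchor S.anchor u ψ φ (ψ p.proj) r ∧
      (flatDeriv (endModel I k) (endChart u ψ) p (Y₂ p)).1 =
        flatAnchor S.anchor u ψ φ (ψ p.proj) (frameConj (u p.proj) p.2 r)) :
    cvec (VectorField.mlieBracket (endModel I k) X₁ Y₁ p -
        VectorField.mlieBracket (endModel I k) X₂ Y₂ p)
      (VectorField.mlieBracket (endModel I k) X₁ Y₂ p +
        VectorField.mlieBracket (endModel I k) X₂ Y₁ p) ∈ S.coCRDistribution cov p ↔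
    ModelCondition (flatAnchor S.anchor u ψ φ) (endChart u ψ p)
      (formCurvature (flatForm cov u ψ φ) (ψ p.proj))
      (formTorsion (flatForm cov u ψ φ) (flatAnchor S.anchor u ψ φ) (ψ p.proj)) q r := by
  have : CompleteSpace B := FiniteDimensional.complete ℝ B
  have : CompleteSpace V := FiniteDimensional.complete ℝ V
  have hc := isFlatChart_endChart (E := E) hu h hO
  have hfx := hfr _ (hO hp)
  have hz := hc.map_source p hp
  have hl := hc.left_inv p hp
  have hd : ∀ {X : ∀ p : EndTotal k E, TangentSpace (endModel I k) p},
      ContMDiffAt (endModel I k) (endModel I k).tangent ∞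
        (fun p => (⟨p, X p⟩ : TangentBundle (endModel I k) (EndTotal k E))) p →
      DifferentiableAt ℝ (flatField (endModel I k) (endChart u ψ) (endChartSymm u φ) X)
        (endChart u ψ p) := fun {X} hX =>
    (hc.contDiffAt_flatField hz (by rwa [hl])).differentiableAt (by simp)
  have hm : ∀ {X : ∀ p : EndTotal k E, TangentSpace (endModel I k) p},
      ContMDiffAt (endModel I k) (endModel I k).tangent ∞
        (fun p => (⟨p, X p⟩ : TangentBundle (endModel I k) (EndTotal k E))) p →
      MDifferentiableAt (endModel I k) (endModel I k).tangent
        (fun p => (⟨p, X p⟩ : TangentBundle (endModel I k) (EndTotal k E))) p := fun {X} hX => hX.mdifferentiableAt (by simp)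
  have hmem : ∀ {X₁ X₂ : ∀ p : EndTotal k E, TangentSpace (endModel I k) p},
      (∀ᶠ p in 𝓝 p, p ∈ S.twistorBundle → cvec (X₁ p) (X₂ p) ∈ S.coCRDistribution cov p) →
      ∀ᶠ z in 𝓝 (endChart u ψ p), z.2 ∈ unitImLeftMul k →
        (flatField (endModel I k) (endChart u ψ) (endChartSymm u φ) X₁ z,
          flatField (endModel I k) (endChart u ψ) (endChartSymm u φ) X₂ z) ∈
        modelDistribution (flatForm cov u ψ φ) (flatAnchor S.anchor u ψ φ) (imLeftMul k) z := by
    intro X₁ X₂ hX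
    have hcont : ContinuousAt (endChartSymm (E := E) u φ) (endChart u ψ p) :=
      (hc.contMDiffAt_symm hz).continuousAt
    rw [ContinuousAt, hl] at hcont
    filter_upwards [hcont.eventually hX, hc.isOpen_target.mem_nhds hz] with z hz1 hz2 hS
    exact mem_modelDistribution_flatField hu h hO hfr hz2.1 hS hz1
  rw [cvec_mem_coCRDistribution hu h hO hp hfx hJ, map_sub, map_add,
    hc.flatDeriv_mlieBracket hp (hm hX₁) (hm hY₁), hc.flatDeriv_mlieBracket hp (hm hX₂) (hm hY₂),
    hc.flatDeriv_mlieBracket hp (hm hX₁) (hm hY₂), hc.flatDeriv_mlieBracket hp (hm hX₂) (hm hY₁)]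
  refine (isTwistorModel hu h hO hfr hcov hcomp).lieBracket_mem_iff hz.1
    ((S.isAdmissible_iff hfx).1 hJ) (hd hX₁) (hd hX₂) (hd hY₁) (hd hY₂) (hmem hX) (hmem hY) ?_ ?_
  · rw [hc.flatField_apply hp, hc.flatField_apply hp]
    exact hq
  · rw [hc.flatField_apply hp, hc.flatField_apply hp]
    exact hr

end Integrability

/-! ### Horizontal test fields in the local model. -/

section HorizontalField

set_option synthInstance.maxHeartbeats 400000

variable {B F : Type*} [NormedAddCommGroup B] [NormedSpace ℝ B]
  [NormedAddCommGroup F] [NormedSpace ℝ F]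

/-- The horizontal lift, with respect to `d + Γ`, of a vector field depending on the endomorphism. -/
def horizontalField (Γ : B → B →L[ℝ] F →L[ℝ] F) (ξ : B × (F →L[ℝ] F) → B)
    (z : B × (F →L[ℝ] F)) : B × (F →L[ℝ] F) :=
  (ξ z, z.2 * Γ z.1 (ξ z) - Γ z.1 (ξ z) * z.2)

theorem vertPart_horizontalField (Γ : B → B →L[ℝ] F →L[ℝ] F) (ξ : B × (F →L[ℝ] F) → B)
    (z : B × (F →L[ℝ] F)) : vertPart Γ z (horizontalField Γ ξ z) = 0 := by
  simp only [vertPart, horizontalField]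
  abel

theorem contDiffAt_horizontalField {Γ : B → B →L[ℝ] F →L[ℝ] F} {ξ : B × (F →L[ℝ] F) → B}
    {z : B × (F →L[ℝ] F)} (hΓ : ContDiffAt ℝ ∞ Γ z.1) (hξ : ContDiffAt ℝ ∞ ξ z) :
    ContDiffAt ℝ ∞ (horizontalField Γ ξ) z := by
  have h1 : ContDiffAt ℝ ∞ (fun z : B × (F →L[ℝ] F) => Γ z.1 (ξ z)) z :=
    (hΓ.comp z contDiffAt_fst).clm_apply hξ
  exact hξ.prodMk ((contDiffAt_snd.mul h1).sub (h1.mul contDiffAt_snd))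

theorem contDiffAt_anchor_apply {ρ : B → F →L[ℝ] B} {z : B × (F →L[ℝ] F)}
    (hρ : ContDiffAt ℝ ∞ ρ z.1) (q : F) :
    ContDiffAt ℝ ∞ (fun z : B × (F →L[ℝ] F) => ρ z.1 q) z ∧
      ContDiffAt ℝ ∞ (fun z : B × (F →L[ℝ] F) => ρ z.1 (z.2 q)) z :=
  ⟨(hρ.comp z contDiffAt_fst).clm_apply contDiffAt_const,
    (hρ.comp z contDiffAt_fst).clm_apply (contDiffAt_snd.clm_apply contDiffAt_const)⟩

theorem horizontalField_mem_modelDistribution (Γ : B → B →L[ℝ] F →L[ℝ] F) (ρ : B → F →L[ℝ] B)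
    (L : Submodule ℝ (F →L[ℝ] F)) (q : F) (z : B × (F →L[ℝ] F)) :
    (horizontalField Γ (fun z => ρ z.1 q) z, horizontalField Γ (fun z => ρ z.1 (z.2 q)) z) ∈
      modelDistribution Γ ρ L z := by
  refine ⟨?_, q, rfl, rfl⟩
  simp only [vertPart_horizontalField]
  exact ⟨L.zero_mem, by simp, by simp⟩

end HorizontalField

/-! ### The two implications. -/

section Integrability

set_option synthInstance.maxHeartbeats 400000
set_option linter.unusedSectionVars false

variable {B : Type*} [NormedAddCommGroup B] [NormedSpace ℝ B] [FiniteDimensional ℝ B]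
  {H : Type*} [TopologicalSpace H] {I : ModelWithCorners ℝ B H} [I.Boundaryless]
  {M : Type*} [TopologicalSpace M] [ChartedSpace H M] [IsManifold I ∞ M]
  {k : ℕ}
  {E : M → Type*} [TopologicalSpace (TotalSpace (HVec k) E)]
  [∀ x, AddCommGroup (E x)] [∀ x, Module ℝ (E x)] [∀ x, TopologicalSpace (E x)]
  [∀ x, IsTopologicalAddGroup (E x)] [∀ x, ContinuousSMul ℝ (E x)]
  [FiberBundle (HVec k) E] [VectorBundle ℝ (HVec k) E] [ContMDiffVectorBundle ∞ (HVec k) E I]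

/-- Around each point there are a smooth frame and flat coordinates. -/
theorem QuaternionicBundle.exists_frame_chart (Q : QuaternionicBundle I k E) (x : M) :
    ∃ (u : ∀ y, HVec k ≃L[ℝ] E y) (U O : Set M) (ψ : M → B) (φ : B → M) (W : Set B),
      IsSmoothFrame I u U ∧ (∀ y ∈ U, u y ∈ Q.frames y) ∧ IsFlatChart I ψ φ O W ∧ O ⊆ U ∧
        x ∈ O := by
  have : CompleteSpace B := FiniteDimensional.complete ℝ B
  obtain ⟨U, hU, hx, u, hfr, hu⟩ := Q.exists_smooth_frame x
  exact ⟨u, U, _, _, _, _, ⟨hU, hu⟩, hfr, isFlatChart_extChartAt x hU, Set.inter_subset_left,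
    hx, mem_extChartAt_source x⟩

variable {S : AlmostCoCRQuaternionic I k E} {cov : CovariantDerivative I (HVec k) E}

theorem isIntegrableAlong_of_forall (hcov : IsSmoothConnection cov) (hcomp : S.IsCompatible cov)
    (hRT : ∀ (x : M) (J : E x →L[ℝ] E x), S.IsAdmissible x J →
        (∀ X ∈ S.imEigenMinus J, ∀ Y ∈ S.imEigenMinus J, ∀ e ∈ eigenMinus J,
          complexify₃ (curvatureForm cov hcov x) X Y e ∈ eigenMinus J) ∧
        (∀ e₁ ∈ eigenMinus J, ∀ e₂ ∈ eigenMinus J,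
          complexify₂ (anchoredTorsion cov S.anchor S.smooth_anchor x).toLinearMap₁₂ e₁ e₂ ∈
            S.imEigenMinus J)) :
    IsIntegrableAlong (endModel I k) S.twistorBundle (S.coCRDistribution cov) := by
  intro U' X₁ X₂ Y₁ Y₂ hU' hX₁ hX₂ hY₁ hY₂ hX hY p hp
  obtain ⟨u, U, O, ψ, φ, W, hu, hfr, h, hO, hx⟩ := S.exists_frame_chart p.proj
  have hJ : S.IsAdmissible p.proj p.2 := hp.2
  have hfx := hfr _ (hO hx)
  have hn := hU'.mem_nhds hp.1
  obtain ⟨-, q, hq⟩ := mem_modelDistribution_of_mem hu h hO hx hfx hJ (hX p hp)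
  obtain ⟨-, r, hr⟩ := mem_modelDistribution_of_mem hu h hO hx hfx hJ (hY p hp)
  refine (cvec_mlieBracket_mem_iff hu h hO hfr hcov hcomp hx hJ (hX₁.contMDiffAt hn)
    (hX₂.contMDiffAt hn) (hY₁.contMDiffAt hn) (hY₂.contMDiffAt hn) ?_ ?_ hq hr).2 ?_
  · filter_upwards [hn] with p' h1 h2 using hX p' ⟨h1, h2⟩
  · filter_upwards [hn] with p' h1 h2 using hY p' ⟨h1, h2⟩
  -- Only the vectors `q`, `r` of the given fields at `p` matter, and the hypothesis at `J` covers
  -- all of them.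
  · exact (modelCondition_iff hu h hO hfr hcov hx hJ).2 (hRT _ _ hJ) q r

theorem forall_of_isIntegrableAlong (hcov : IsSmoothConnection cov) (hcomp : S.IsCompatible cov)
    (hint : IsIntegrableAlong (endModel I k) S.twistorBundle (S.coCRDistribution cov))
    (x : M) (J : E x →L[ℝ] E x) (hJ : S.IsAdmissible x J) :
    (∀ X ∈ S.imEigenMinus J, ∀ Y ∈ S.imEigenMinus J, ∀ e ∈ eigenMinus J,
      complexify₃ (curvatureForm cov hcov x) X Y e ∈ eigenMinus J) ∧
    (∀ e₁ ∈ eigenMinus J, ∀ e₂ ∈ eigenMinus J,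
      complexify₂ (anchoredTorsion cov S.anchor S.smooth_anchor x).toLinearMap₁₂ e₁ e₂ ∈
        S.imEigenMinus J) := by
  have : CompleteSpace B := FiniteDimensional.complete ℝ B
  obtain ⟨u, U, O, ψ, φ, W, hu, hfr, h, hO, hx⟩ := S.exists_frame_chart x
  have hc := isFlatChart_endChart (E := E) hu h hO
  let p : EndTotal k E := ⟨x, J⟩
  have hp : p.proj ∈ O := hx
  refine (modelCondition_iff (p := p) hu h hO hfr hcov hp hJ).1 fun q r => ?_
  set Γ := flatForm cov u ψ φ with hΓ
  set ρ := flatAnchor S.anchor u ψ φ with hρ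
  -- `X₁ q + i X₂ q` is the horizontal lift of `ρ (q + i J q)`, with `q` constant in the frame.
  -- These fields are smooth over `O`, are sections of the distribution along `Z`, and have any
  -- prescribed `q` at the given point.
  let X₁ : HVec k → ∀ p : EndTotal k E, TangentSpace (endModel I k) p := fun q =>
    unflatField (endModel I k) (endChart u ψ) (horizontalField Γ fun z => ρ z.1 q)
  let X₂ : HVec k → ∀ p : EndTotal k E, TangentSpace (endModel I k) p := fun q =>
    unflatField (endModel I k) (endChart u ψ) (horizontalField Γ fun z => ρ z.1 (z.2 q))
  have hD₁ : ∀ q, ∀ p : EndTotal k E, p.proj ∈ O →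
      flatDeriv (endModel I k) (endChart u ψ) p (X₁ q p) =
        horizontalField Γ (fun z => ρ z.1 q) (endChart u ψ p) :=
    fun q p hp => hc.flatDeriv_unflatField hp _
  have hD₂ : ∀ q, ∀ p : EndTotal k E, p.proj ∈ O →
      flatDeriv (endModel I k) (endChart u ψ) p (X₂ q p) =
        horizontalField Γ (fun z => ρ z.1 (z.2 q)) (endChart u ψ p) :=
    fun q p hp => hc.flatDeriv_unflatField hp _
  have hX₁ : ∀ q, ∀ p : EndTotal k E, p.proj ∈ O →
      ContMDiffAt (endModel I k) (endModel I k).tangent ∞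
        (fun p => (⟨p, X₁ q p⟩ : TangentBundle (endModel I k) (EndTotal k E))) p :=
    fun q p hp => hc.contMDiffAt_unflatField hp (contDiffAt_horizontalField
      (contDiffAt_flatForm hu h hO hcov (h.map_source _ hp))
      (contDiffAt_anchor_apply (contDiffAt_flatAnchor hu h hO S.smooth_anchor
        (h.map_source _ hp)) q).1)
  have hX₂ : ∀ q, ∀ p : EndTotal k E, p.proj ∈ O →
      ContMDiffAt (endModel I k) (endModel I k).tangent ∞
        (fun p => (⟨p, X₂ q p⟩ : TangentBundle (endModel I k) (EndTotal k E))) p :=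
    fun q p hp => hc.contMDiffAt_unflatField hp (contDiffAt_horizontalField
      (contDiffAt_flatForm hu h hO hcov (h.map_source _ hp))
      (contDiffAt_anchor_apply (contDiffAt_flatAnchor hu h hO S.smooth_anchor
        (h.map_source _ hp)) q).2)
  have hX : ∀ q, ∀ p : EndTotal k E, p.proj ∈ O → p ∈ S.twistorBundle →
      cvec (X₁ q p) (X₂ q p) ∈ S.coCRDistribution cov p := by
    intro q p hp hJ
    refine mem_coCRDistribution_of_mem hu h hO hp (hfr _ (hO hp)) hJ ?_
    rw [hD₁ q p hp, hD₂ q p hp]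
    exact horizontalField_mem_modelDistribution Γ ρ (imLeftMul k) q (endChart u ψ p)
  have hOopen : IsOpen ((TotalSpace.proj : EndTotal k E → M) ⁻¹' O) := hc.isOpen_source
  have hev : ∀ q, ∀ᶠ p in 𝓝 p, p ∈ S.twistorBundle →
      cvec (X₁ q p) (X₂ q p) ∈ S.coCRDistribution cov p := by
    intro q
    filter_upwards [hOopen.mem_nhds hp] with p' h1 h2 using hX q p' h1 h2
  refine (cvec_mlieBracket_mem_iff hu h hO hfr hcov hcomp hp hJ (hX₁ q p hp) (hX₂ q p hp)
    (hX₁ r p hp) (hX₂ r p hp) (hev q) (hev r) ?_ ?_).1 ?_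
  · rw [hD₁ q p hp, hD₂ q p hp]
    exact ⟨rfl, rfl⟩
  · rw [hD₁ r p hp, hD₂ r p hp]
    exact ⟨rfl, rfl⟩
  · exact hint _ (X₁ q) (X₂ q) (X₁ r) (X₂ r) hOopen
      (fun p hp => (hX₁ q p hp).contMDiffWithinAt) (fun p hp => (hX₂ q p hp).contMDiffWithinAt)
      (fun p hp => (hX₁ r p hp).contMDiffWithinAt) (fun p hp => (hX₂ r p hp).contMDiffWithinAt)
      (fun p hp => hX q p hp.1 hp.2) (fun p hp => hX r p hp.1 hp.2) p ⟨hp, hJ⟩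

end Integrability

end

theorem theorem2p1 {n k : ℕ} {M : Type*} [TopologicalSpace M] [T2Space M]
    [SecondCountableTopology M] [ChartedSpace (EuclideanSpace ℝ (Fin n)) M] [IsManifold (𝓡 n) ∞ M]
    {E : M → Type*} [TopologicalSpace (TotalSpace (HVec k) E)]
    [∀ x, AddCommGroup (E x)] [∀ x, Module ℝ (E x)] [∀ x, TopologicalSpace (E x)]
    [∀ x, IsTopologicalAddGroup (E x)] [∀ x, ContinuousSMul ℝ (E x)]
    [FiberBundle (HVec k) E] [VectorBundle ℝ (HVec k) E]
    [ContMDiffVectorBundle ∞ (HVec k) E (𝓡 n)]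
    (S : AlmostCoCRQuaternionic (𝓡 n) k E)
    (cov : CovariantDerivative (𝓡 n) (HVec k) E) (hcov : IsSmoothConnection cov)
    (hcomp : S.IsCompatible cov) :
    IsIntegrableAlong (endModel (𝓡 n) k) S.twistorBundle (S.coCRDistribution cov) ↔
      ∀ (x : M) (J : E x →L[ℝ] E x), S.IsAdmissible x J →
        (∀ X ∈ S.imEigenMinus J, ∀ Y ∈ S.imEigenMinus J, ∀ e ∈ eigenMinus J,
          complexify₃ (curvatureForm cov hcov x) X Y e ∈ eigenMinus J) ∧
        (∀ e₁ ∈ eigenMinus J, ∀ e₂ ∈ eigenMinus J,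
          complexify₂ (anchoredTorsion cov S.anchor S.smooth_anchor x).toLinearMap₁₂ e₁ e₂ ∈
            S.imEigenMinus J) := by
  exact ⟨fun hint x J hJ => forall_of_isIntegrableAlong hcov hcomp hint x J hJ,
    isIntegrableAlong_of_forall hcov hcomp⟩
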